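/- Let $k$ be a field of characteristic not $2$, $k^s$ a separable closure of $k$, $f\in k[X]$ a separable polynomial of degree $6$ and $\Omega\subset k^s$ its set of roots. Let $C$ be the smooth projective curve of genus $2$ with affine model $y^2=f(x)$ and $J$ its Jacobian. Put $L=k[X]/(f)$ and $L^s=L\otimes_k k^s$; for $\omega\in\Omega$ let $\varphi_\omega\colon L^s\to k^s$ be the $k^s$-algebra map sending $X$ to $\omega$, and let $N$ denote the norms $L\to k$ and $L^s\to k^s$. Write $\mu_2(R)=\{x\in R^*: x^2=1\}$, $M=\ker(N\colon\mu_2(L^s)\to\mu_2(k^s))$, and $\mathrm H^i(A)$ for the continuous cohomology $\mathrm H^i(\mathrm{Gal}(k^s/k),A)$ of a discrete Galois module $A$. Let $\Gamma\subset L^*\times k^*$ be the group of pairs $(\delta,n)$ with $N(\delta)=n^2$, and let $\chi\colon L^*\to\Gamma$, $\chi(\varepsilon)=(\varepsilon^2,N(\varepsilon))$. For distinct $\omega_1,\omega_2\in\Omega$ let $\alpha_{\omega_1,\omega_2}\in M$ be the element with $\varphi_\omega(\alpha_{\omega_1,\omega_2})=-1$ if $\omega\in\{\omega_1,\omega_2\}$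 and $=1$ otherwise. Let $\beta\colon M\to J[2](k^s)$ and $\epsilon\colon J[2](k^s)\to\mu_2(L^s)/\mu_2(k^s)$ be the unique homomorphisms such that, for all distinct $\omega_1,\omega_2$, $\beta$ sends $\alpha_{\omega_1,\omega_2}$ to the class of $((\omega_1,0))-((\omega_2,0))$ and $\epsilon$ sends the class of $((\omega_1,0))-((\omega_2,0))$ to the class of $\alpha_{\omega_1,\omega_2}$; they exist and are Galois equivariant, and they induce $\beta_*\colon\mathrm H^1(M)\to\mathrm H^1(J[2])$ and $\epsilon_*\colon\mathrm H^1(J[2])\to\mathrm H^1(\mu_2(L^s)/\mu_2(k^s))$. Identify $\mathrm H^1(\mu_2(L^s))$ with $L^*/(L^*)^2$ by the Kummer isomorphism, under which the class of $\delta\in L^*$ corresponds to the class of $\sigma\mapsto\sigma(\varepsilon)/\varepsilon$ for any $\varepsilon\in L^s$ with $\varepsilon^2=\delta$. Let $\Upsilon\colon\mathrm H^1(J[2])\to\mathrm{Br}(k)[2]$, with $\mathrm{Br}(k)=\mathrm H^2((k^s)^*)$, be the connecting homomorphism of $1\to\mu_2(k^s)\to M\xrightarrow{\beta}J[2](k^s)\to1$,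 and let $\kappa\colon\ker\Upsilon\to L^*/(L^*)^2k^*$ be the homomorphism induced by $\epsilon_*$: it is the unique homomorphism such that whenever $\kappa(\xi)$ is the class of $\delta$, the class $\epsilon_*(\xi)$ is the image of $\delta$ under $L^*/(L^*)^2\cong\mathrm H^1(\mu_2(L^s))\to\mathrm H^1(\mu_2(L^s)/\mu_2(k^s))$. Then: 1. For every $(\delta,n)\in\Gamma$ there is $\varepsilon\in (L^s)^*$ with $\varepsilon^2=\delta$ and $N(\varepsilon)=n$, and there is a unique isomorphism $\gamma\colon\Gamma/\operatorname{im}(\chi)\to\mathrm H^1(M)$ that sends the class of each $(\delta,n)$ to the class of the cocycle $\sigma\mapsto\sigma(\varepsilon)/\varepsilon$, for any such $\varepsilon$. 2. The composition of $\gamma$ with the map $\mathrm H^1(M)\to\mathrm H^1(\mu_2(L^s))\cong L^*/(L^*)^2$ induced by the inclusion $M\subset\mu_2(L^s)$ sends the class of $(\delta,n)$ to the class of $\delta$. 3. $\ker\epsilon_*=\ker\kappa$ as subgroups of $\mathrm H^1(J[2])$, and this group is generated by $\beta_*(\gamma(1,-1))$, where $(1,-1)$ stands for its class in $\Gamma/\operatorname{im}(\chi)$.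 -/

import Mathlib

open Polynomial TensorProduct WithZero

noncomputable section

namespace TwoDescent

/-! ### Group actions on subgroups, quotients and base changes -/

/-- The action of `G` on a `G`-stable subgroup. -/
@[reducible]
def stableSubgroupAction {G A : Type*} [Group G] [CommGroup A] [MulDistribMulAction G A]
    (H : Subgroup A) (hH : ∀ (g : G), ∀ a ∈ H, g • a ∈ H) : MulDistribMulAction G H where
  smul g a := ⟨g • (a : A), hH g a a.2⟩
  one_smul a := Subtype.ext (one_smul G (a : A))
  mul_smul g h a := Subtype.ext (mul_smul g h (a : A))
  smul_mul g a b := Subtype.ext (smul_mul' g (a : A) (b : A))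
  smul_one g := Subtype.ext (smul_one g)

/-- The action of `G` on the quotient by a `G`-stable subgroup. -/
@[reducible]
def stableQuotientAction {G A : Type*} [Group G] [CommGroup A] [MulDistribMulAction G A]
    (H : Subgroup A) (hH : ∀ (g : G), ∀ a ∈ H, g • a ∈ H) : MulDistribMulAction G (A ⧸ H) where
  smul g := QuotientGroup.map H H (MulDistribMulAction.toMonoidHom A g) (fun a ha => hH g a ha)
  one_smul a := by
    induction a using QuotientGroup.induction_on with
    | H a => exact congrArg (QuotientGroup.mk' H) (one_smul G a)
  mul_smul g h a := by
    induction a using QuotientGroup.induction_on with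
    | H a => exact congrArg (QuotientGroup.mk' H) (mul_smul g h a)
  smul_mul g a b := map_mul _ a b
  smul_one g := map_one _

section BaseChange

variable {k : Type*} [Field k] {K : Type*} [Field K] [Algebra k K] {B : Type*} [CommRing B]
  [Algebra k B]

/-- The Galois action on `K ⊗[k] B` through the first factor, `σ (c ⊗ b) = σ c ⊗ b`. -/
instance baseChangeAction : MulSemiringAction Gal(K/k) (K ⊗[k] B) where
  smul_one σ := by
    rw [Algebra.TensorProduct.one_def, TensorProduct.smul_tmul', smul_one]
  smul_mul σ x y := by
    induction x using TensorProduct.induction_on with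
    | zero => simp
    | add x₁ x₂ h₁ h₂ => simp [add_mul, smul_add, h₁, h₂]
    | tmul a b =>
      induction y using TensorProduct.induction_on with
      | zero => simp
      | add y₁ y₂ h₁ h₂ => simp only [mul_add, smul_add, h₁, h₂]
      | tmul c d =>
        simp only [Algebra.TensorProduct.tmul_mul_tmul, TensorProduct.smul_tmul', smul_mul']

/-- The Galois action on the units of `K ⊗[k] B`. -/
instance baseChangeUnitsAction : MulDistribMulAction Gal(K/k) (K ⊗[k] B)ˣ :=
  Units.mulDistribMulActionRight

end BaseChange

/-! ### Continuous cohomology in degrees one and two with discrete coefficients -/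

section Cohomology

variable (G : Type*) [Group G] [TopologicalSpace G] (A : Type*) [CommGroup A]
  [MulDistribMulAction G A]

/-- Continuous 1-cocycles `c(στ) = σ(c(τ)) c(σ)`, for the discrete topology on `A`. -/
def Z1 : Subgroup (G → A) where
  carrier := {c | IsLocallyConstant c ∧ groupCohomology.IsMulCocycle₁ c}
  one_mem' := ⟨IsLocallyConstant.const 1, fun g h => by simp⟩
  mul_mem' := fun {a b} ha hb => ⟨ha.1.mul hb.1, fun g h => by
    simp only [Pi.mul_apply, ha.2 g h, hb.2 g h, smul_mul']; exact mul_mul_mul_comm _ _ _ _⟩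
  inv_mem' := fun {a} ha => ⟨ha.1.inv, fun g h => by
    simp only [Pi.inv_apply, ha.2 g h, smul_inv', mul_inv]⟩

/-- The 1-coboundaries `σ ↦ σ(a) / a`. -/
def B1 : Subgroup (Z1 G A) where
  carrier := {c | groupCohomology.IsMulCoboundary₁ (c : G → A)}
  one_mem' := ⟨1, fun g => by simp⟩
  mul_mem' := by
    rintro a b ⟨x, hx⟩ ⟨y, hy⟩
    exact ⟨x * y, fun g => by
      simp only [Subgroup.coe_mul, Pi.mul_apply, ← hx, ← hy, smul_mul', mul_div_mul_comm]⟩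
  inv_mem' := by
    rintro a ⟨x, hx⟩
    exact ⟨x⁻¹, fun g => by
      simp only [Subgroup.coe_inv, Pi.inv_apply, ← hx, smul_inv', inv_div_inv, inv_div]⟩

/-- The first cohomology group of `G` with values in the discrete module `A`. -/
def H1 : Type _ := Z1 G A ⧸ B1 G A

instance : CommGroup (H1 G A) := inferInstanceAs (CommGroup (Z1 G A ⧸ B1 G A))

variable {G A} in
/-- The class of a 1-cocycle. -/
def H1.mk : Z1 G A →* H1 G A := QuotientGroup.mk' (B1 G A)

/-- Continuous 2-cocycles, for the discrete topology on `A`. -/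
def Z2 : Subgroup (G × G → A) where
  carrier := {c | IsLocallyConstant c ∧ groupCohomology.IsMulCocycle₂ c}
  one_mem' := ⟨IsLocallyConstant.const 1, fun g h j => by simp⟩
  mul_mem' := fun {a b} ha hb => ⟨ha.1.mul hb.1, fun g h j => by
    have h1 := ha.2 g h j
    have h2 := hb.2 g h j
    simp only [Pi.mul_apply, smul_mul']
    rw [mul_mul_mul_comm, h1, h2, mul_mul_mul_comm]⟩
  inv_mem' := fun {a} ha => ⟨ha.1.inv, fun g h j => by
    have h1 := ha.2 g h j
    simp only [Pi.inv_apply, smul_inv', ← mul_inv, h1]⟩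

/-- The 2-coboundaries of continuous 1-cochains. -/
def B2 : Subgroup (Z2 G A) where
  carrier := {c | ∃ x : G → A, IsLocallyConstant x ∧
    ∀ g h : G, g • x h / x (g * h) * x g = (c : G × G → A) (g, h)}
  one_mem' := ⟨1, IsLocallyConstant.const 1, fun g h => by simp⟩
  mul_mem' := by
    rintro a b ⟨x, hx, hx'⟩ ⟨y, hy, hy'⟩
    refine ⟨x * y, hx.mul hy, fun g h => ?_⟩
    simp only [Subgroup.coe_mul, Pi.mul_apply, ← hx', ← hy', smul_mul', mul_div_mul_comm]
    exact mul_mul_mul_comm _ _ _ _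
  inv_mem' := by
    rintro a ⟨x, hx, hx'⟩
    refine ⟨x⁻¹, hx.inv, fun g h => ?_⟩
    simp only [Subgroup.coe_inv, Pi.inv_apply, ← hx', smul_inv', inv_div_inv, mul_inv, inv_div]

/-- The second cohomology group of `G` with values in the discrete module `A`. -/
def H2 : Type _ := Z2 G A ⧸ B2 G A

instance : CommGroup (H2 G A) := inferInstanceAs (CommGroup (Z2 G A ⧸ B2 G A))

variable {G A} in
/-- The class of a 2-cocycle. -/
def H2.mk : Z2 G A →* H2 G A := QuotientGroup.mk' (B2 G A)

variable {G A} {B : Type*} [CommGroup B] [MulDistribMulAction G B]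

/-- The map on 1-cocycles induced by an equivariant homomorphism. -/
def Z1.map (φ : A →*[G] B) : Z1 G A →* Z1 G B where
  toFun c := ⟨fun g => φ ((c : G → A) g), c.2.1.comp φ, fun g h => by
    simp only [c.2.2 g h, map_mul, map_smul]⟩
  map_one' := Subtype.ext (funext fun _ => map_one φ)
  map_mul' a b := Subtype.ext (funext fun _ => map_mul φ _ _)

/-- The map on `H1` induced by an equivariant homomorphism. -/
def H1.map (φ : A →*[G] B) : H1 G A →* H1 G B :=
  QuotientGroup.map (B1 G A) (B1 G B) (Z1.map φ) (by
    rintro c ⟨x, hx⟩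
    exact ⟨φ x, fun g => by rw [← map_smul, ← _root_.map_div, hx]; rfl⟩)

end Cohomology

variable {k : Type*} [Field k] (f : k[X]) (K : Type*) [Field K] [Algebra k K]

/-! ### The étale algebra `L = k[X]/f`, the modules `μ₂(L_K)`, `M` and `μ₂(L_K)/μ₂(K)` -/

/-- `L = k[X]/f`. -/
abbrev EtAlg : Type _ := AdjoinRoot f

/-- `L_K = K ⊗ L`; for `K` a separable closure of `k` this is the separable algebra `Lˢ`. -/
abbrev EtAlgSep : Type _ := K ⊗[k] EtAlg f

variable {f K} in
/-- The inclusion `L → L_K` on units. -/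
def unitsIncl : (EtAlg f)ˣ →* (EtAlgSep f K)ˣ :=
  Units.map (Algebra.TensorProduct.includeRight : EtAlg f →ₐ[k] EtAlgSep f K).toMonoidHom

/-- The `K`-algebra map `φ_ω : L_K → K` sending `X` to the root `ω`. -/
def evalRoot (ω : f.rootSet K) : EtAlgSep f K →ₐ[K] K :=
  Algebra.TensorProduct.lift (AlgHom.id K K)
    (AdjoinRoot.liftAlgHom f (Algebra.ofId k K) (ω : K) (by
      have := Polynomial.aeval_eq_zero_of_mem_rootSet ω.2
      simpa [Polynomial.aeval_def] using this))
    (fun _ _ => mul_comm _ _)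

/-- The group `μ₂(L_K)`. -/
abbrev Mu2 : Type _ := rootsOfUnity 2 (EtAlgSep f K)

/-- `M`, the kernel of the norm `N : μ₂(L_K) → μ₂(K)`, as a subgroup of the units of `L_K`. -/
def normOneMu2 : Subgroup (EtAlgSep f K)ˣ :=
  rootsOfUnity 2 (EtAlgSep f K) ⊓ (Units.map (Algebra.norm K)).ker

/-- The Galois module `M`. -/
abbrev MGrp : Type _ := normOneMu2 f K

variable {f K} in
theorem norm_galois_smul (σ : Gal(K/k)) (a : EtAlgSep f K) :
    Algebra.norm K (σ • a) = σ (Algebra.norm K a) := by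
  have h := Algebra.norm_eq_of_equiv_equiv (A₁ := K) (A₂ := K)
    (B₁ := EtAlgSep f K) (B₂ := EtAlgSep f K) (σ : K ≃+* K)
    (MulSemiringAction.toRingEquiv Gal(K/k) (EtAlgSep f K) σ) (by
      ext c
      simp [Algebra.TensorProduct.algebraMap_apply, TensorProduct.smul_tmul']) a
  rw [h]
  simp

variable {f K} in
theorem smul_mem_mu2 (σ : Gal(K/k)) (a : (EtAlgSep f K)ˣ)
    (ha : a ∈ rootsOfUnity 2 (EtAlgSep f K)) : σ • a ∈ rootsOfUnity 2 (EtAlgSep f K) := by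
  rw [mem_rootsOfUnity] at ha ⊢
  rw [← smul_pow', ha, smul_one]

variable {f K} in
theorem smul_mem_normOneMu2 (σ : Gal(K/k)) (a : (EtAlgSep f K)ˣ)
    (ha : a ∈ normOneMu2 f K) : σ • a ∈ normOneMu2 f K := by
  refine ⟨smul_mem_mu2 σ a ha.1, ?_⟩
  have h2 : Units.map (Algebra.norm K) a = 1 := ha.2
  have h3 : Algebra.norm K (a : EtAlgSep f K) = 1 := congrArg Units.val h2
  refine Units.ext ?_
  change Algebra.norm K (σ • (a : EtAlgSep f K)) = 1
  rw [norm_galois_smul, h3, map_one]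

instance mu2Action : MulDistribMulAction Gal(K/k) (Mu2 f K) :=
  stableSubgroupAction _ smul_mem_mu2

instance mGrpAction : MulDistribMulAction Gal(K/k) (MGrp f K) :=
  stableSubgroupAction _ smul_mem_normOneMu2

/-- The inclusion `M → μ₂(L_K)`. -/
def mToMu2 : MGrp f K →*[Gal(K/k)] Mu2 f K where
  toFun a := ⟨a, a.2.1⟩
  map_smul' _ _ := rfl
  map_one' := rfl
  map_mul' _ _ := rfl

/-- `μ₂(K)` as a subgroup of `μ₂(L_K)`. -/
def constMu2 : Subgroup (Mu2 f K) :=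
  (restrictRootsOfUnity (algebraMap K (EtAlgSep f K)) 2).range

variable {f K} in
theorem smul_mem_constMu2 (σ : Gal(K/k)) (a : Mu2 f K) (ha : a ∈ constMu2 f K) :
    σ • a ∈ constMu2 f K := by
  obtain ⟨c, rfl⟩ := ha
  refine ⟨restrictRootsOfUnity σ 2 c, ?_⟩
  refine Subtype.ext (Units.ext ?_)
  change (σ ((c : Kˣ) : K)) ⊗ₜ[k] (1 : EtAlg f) = σ • (((c : Kˣ) : K) ⊗ₜ[k] (1 : EtAlg f))
  rw [TensorProduct.smul_tmul']
  rfl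

/-- The group `μ₂(L_K)/μ₂(K)`. -/
abbrev Mu2Quot : Type _ := Mu2 f K ⧸ constMu2 f K

instance mu2QuotAction : MulDistribMulAction Gal(K/k) (Mu2Quot f K) :=
  stableQuotientAction _ smul_mem_constMu2

/-- The projection `μ₂(L_K) → μ₂(L_K)/μ₂(K)`. -/
def mu2ToQuot : Mu2 f K →*[Gal(K/k)] Mu2Quot f K where
  toFun a := QuotientGroup.mk a
  map_smul' _ _ := rfl
  map_one' := rfl
  map_mul' _ _ := rfl

/-! ### The group `Γ` and the map `χ` -/

/-- `Γ`, the group of pairs `(δ, n)` in `Lˣ × kˣ` with `N(δ) = n ^ 2`. -/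
def Gam : Subgroup ((EtAlg f)ˣ × kˣ) where
  carrier := {x | Units.map (Algebra.norm k) x.1 = x.2 ^ 2}
  one_mem' := by simp
  mul_mem' := by
    intro a b ha hb
    simp only [Set.mem_ofPred_eq, Prod.fst_mul, Prod.snd_mul, map_mul, mul_pow] at ha hb ⊢
    rw [ha, hb]
  inv_mem' := by
    intro a ha
    simp only [Set.mem_ofPred_eq, Prod.fst_inv, Prod.snd_inv, map_inv, inv_pow] at ha ⊢
    rw [ha]

/-- `χ : Lˣ → Γ`, `ε ↦ (ε ^ 2, N(ε))`. -/
def chi : (EtAlg f)ˣ →* Gam f :=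
  ((powMonoidHom 2).prod (Units.map (Algebra.norm k))).codRestrict (Gam f) (fun e => by
    change Units.map (Algebra.norm k) (e ^ 2) = (Units.map (Algebra.norm k) e) ^ 2
    rw [map_pow])

/-- The element `(1, -1)` of `Γ`. -/
def oneNegOne : Gam f := ⟨(1, -1), by
  change Units.map (Algebra.norm k) 1 = (-1) ^ 2
  rw [map_one, neg_one_sq]⟩

/-! ### The Jacobian of `y² = f(x)` and its 2-torsion

For a separably closed field `K`, the `K`-points of the Jacobian of the smooth projective curve
`C` with affine model `y² = f(x)` are the degree-zero divisor classes of `C_K`. The closed points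
of `C_K` are the places of its function field `K(C) = K ⊗ k(C)`. -/

/-- The function field `k(C) = k(x)[y]/(y² - f(x))`. -/
abbrev BaseFunctionField : Type _ :=
  AdjoinRoot ((X : (RatFunc k)[X]) ^ 2 - C (algebraMap k[X] (RatFunc k) f))

/-- The function field `K ⊗ k(C)` of `C_K`. -/
abbrev CurveFunctionField : Type _ := K ⊗[k] BaseFunctionField f

/-- The coordinate function `x`. -/
def coordX : CurveFunctionField f K := 1 ⊗ₜ AdjoinRoot.of _ RatFunc.X

/-- The coordinate function `y`. -/
def coordY : CurveFunctionField f K := 1 ⊗ₜ AdjoinRoot.root _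

/-- Closed points of `C_K`: normalized discrete valuations of the function field that are trivial
on the constant field `K`. -/
structure Place where
  /-- The normalized discrete valuation, written multiplicatively. -/
  val : Valuation (CurveFunctionField f K) ℤᵐ⁰
  surjective : Function.Surjective val
  trivial_on_constants : ∀ c : K, c ≠ 0 → val (algebraMap K (CurveFunctionField f K) c) = 1

namespace Place

variable {f K}

theorem ext' {v w : Place f K} (h : v.val = w.val) : v = w := by
  cases v; cases w; cases h; rfl

/-- The order of a function at a place. -/
def ord (v : Place f K) (g : (CurveFunctionField f K)ˣ) : ℤ :=
  - WithZero.log (v.val (g : CurveFunctionField f K))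

theorem val_algebraMap_le (v : Place f K) (c : K) :
    v.val (algebraMap K (CurveFunctionField f K) c) ≤ 1 := by
  by_cases hc : c = 0
  · simp [hc]
  · exact (v.trivial_on_constants c hc).le

/-- The functions that are regular at `v`. -/
def localRing (v : Place f K) : Submodule K (CurveFunctionField f K) where
  carrier := {g | v.val g ≤ 1}
  zero_mem' := by simp
  add_mem' := fun {a b} ha hb => (v.val.map_add a b).trans (max_le ha hb)
  smul_mem' c g hg := by
    change v.val (c • g) ≤ 1
    rw [Algebra.smul_def, map_mul]
    exact mul_le_one' (v.val_algebraMap_le c) hg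

/-- The functions that vanish at `v`. -/
def maxIdeal (v : Place f K) : Submodule K (CurveFunctionField f K) where
  carrier := {g | v.val g < 1}
  zero_mem' := by simp
  add_mem' := fun {a b} ha hb => (v.val.map_add a b).trans_lt (max_lt ha hb)
  smul_mem' c g hg := by
    change v.val (c • g) < 1
    rw [Algebra.smul_def, map_mul]
    exact (mul_le_of_le_one_left' (v.val_algebraMap_le c)).trans_lt hg

/-- The residue field of `v`, as a `K`-vector space. -/
abbrev ResidueSpace (v : Place f K) : Type _ :=
  v.localRing ⧸ v.maxIdeal.comap v.localRing.subtype

/-- The degree of a closed point: the degree over `K` of its residue field. -/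
def degree (v : Place f K) : ℕ := Module.finrank K v.ResidueSpace

/-- Galois acts on places by `(σ v)(g) = v(σ⁻¹ g)`. -/
instance : MulAction Gal(K/k) (Place f K) where
  smul σ v :=
    { val := v.val.comap
        (MulSemiringAction.toRingHom Gal(K/k) (CurveFunctionField f K) σ⁻¹)
      surjective := v.surjective.comp (MulAction.surjective σ⁻¹)
      trivial_on_constants := fun c hc => by
        change v.val (σ⁻¹ • (c ⊗ₜ[k] (1 : BaseFunctionField f))) = 1
        rw [TensorProduct.smul_tmul']
        exact v.trivial_on_constants (σ⁻¹ c) (by simpa using hc) }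
  one_smul v := ext' (by
    ext g
    change v.val ((1 : Gal(K/k))⁻¹ • g) = v.val g
    rw [inv_one, one_smul])
  mul_smul σ τ v := ext' (by
    ext g
    change v.val ((σ * τ)⁻¹ • g) = v.val (τ⁻¹ • σ⁻¹ • g)
    rw [mul_inv_rev, mul_smul])

theorem smul_val (σ : Gal(K/k)) (v : Place f K) (g : CurveFunctionField f K) :
    (σ • v).val g = v.val (σ⁻¹ • g) := rfl

end Place

/-- Divisors on `C_K`. -/
abbrev CurveDiv : Type _ := Place f K →₀ ℤ

/-- The degree homomorphism. -/
def CurveDiv.degree : CurveDiv f K →+ ℤ :=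
  Finsupp.liftAddHom fun v => (AddMonoidHom.mulRight (v.degree : ℤ))

/-- Principal divisors. -/
def principalDiv : AddSubgroup (CurveDiv f K) where
  carrier := {D | ∃ g : (CurveFunctionField f K)ˣ, ∀ v : Place f K, D v = v.ord g}
  zero_mem' := ⟨1, fun v => by simp [Place.ord]⟩
  add_mem' := by
    rintro D E ⟨g, hg⟩ ⟨h, hh⟩
    refine ⟨g * h, fun v => ?_⟩
    have h1 : v.val (g : CurveFunctionField f K) ≠ 0 := (g.isUnit.map v.val).ne_zero
    have h2 : v.val (h : CurveFunctionField f K) ≠ 0 := (h.isUnit.map v.val).ne_zero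
    rw [Finsupp.add_apply, hg, hh]
    simp only [Place.ord, Units.val_mul, map_mul, WithZero.log_mul h1 h2]
    ring
  neg_mem' := by
    rintro D ⟨g, hg⟩
    refine ⟨g⁻¹, fun v => ?_⟩
    have h1 : v.val (g : CurveFunctionField f K) ≠ 0 := (g.isUnit.map v.val).ne_zero
    have h2 : v.val ((g⁻¹ : (CurveFunctionField f K)ˣ) : CurveFunctionField f K) ≠ 0 :=
      (g⁻¹.isUnit.map v.val).ne_zero
    have h3 := WithZero.log_mul h1 h2
    rw [← map_mul, Units.mul_inv, map_one, WithZero.log_one] at h3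
    rw [Finsupp.neg_apply, hg]
    simp only [Place.ord]
    linarith

/-- The divisor class group of `C_K`. -/
abbrev CurvePic : Type _ := CurveDiv f K ⧸ principalDiv f K

/-- The class of a divisor. -/
def divClass : CurveDiv f K →+ CurvePic f K := QuotientAddGroup.mk' _

/-- The points of the Jacobian over the separably closed field `K`: divisor classes of degree
zero. -/
def jacobianPoints : AddSubgroup (CurvePic f K) :=
  (CurveDiv.degree f K).ker.map (divClass f K)

/-- `J[2](K)` as a group of divisor classes. -/
def jacobianTwoTorsion : AddSubgroup (CurvePic f K) :=
  jacobianPoints f K ⊓ (nsmulAddMonoidHom 2).ker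

variable {f K}

namespace Place

/-- `g ↦ σ⁻¹ g` identifies the functions regular at `σ v` with those regular at `v`. -/
def localRingEquiv (σ : Gal(K/k)) (v : Place f K) : (σ • v).localRing ≃+ v.localRing where
  toFun g := ⟨σ⁻¹ • (g : CurveFunctionField f K), g.2⟩
  invFun g := ⟨σ • (g : CurveFunctionField f K), by
    change v.val (σ⁻¹ • σ • (g : CurveFunctionField f K)) ≤ 1
    rw [inv_smul_smul]
    exact g.2⟩
  left_inv g := Subtype.ext (smul_inv_smul σ (g : CurveFunctionField f K))
  right_inv g := Subtype.ext (inv_smul_smul σ (g : CurveFunctionField f K))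
  map_add' g h := Subtype.ext (smul_add σ⁻¹ (g : CurveFunctionField f K) h)

theorem galois_smul_smul (σ : Gal(K/k)) (c : K) (g : CurveFunctionField f K) :
    σ • (c • g) = σ c • σ • g := by
  rw [Algebra.smul_def, smul_mul', Algebra.smul_def]
  congr 1

theorem degree_smul (σ : Gal(K/k)) (v : Place f K) : (σ • v).degree = v.degree := by
  let j : (σ • v).ResidueSpace ≃+ v.ResidueSpace :=
    QuotientAddGroup.congr
      ((σ • v).maxIdeal.comap (σ • v).localRing.subtype).toAddSubgroup
      (v.maxIdeal.comap v.localRing.subtype).toAddSubgroup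
      (localRingEquiv σ v) (by
        ext g
        constructor
        · rintro ⟨h, hh, rfl⟩
          exact hh
        · intro hg
          refine ⟨(localRingEquiv σ v).symm g, ?_, (localRingEquiv σ v).apply_symm_apply g⟩
          change v.val (σ⁻¹ • σ • (g : CurveFunctionField f K)) < 1
          rw [inv_smul_smul]
          exact hg)
  refine congrArg Cardinal.toNat (rank_eq_of_equiv_equiv (σ⁻¹ : Gal(K/k)) j
    (AlgEquiv.bijective _) ?_)
  intro c m
  induction m using Submodule.Quotient.induction_on with
  | H g =>
    refine congrArg (Submodule.Quotient.mk (p := v.maxIdeal.comap v.localRing.subtype)) ?_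
    exact Subtype.ext (galois_smul_smul σ⁻¹ c (g : CurveFunctionField f K))

end Place

/-- The Galois action on divisors. -/
def divAct (σ : Gal(K/k)) : CurveDiv f K →+ CurveDiv f K :=
  Finsupp.mapDomain.addMonoidHom (σ • ·)

theorem divAct_apply (σ : Gal(K/k)) (D : CurveDiv f K) (v : Place f K) :
    divAct σ D v = D (σ⁻¹ • v) := by
  have h := Finsupp.mapDomain_apply (MulAction.injective σ) D (σ⁻¹ • v)
  rwa [smul_inv_smul] at h

theorem degree_divAct (σ : Gal(K/k)) (D : CurveDiv f K) :
    CurveDiv.degree f K (divAct σ D) = CurveDiv.degree f K D := by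
  have h : (CurveDiv.degree f K).comp (divAct σ) = CurveDiv.degree f K := by
    ext v
    simp [CurveDiv.degree, divAct, Place.degree_smul]
  exact DFunLike.congr_fun h D

theorem divAct_mem_principalDiv (σ : Gal(K/k)) (D : CurveDiv f K)
    (hD : D ∈ principalDiv f K) : divAct σ D ∈ principalDiv f K := by
  obtain ⟨g, hg⟩ := hD
  refine ⟨σ • g, fun v => ?_⟩
  rw [divAct_apply, hg]
  change -WithZero.log (v.val (σ⁻¹⁻¹ • (g : CurveFunctionField f K))) =
    -WithZero.log (v.val (σ • (g : CurveFunctionField f K)))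
  rw [inv_inv]

/-- The Galois action on divisor classes. -/
instance curvePicAction : DistribMulAction Gal(K/k) (CurvePic f K) where
  smul σ := QuotientAddGroup.map _ _ (divAct σ) (divAct_mem_principalDiv σ)
  one_smul p := by
    induction p using QuotientAddGroup.induction_on with
    | H D =>
      refine congrArg (divClass f K) (Finsupp.ext fun v => ?_)
      rw [divAct_apply, inv_one, one_smul]
  mul_smul σ τ p := by
    induction p using QuotientAddGroup.induction_on with
    | H D =>
      refine congrArg (divClass f K) (Finsupp.ext fun v => ?_)
      rw [divAct_apply, divAct_apply, divAct_apply, mul_inv_rev, mul_smul]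
  smul_zero _ := map_zero _
  smul_add _ _ _ := map_add _ _ _

theorem smul_mem_jacobianTwoTorsion (σ : Gal(K/k)) (p : CurvePic f K)
    (hp : p ∈ jacobianTwoTorsion f K) : σ • p ∈ jacobianTwoTorsion f K := by
  obtain ⟨⟨D, hD, rfl⟩, hp2⟩ := hp
  refine ⟨⟨divAct σ D, ?_, rfl⟩, ?_⟩
  · exact (degree_divAct σ D).trans hD
  · change 2 • (σ • divClass f K D) = 0
    have h : 2 • divClass f K D = 0 := hp2
    rw [two_nsmul, ← smul_add, ← two_nsmul, h, smul_zero]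

variable (f K)

/-- `J[2](K)`, written multiplicatively. -/
abbrev JTwo : Type _ := Multiplicative (jacobianTwoTorsion f K)

instance jTwoAction : MulDistribMulAction Gal(K/k) (JTwo f K) where
  smul σ p := Multiplicative.ofAdd
    ⟨σ • (p.toAdd : CurvePic f K), smul_mem_jacobianTwoTorsion σ _ p.toAdd.2⟩
  one_smul p := Subtype.ext (one_smul Gal(K/k) (p.toAdd : CurvePic f K))
  mul_smul σ τ p := Subtype.ext (mul_smul σ τ (p.toAdd : CurvePic f K))
  smul_mul σ p q := Subtype.ext (smul_add σ (p.toAdd : CurvePic f K) q.toAdd)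
  smul_one σ := Subtype.ext (smul_zero σ)

variable {f K}

/-- The Weierstrass point `(ω, 0)` of `C_K`: the closed point at which `x - ω` and `y` vanish. -/
def IsWeierstrassPoint (ω : f.rootSet K) (w : Place f K) : Prop :=
  w.val (coordX f K - algebraMap K _ (ω : K)) < 1 ∧ w.val (coordY f K) < 1

/-- The divisor class of `(w₁) - (w₂)`. -/
def diffClass (w₁ w₂ : Place f K) : CurvePic f K :=
  divClass f K (Finsupp.single w₁ 1 - Finsupp.single w₂ 1)

/-! ### Characterizations of the homomorphisms between the Galois modules -/

/-- `α = α_{ω₁,ω₂}`: `φ_ω(α) = -1` for `ω ∈ {ω₁, ω₂}`, and `φ_ω(α) = 1` otherwise. -/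
def IsAlpha (ω₁ ω₂ : f.rootSet K) (α : MGrp f K) : Prop :=
  ∀ ω : f.rootSet K,
    ((ω = ω₁ ∨ ω = ω₂) → evalRoot f K ω ((α : (EtAlgSep f K)ˣ) : EtAlgSep f K) = -1) ∧
    (¬ (ω = ω₁ ∨ ω = ω₂) → evalRoot f K ω ((α : (EtAlgSep f K)ˣ) : EtAlgSep f K) = 1)

/-- `β : M → J[2](K)` sends `α_{ω₁,ω₂}` to the class of `(ω₁, 0) - (ω₂, 0)`. -/
def IsBeta (w : f.rootSet K → Place f K) (β : MGrp f K →* JTwo f K) : Prop :=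
  ∀ ω₁ ω₂ : f.rootSet K, ω₁ ≠ ω₂ → ∀ α : MGrp f K, IsAlpha ω₁ ω₂ α →
    (((β α).toAdd : jacobianTwoTorsion f K) : CurvePic f K) = diffClass (w ω₁) (w ω₂)

/-- `ϵ : J[2](K) → μ₂(L_K)/μ₂(K)` sends the class of `(ω₁, 0) - (ω₂, 0)` to the class of
`α_{ω₁,ω₂}`. -/
def IsEpsilon (w : f.rootSet K → Place f K) (e : JTwo f K →* Mu2Quot f K) : Prop :=
  ∀ ω₁ ω₂ : f.rootSet K, ω₁ ≠ ω₂ → ∀ α : MGrp f K, IsAlpha ω₁ ω₂ α →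
    ∀ p : JTwo f K, ((p.toAdd : jacobianTwoTorsion f K) : CurvePic f K) =
      diffClass (w ω₁) (w ω₂) → e p = mu2ToQuot f K (mToMu2 f K α)

variable (k K) in
/-- The Brauer group `H²(Gal(K/k), Kˣ)` of `k`, for `K` a separable closure of `k`. -/
abbrev BrauerGrp : Type _ := H2 Gal(K/k) Kˣ

variable (k K) in
/-- The 2-torsion of the Brauer group. -/
abbrev BrauerTwo : Type _ := (powMonoidHom 2 : BrauerGrp k K →* BrauerGrp k K).ker

/-- `Υ : H¹(J[2]) → Br(k)[2]` is the connecting homomorphism of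
`1 → μ₂(K) → M → J[2](K) → 1`: if `a` is a continuous cochain with values in `M` that lifts the
cocycle `c`, then `Υ` maps the class of `c` to the class of the coboundary
`(σ, τ) ↦ σ(a(τ)) a(στ)⁻¹ a(σ)`, which has values in `μ₂(K)`. -/
def IsConnecting (β : MGrp f K →* JTwo f K)
    (U : H1 Gal(K/k) (JTwo f K) →* BrauerTwo k K) : Prop :=
  ∀ (c : Z1 Gal(K/k) (JTwo f K)) (a : Gal(K/k) → MGrp f K), IsLocallyConstant a →
    (∀ σ, β (a σ) = (c : Gal(K/k) → JTwo f K) σ) →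
    ∃ z : Z2 Gal(K/k) Kˣ,
      (∀ σ τ, Units.map (algebraMap K (EtAlgSep f K)).toMonoidHom
          ((z : Gal(K/k) × Gal(K/k) → Kˣ) (σ, τ)) =
        ((σ • a τ / a (σ * τ) * a σ : MGrp f K) : (EtAlgSep f K)ˣ)) ∧
      (∀ σ τ, (z : Gal(K/k) × Gal(K/k) → Kˣ) (σ, τ) ∈ rootsOfUnity 2 K) ∧
      (U (H1.mk c) : BrauerGrp k K) = H2.mk z

variable (f) in
/-- The subgroup `Lˣ² kˣ` of `Lˣ`. -/
def squaresConsts : Subgroup (EtAlg f)ˣ :=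
  (powMonoidHom 2 : (EtAlg f)ˣ →* (EtAlg f)ˣ).range ⊔
    (Units.map (algebraMap k (EtAlg f)).toMonoidHom).range

variable (f) in
/-- `Lˣ / Lˣ²`. -/
abbrev SqClasses : Type _ := (EtAlg f)ˣ ⧸ (powMonoidHom 2 : (EtAlg f)ˣ →* (EtAlg f)ˣ).range

/-- The Kummer isomorphism `H¹(μ₂(L_K)) ≅ Lˣ / Lˣ²`: for `ε` in `L_Kˣ` with `ε ^ 2 = δ ∈ Lˣ`, it
sends the class of the cocycle `σ ↦ σ(ε)/ε` to the class of `δ`. -/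
def IsKummer (θ : H1 Gal(K/k) (Mu2 f K) ≃* SqClasses f) : Prop :=
  ∀ (δ : (EtAlg f)ˣ) (ε : (EtAlgSep f K)ˣ), ε ^ 2 = unitsIncl δ →
    ∃ c : Z1 Gal(K/k) (Mu2 f K),
      (∀ σ, (((c : Gal(K/k) → Mu2 f K) σ : Mu2 f K) : (EtAlgSep f K)ˣ) = σ • ε / ε) ∧
      θ (H1.mk c) = QuotientGroup.mk δ

/-- `κ : P¹(J[2]) → Lˣ / Lˣ² kˣ` is the homomorphism induced by `ϵ_*`: if `κ(ξ)` is the class of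
`δ`, then `ϵ_*(ξ)` is the image of `δ` under `Lˣ / Lˣ² ≅ H¹(μ₂(L_K)) → H¹(μ₂(L_K)/μ₂(K))`. -/
def IsKappa (e : JTwo f K →*[Gal(K/k)] Mu2Quot f K) (θ : H1 Gal(K/k) (Mu2 f K) ≃* SqClasses f)
    (P : Subgroup (H1 Gal(K/k) (JTwo f K))) (κ : P →* (EtAlg f)ˣ ⧸ squaresConsts f) : Prop :=
  ∀ (ξ : P) (δ : (EtAlg f)ˣ), κ ξ = QuotientGroup.mk δ →
    H1.map e (ξ : H1 Gal(K/k) (JTwo f K)) = H1.map (mu2ToQuot f K) (θ.symm (QuotientGroup.mk δ))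

/-- `ε ∈ L_Kˣ` satisfies `ε ^ 2 = δ` and `N(ε) = n`. -/
def IsRootOf (x : Gam f) (ε : (EtAlgSep f K)ˣ) : Prop :=
  ε ^ 2 = unitsIncl (x : (EtAlg f)ˣ × kˣ).1 ∧
    Algebra.norm K (ε : EtAlgSep f K) = algebraMap k K ((x : (EtAlg f)ˣ × kˣ).2 : k)

/-- `γ : Γ / im χ → H¹(M)` sends the class of `(δ, n)` to the class of the cocycle
`σ ↦ σ(ε)/ε`, for every `ε` with `ε ^ 2 = δ` and `N(ε) = n`. -/
def IsGamma (γ : Gam f ⧸ (chi f).range ≃* H1 Gal(K/k) (MGrp f K)) : Prop :=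
  ∀ (x : Gam f) (ε : (EtAlgSep f K)ˣ), IsRootOf x ε →
    ∃ c : Z1 Gal(K/k) (MGrp f K),
      (∀ σ, (((c : Gal(K/k) → MGrp f K) σ : MGrp f K) : (EtAlgSep f K)ˣ) = σ • ε / ε) ∧
      γ (QuotientGroup.mk x) = H1.mk c

end TwoDescent

end

open TwoDescent

/-!
Fix a root `ω₀` of `f`. Over the separable closure `K`, the substitution `x = ω₀ + 1 / t`,
`y = s / t ^ 3` turns the curve `y² = f(x)` into `s² = g(t)` with `g` of degree five and the
Weierstrass point `(ω₀, 0)` at infinity (`SplitSextic.equivOdd`). On this model the 2-torsion of the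
Picard group is computed without the Riemann-Roch theorem, from the involution `s ↦ -s` alone.

* If `2 D` is principal, the class of `D` is fixed by the involution. As constants are squares, the
  function realizing this can be scaled to have norm one, and Hilbert 90 for `K(t, s) / K(t)` changes
  `D` by a principal divisor into an invariant divisor. An invariant divisor is a combination of
  Weierstrass points and of fibres over the `t`-line, which are equivalent to multiples of the place
  at infinity. So the classes of `(i, 0) - ∞`, for the roots `i` of `g`, generate the 2-torsion
  (`OddModel.exists_sum_sub_mem`).
* If a sum of such differences over a set `S` of roots is the divisor of `h`, then `h²` is a constant
  times the product of the `t - i` with `i ∈ S`. Writing `h = a + b s` shows that this product, or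
  the one over the complement of `S`, is a square in `K(t)`; so `S` is empty or contains all the roots
  (`OddModel.eq_empty_or_eq_of_mem_prinDiv`).

Hence `J[2]` is generated by the classes of `(ω, 0) - (ω₀, 0)`, of order two, and the only relation
among those with `ω ≠ ω₀` is that their product is trivial
(`IsWeierstrassFamily.exists_isTorsionFrame`). On the other side, `K ⊗ L` is the algebra of functions
on the set of roots, with the norm given by the product of the values (`evalEquiv`, `norm_eq_prod`), so
`M` consists of the sign vectors with an even number of signs `-1`. Comparing the two descriptions,
`β` is surjective with kernel `μ₂(K)` (`exists_beta`), and `ϵ` is the injection induced by the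
inclusion of `M` in `μ₂(K ⊗ L)` (`exists_epsilon`).

On the cohomological side, Hilbert 90 holds for `(K ⊗ L)ˣ`, because Shapiro's lemma reduces it to the
stabilizers of the roots (`exists_smul_div_eq_etAlgSep`). Every cocycle with values in `M` or in
`μ₂(K ⊗ L)` is therefore of the form `σ ↦ σ(ε) / ε`, where `ε²` and, for `M`, also `N(ε)` are Galois
invariant; this yields `γ` and the Kummer isomorphism (`exists_h1_equiv`, applied in `exists_isGamma`
and `exists_isKummer`). If `Υ(ξ) = 1` then `ξ` lifts to `H¹(M)`, since a cochain with values in `Kˣ`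
whose coboundary has square one can be corrected to a sign-valued one by Hilbert 90 and square roots
(`exists_map_eq_of_connecting_eq_one`). As `Lˣ / (Lˣ)² kˣ` embeds into `H¹(μ₂(K ⊗ L) / μ₂(K))`
(`map_kummer_symm_eq_one_iff`), it follows that `κ` exists and has the kernel of `ϵ_*` on `ker Υ`
(`exists_kappa`).

Finally, if a cocycle `c` in `J[2]` dies under `ϵ_*`, then `ϵ(c(σ))` is the class of `σ(q) / q` for some
`q` in `μ₂(K ⊗ L)`, and `N(q) = ±1`. If `N(q) = 1`, then `q` lies in `M` and `β(q)` splits `c`. If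
`N(q) = -1`, then `q² = 1` makes `q` a root of `(1, -1)`, and `c` is the image under `β` of the cocycle
that represents `γ(1, -1)` (`ker_map_epsilon`). So `ker ϵ_*` is generated by `β_*(γ(1, -1))`; it lies in
`ker Υ`, because `Υ` is trivial on the image of `β_*`.
-/

noncomputable section

namespace TwoDescent

/-! ### Quadratic extensions of `K(t)` -/

section QuadraticModel

variable {K : Type*} [Field K] {g : K[X]}

/-- The relation `s² - g(t)` defining the function field `K(t, s)`. -/
abbrev quadRel (g : K[X]) : (RatFunc K)[X] := X ^ 2 - C (algebraMap K[X] (RatFunc K) g)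

/-- The generator `s` of the quadratic extension of `K(t)` defined by `s² = g(t)`. -/
abbrev genS (g : K[X]) : BaseFunctionField g := AdjoinRoot.root (quadRel g)

theorem quadRel_monic (g : K[X]) : (quadRel g).Monic := monic_X_pow_sub_C _ two_ne_zero

theorem genS_sq (g : K[X]) :
    genS g ^ 2 = algebraMap (RatFunc K) (BaseFunctionField g) (algebraMap K[X] (RatFunc K) g) := by
  have h := AdjoinRoot.eval₂_root (quadRel g)
  simp only [quadRel, eval₂_sub, eval₂_pow, eval₂_X, eval₂_C, sub_eq_zero] at h
  exact h

theorem exists_eq_add_mul_genS (h : BaseFunctionField g) : ∃ a b : RatFunc K,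
    h = algebraMap _ (BaseFunctionField g) a + algebraMap _ (BaseFunctionField g) b * genS g := by
  obtain ⟨p, rfl⟩ := AdjoinRoot.mk_surjective h
  have hm := quadRel_monic g
  have hdeg : (p %ₘ quadRel g).natDegree ≤ 1 := by
    have h2 := natDegree_modByMonic_lt p hm (by
      intro h1
      have := natDegree_X_pow_sub_C (n := 2) (r := algebraMap K[X] (RatFunc K) g)
      rw [show (X ^ 2 - C (algebraMap K[X] (RatFunc K) g)) = 1 from h1] at this
      simp at this)
    rw [natDegree_X_pow_sub_C] at h2
    omega
  obtain ⟨b, a, hab⟩ := exists_eq_X_add_C_of_natDegree_le_one hdeg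
  refine ⟨a, b, ?_⟩
  have h1 : AdjoinRoot.mk (quadRel g) p = AdjoinRoot.mk (quadRel g) (p %ₘ quadRel g) := by
    conv_lhs => rw [← modByMonic_add_div p (quadRel g)]
    simp
  rw [h1, hab, map_add, map_mul, AdjoinRoot.mk_C, AdjoinRoot.mk_C, AdjoinRoot.mk_X, add_comm]
  rfl

/-- The involution `s ↦ -s` of `K(t, s)`. -/
def conj (g : K[X]) : BaseFunctionField g ≃ₐ[RatFunc K] BaseFunctionField g :=
  have h : (quadRel g).eval₂ (Algebra.ofId (RatFunc K) (BaseFunctionField g) : _ →+* _)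
      (-genS g) = 0 := by
    simp only [quadRel, eval₂_sub, eval₂_pow, eval₂_X, eval₂_C, sub_eq_zero, neg_sq, genS_sq]
    rfl
  have h2 : (AdjoinRoot.liftAlgHom (quadRel g) (Algebra.ofId (RatFunc K) (BaseFunctionField g))
      (-genS g) h).comp (AdjoinRoot.liftAlgHom (quadRel g)
        (Algebra.ofId (RatFunc K) (BaseFunctionField g)) (-genS g) h) = AlgHom.id _ _ := by
    refine AdjoinRoot.algHom_ext ?_
    simp [map_neg]
  AlgEquiv.ofAlgHom (AdjoinRoot.liftAlgHom (quadRel g)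
    (Algebra.ofId (RatFunc K) (BaseFunctionField g)) (-genS g) h)
    (AdjoinRoot.liftAlgHom (quadRel g)
    (Algebra.ofId (RatFunc K) (BaseFunctionField g)) (-genS g) h) h2 h2

@[simp]
theorem conj_genS (g : K[X]) : conj g (genS g) = -genS g := by
  simp [conj]

theorem conj_conj (h : BaseFunctionField g) : conj g (conj g h) = h := by
  obtain ⟨a, b, rfl⟩ := exists_eq_add_mul_genS h
  simp only [map_add, map_mul, AlgEquiv.commutes, conj_genS, map_neg, neg_neg]

theorem mul_conj (a b : RatFunc K) :
    (algebraMap _ (BaseFunctionField g) a + algebraMap _ (BaseFunctionField g) b * genS g) *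
      conj g (algebraMap _ (BaseFunctionField g) a + algebraMap _ (BaseFunctionField g) b * genS g)
      = algebraMap _ (BaseFunctionField g) (a ^ 2 - b ^ 2 * algebraMap K[X] (RatFunc K) g) := by
  simp only [map_add, map_mul, AlgEquiv.commutes, conj_genS, map_sub, map_pow, ← genS_sq]
  ring

/-- The norm to `K(t)`. -/
theorem exists_mul_conj_eq (h : BaseFunctionField g) :
    ∃ n : RatFunc K, h * conj g h = algebraMap _ (BaseFunctionField g) n := by
  obtain ⟨a, b, rfl⟩ := exists_eq_add_mul_genS h
  exact ⟨_, mul_conj a b⟩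

variable [Fact (Irreducible (quadRel g))]

instance : FiniteDimensional (RatFunc K) (BaseFunctionField g) :=
  (quadRel_monic g).finite_adjoinRoot

instance : FunctionField K (BaseFunctionField g) :=
  inferInstanceAs (FiniteDimensional (RatFunc K) (BaseFunctionField g))

theorem ne_zero_of_irreducible_quadRel : g ≠ 0 := by
  rintro rfl
  have h : Irreducible (quadRel (0 : K[X])) := Fact.out
  simp only [quadRel, map_zero, sub_zero] at h
  exact not_irreducible_pow (by norm_num) h

theorem genS_ne_zero : genS g ≠ 0 := by
  intro h
  have h1 := genS_sq g
  rw [h, zero_pow two_ne_zero] at h1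
  have h2 := (algebraMap (RatFunc K) (BaseFunctionField g)).injective
    (h1.symm.trans (map_zero _).symm)
  simp [ne_zero_of_irreducible_quadRel] at h2

theorem two_ne_zero_ratFunc {K : Type*} [Field K] (h2 : (2 : K) ≠ 0) : (2 : RatFunc K) ≠ 0 := by
  have h := (map_ne_zero (algebraMap K (RatFunc K))).mpr h2
  rwa [map_ofNat] at h

/-- In characteristic not two, the quadratic extension `K(t, s)` of `K(t)` is separable. -/
theorem isSeparable_baseFunctionField (h2 : (2 : K) ≠ 0) :
    Algebra.IsSeparable (RatFunc K) (BaseFunctionField g) := by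
  refine ⟨fun h => ?_⟩
  obtain ⟨a, b, rfl⟩ := exists_eq_add_mul_genS h
  have hs : IsSeparable (RatFunc K) (genS g) := by
    have h1 := AdjoinRoot.minpoly_root (quadRel_monic g).ne_zero
    rw [(quadRel_monic g).leadingCoeff, inv_one, map_one, mul_one] at h1
    unfold IsSeparable
    rw [h1]
    refine separable_X_pow_sub_C _ (by exact_mod_cast two_ne_zero_ratFunc h2) ?_
    simp [ne_zero_of_irreducible_quadRel]
  exact Field.isSeparable_add (isSeparable_algebraMap _)
    (Field.isSeparable_mul (isSeparable_algebraMap _) hs)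

/-! ### Places of `K(t, s)` -/

/-- The valuation `v` of `K(t, s)` is normalized, discrete and trivial on `K`. -/
structure IsPlace (v : Valuation (BaseFunctionField g) ℤᵐ⁰) : Prop where
  surjective : Function.Surjective v
  trivial : ∀ c : K, c ≠ 0 → v (algebraMap K (BaseFunctionField g) c) = 1

variable {v : Valuation (BaseFunctionField g) ℤᵐ⁰}

variable (g) in
/-- The coordinate function `t`. -/
abbrev genT : BaseFunctionField g := algebraMap (RatFunc K) _ RatFunc.X

/-- The restriction of a valuation of `K(t, s)` to `K(t)`. -/
abbrev resVal (v : Valuation (BaseFunctionField g) ℤᵐ⁰) : Valuation (RatFunc K) ℤᵐ⁰ :=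
  v.comap (algebraMap (RatFunc K) (BaseFunctionField g))

theorem IsPlace.isTrivialOn (hv : IsPlace v) : (resVal v).IsTrivialOn K :=
  ⟨fun c hc => by
    rw [Valuation.comap_apply, ← IsScalarTower.algebraMap_apply]
    exact hv.trivial c hc⟩

theorem IsPlace.comap_conj (hv : IsPlace v) : IsPlace (v.comap (conj g : BaseFunctionField g →+* BaseFunctionField g)) where
  surjective := hv.surjective.comp (conj g).surjective
  trivial c hc := by
    have : conj g (algebraMap K (BaseFunctionField g) c) = algebraMap K _ c := by
      rw [IsScalarTower.algebraMap_apply K (RatFunc K), AlgEquiv.commutes]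
    change v (conj g _) = 1
    rw [this, hv.trivial c hc]

/-! ### The place at infinity for `g` of odd degree -/

theorem val_genS_sq (v : Valuation (BaseFunctionField g) ℤᵐ⁰) :
    v (genS g) ^ 2 = resVal v (algebraMap K[X] (RatFunc K) g) := by
  rw [← map_pow, genS_sq]; rfl

/-- At a pole of `t`, the parameters `t` and `s` have orders `-2` and `-deg g`. -/
theorem IsPlace.val_infinity (hv : IsPlace v) (ht : 1 < v (genT g)) (hodd : Odd g.natDegree) :
    (∀ a : RatFunc K, a ≠ 0 → resVal v a = exp (2 * a.intDegree)) ∧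
      v (genS g) = exp (g.natDegree : ℤ) ∧
      ∀ a b : RatFunc K, v (algebraMap _ _ a + algebraMap _ _ b * genS g) =
        max (resVal v a) (resVal v b * v (genS g)) := by
  have := hv.isTrivialOn
  have hg0 : g ≠ 0 := ne_zero_of_irreducible_quadRel
  obtain ⟨j, hj⟩ := hodd
  -- write `v t = exp m` and `v s = exp n`, so that `2 n = (2 j + 1) m`
  obtain ⟨m, hm⟩ : ∃ m : ℤ, v (genT g) = exp m :=
    ⟨_, (exp_log (ne_zero_of_lt ht)).symm⟩
  obtain ⟨n, hn⟩ : ∃ n : ℤ, v (genS g) = exp n :=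
    ⟨_, (exp_log ((Valuation.ne_zero_iff v).mpr genS_ne_zero)).symm⟩
  have hK : ∀ a : RatFunc K, a ≠ 0 → resVal v a = exp (m * a.intDegree) := by
    intro a ha
    rw [RatFunc.valuation_eq_valuation_X_zpow_intDegree_of_one_lt_valuation_X (v := resVal v) ht ha]
    change v (genT g) ^ _ = _
    rw [hm, ← exp_zsmul, smul_eq_mul, mul_comm]
  have hm0 : 0 < m := by
    rw [hm, ← exp_zero, exp_lt_exp] at ht
    exact ht
  have hrel : 2 * n = (2 * j + 1) * m := by
    have h := val_genS_sq v
    rw [hn, hK _ (by simpa using hg0), RatFunc.intDegree_polynomial, ← exp_nsmul, hj] at h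
    have h' := exp_injective h
    push_cast at h'
    simp only [nsmul_eq_mul] at h'
    push_cast at h'
    linarith
  obtain ⟨m', rfl⟩ : ∃ m', m = 2 * m' := ⟨n - j * m, by linarith⟩
  have hn' : n = (2 * j + 1) * m' := by linarith
  have hmax : ∀ a b : RatFunc K, v (algebraMap _ _ a + algebraMap _ _ b * genS g) =
        max (resVal v a) (resVal v b * v (genS g)) := by
    intro a b
    by_cases hb : b = 0
    · simp [hb]
    by_cases ha : a = 0
    · simp [ha]
    -- the values of `a` and `b s` differ, since their exponents are `m'` times integers of
    -- different parity
    refine (Valuation.map_add_of_distinct_val v ?_).trans (by rw [map_mul]; rfl)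
    rw [map_mul]
    change resVal v a ≠ resVal v b * _
    rw [hK a ha, hK b hb, hn, ← exp_add]
    intro h
    have h' := exp_injective h
    rw [hn'] at h'
    have h3 : m' * (2 * a.intDegree - 2 * b.intDegree - 2 * j - 1) = 0 := by linarith
    rcases mul_eq_zero.mp h3 with h4 | h4 <;> omega
  -- by surjectivity of `v`, the common factor `m'` of all its exponents is a unit
  have hm1 : m' = 1 := by
    obtain ⟨h, hh⟩ := hv.surjective (exp 1)
    obtain ⟨a, b, rfl⟩ := exists_eq_add_mul_genS h
    rw [hmax] at hh
    have hdvd : m' ∣ 1 := by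
      rcases max_choice (resVal v a) (resVal v b * v (genS g)) with h1 | h1
      · rw [h1] at hh
        have ha : a ≠ 0 := by rintro rfl; simp only [map_zero] at hh; exact exp_ne_zero hh.symm
        rw [hK a ha] at hh
        exact ⟨2 * a.intDegree, by have := exp_injective hh; linarith⟩
      · rw [h1] at hh
        have hb : b ≠ 0 := by rintro rfl; simp only [map_zero, zero_mul] at hh; exact exp_ne_zero hh.symm
        rw [hK b hb, hn, ← exp_add] at hh
        exact ⟨2 * b.intDegree + (2 * j + 1), by have := exp_injective hh; linarith⟩
    exact Int.eq_one_of_dvd_one (by omega) hdvd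
  subst hm1
  refine ⟨fun a ha => by rw [hK a ha, mul_one], ?_, hmax⟩
  rw [hn, hn', hj]
  push_cast
  ring_nf

/-- For `g` of odd degree there is at most one place at which `t` has a pole. -/
theorem IsPlace.eq_of_infinity {v' : Valuation (BaseFunctionField g) ℤᵐ⁰} (hv : IsPlace v)
    (hv' : IsPlace v') (ht : 1 < v (genT g)) (ht' : 1 < v' (genT g)) (hodd : Odd g.natDegree) :
    v = v' := by
  obtain ⟨h1, h2, h3⟩ := hv.val_infinity ht hodd
  obtain ⟨h1', h2', h3'⟩ := hv'.val_infinity ht' hodd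
  have hres : ∀ a, resVal v a = resVal v' a := fun a => by
    by_cases ha : a = 0
    · rw [ha, map_zero, map_zero]
    · rw [h1 a ha, h1' a ha]
  ext h
  obtain ⟨a, b, rfl⟩ := exists_eq_add_mul_genS h
  rw [h3, h3', h2, h2', hres, hres]

/-- A rational function without pole at infinity has a value in `K` there. -/
theorem exists_intDegree_sub_neg (a : RatFunc K) (ha : a = 0 ∨ a.intDegree ≤ 0) :
    ∃ c : K, a - RatFunc.C c = 0 ∨ (a - RatFunc.C c).intDegree < 0 := by
  have hq : a.denom ≠ 0 := a.denom_ne_zero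
  have hle : a.num.natDegree ≤ a.denom.natDegree := by
    rcases ha with rfl | ha
    · simp
    · rw [RatFunc.intDegree] at ha
      omega
  refine ⟨a.num.coeff a.denom.natDegree, ?_⟩
  set c := a.num.coeff a.denom.natDegree
  set r := a.num - C c * a.denom with hr
  have hrn : r.natDegree ≤ a.denom.natDegree :=
    (natDegree_sub_le _ _).trans (max_le hle (natDegree_C_mul_le _ _))
  have hrc : r.coeff a.denom.natDegree = 0 := by
    rw [hr, coeff_sub, coeff_C_mul, coeff_natDegree, (RatFunc.monic_denom a).leadingCoeff, mul_one,
      sub_self]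
  have hq' : algebraMap K[X] (RatFunc K) a.denom ≠ 0 := by simpa using hq
  have heq : a - RatFunc.C c = algebraMap K[X] (RatFunc K) r / algebraMap K[X] (RatFunc K) a.denom := by
    have h1 := (div_eq_iff hq').mp (RatFunc.num_div_denom a)
    rw [eq_div_iff hq', sub_mul, hr, map_sub, map_mul, RatFunc.algebraMap_C, ← h1]
  by_cases h0 : r = 0
  · left; rw [heq, h0]; simp
  · right
    rw [heq, RatFunc.intDegree_div (by simpa using h0) hq', RatFunc.intDegree_polynomial,
      RatFunc.intDegree_polynomial]
    have : r.natDegree ≠ a.denom.natDegree := by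
      intro h
      rw [← h, coeff_natDegree, leadingCoeff_eq_zero] at hrc
      exact h0 hrc
    omega

/-- The residue field of the place at infinity is `K`. -/
theorem IsPlace.exists_val_sub_lt_one (hv : IsPlace v) (ht : 1 < v (genT g))
    (hodd : Odd g.natDegree) {h : BaseFunctionField g} (hh : v h ≤ 1) :
    ∃ c : K, v (h - algebraMap K _ c) < 1 := by
  obtain ⟨h1, h2, h3⟩ := hv.val_infinity ht hodd
  obtain ⟨a, b, rfl⟩ := exists_eq_add_mul_genS h
  rw [h3, max_le_iff] at hh
  obtain ⟨c, hc⟩ := exists_intDegree_sub_neg a (by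
    by_cases ha : a = 0
    · exact Or.inl ha
    · rw [h1 a ha, ← exp_zero, exp_le_exp] at hh
      right; omega)
  refine ⟨c, ?_⟩
  have : (algebraMap (RatFunc K) (BaseFunctionField g) a + algebraMap _ _ b * genS g -
      algebraMap K _ c) = algebraMap (RatFunc K) _ (a - RatFunc.C c) +
        algebraMap _ _ b * genS g := by
    rw [map_sub, IsScalarTower.algebraMap_apply K (RatFunc K)]
    rw [RatFunc.algebraMap_eq_C]
    ring
  rw [this, h3, max_lt_iff]
  constructor
  · rcases hc with hc | hc
    · simp [hc]
    · by_cases h0 : a - RatFunc.C c = 0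
      · simp [h0]
      · rw [h1 _ h0, ← exp_zero, exp_lt_exp]
        omega
  · by_cases hb : b = 0
    · simp [hb]
    · have h4 := hh.2
      obtain ⟨j, hj⟩ := hodd
      rw [h1 b hb, h2, ← exp_add, ← exp_zero] at h4 ⊢
      rw [exp_le_exp] at h4
      rw [exp_lt_exp]
      omega

end QuadraticModel

/-! ### Finite places of `K(t, s)` and primes of the integral closure of `K[t]` -/

section FinitePlaces

open IsDedekindDomain

variable {K : Type*} [Field K] {g : K[X]} [Fact (Irreducible (quadRel g))]
  {v : Valuation (BaseFunctionField g) ℤᵐ⁰}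

variable (g) in
/-- The integral closure of `K[t]` in `K(t, s)`. -/
abbrev IntClosure : Type _ := FunctionField.ringOfIntegers K (BaseFunctionField g)

variable (g) in
theorem isDedekindDomain_intClosure (h2 : (2 : K) ≠ 0) : IsDedekindDomain (IntClosure g) :=
  have := isSeparable_baseFunctionField (g := g) h2
  inferInstance

theorem IsPlace.val_polynomial_le_one (hv : IsPlace v) (ht : v (genT g) ≤ 1) (p : K[X]) :
    v (algebraMap K[X] _ p) ≤ 1 := by
  induction p using Polynomial.induction_on' with
  | add p q hp hq =>
    rw [map_add]
    exact (v.map_add _ _).trans (max_le hp hq)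
  | monomial n c =>
    have h1 : algebraMap K[X] (BaseFunctionField g) (monomial n c) =
        algebraMap K _ c * genT g ^ n := by
      rw [← C_mul_X_pow_eq_monomial, map_mul, map_pow,
        IsScalarTower.algebraMap_apply K[X] (RatFunc K) _ X, RatFunc.algebraMap_X,
        IsScalarTower.algebraMap_apply K K[X] (BaseFunctionField g)]
      rfl
    rw [h1, map_mul, map_pow]
    refine mul_le_one' ?_ (pow_le_one' ht n)
    by_cases hc : c = 0
    · simp [hc]
    · exact (hv.trivial c hc).le

theorem IsPlace.val_intClosure_le_one (hv : IsPlace v) (ht : v (genT g) ≤ 1) (r : IntClosure g) :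
    v (r : BaseFunctionField g) ≤ 1 := by
  obtain ⟨p, hp, hr⟩ := r.2
  let i : K[X] →+* v.integer := (algebraMap K[X] (BaseFunctionField g)).codRestrict v.integer
    (fun p => hv.val_polynomial_le_one ht p)
  refine Valuation.Integers.mem_of_integral (Valuation.integer.integers v) (x := (r : BaseFunctionField g)) ⟨p.map i, hp.map i, ?_⟩
  rw [eval₂_map]
  exact hr

/-- Every place at which `t` is regular is the valuation of a prime of the integral closure. -/
theorem IsPlace.exists_eq_valuation [IsDedekindDomain (IntClosure g)] (hv : IsPlace v)
    (ht : v (genT g) ≤ 1) :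
    ∃ P : HeightOneSpectrum (IntClosure g), v = P.valuation (BaseFunctionField g) := by
  have hle := hv.val_intClosure_le_one ht
  let w : Valuation (IntClosure g) ℤᵐ⁰ := v.comap (algebraMap _ (BaseFunctionField g))
  let I : Ideal (IntClosure g) :=
    { carrier := {r | w r < 1}
      zero_mem' := by simp
      add_mem' := fun {a b} ha hb => (w.map_add a b).trans_lt (max_lt ha hb)
      smul_mem' := fun c a ha => by
        change w (c * a) < 1
        rw [map_mul]
        exact (mul_le_of_le_one_left' (hle c)).trans_lt ha }
  have hmem : ∀ r, r ∈ I ↔ v (r : BaseFunctionField g) < 1 := fun r => Iff.rfl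
  have hprime : I.IsPrime := by
    refine ⟨(Ideal.ne_top_iff_one I).mpr (by rw [hmem]; simp), fun {a b} hab => ?_⟩
    by_contra! h
    simp only [hmem, not_lt] at h hab
    have ha := le_antisymm (hle a) h.1
    have hb := le_antisymm (hle b) h.2
    simp [ha, hb] at hab
  obtain ⟨z, hz⟩ := hv.surjective (exp (-1))
  have hbot : I ≠ ⊥ := by
    obtain ⟨a, b, hb, rfl⟩ := IsFractionRing.div_surjective (A := IntClosure g) z
    intro hI
    have ha : v (a : BaseFunctionField g) = 1 := by
      refine le_antisymm (hle a) (not_lt.mp fun h => ?_)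
      have : a = 0 := by rw [← Ideal.mem_bot, ← hI]; exact h
      rw [this] at hz
      simp only [map_zero, zero_div] at hz
      exact exp_ne_zero hz.symm
    rw [map_div₀] at hz
    have h1 : v ((algebraMap (IntClosure g) (BaseFunctionField g)) a) = 1 := ha
    rw [h1, one_div] at hz
    have h2 : v ((algebraMap (IntClosure g) (BaseFunctionField g)) b) ≤ 1 := hle b
    have h3 : (1 : ℤᵐ⁰) ≤ (v ((algebraMap (IntClosure g) (BaseFunctionField g)) b))⁻¹ :=
      (one_le_inv₀ (by
        rw [zero_lt_iff]; intro h; rw [h, inv_zero] at hz; exact exp_ne_zero hz.symm)).mpr h2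
    rw [hz, ← exp_zero, exp_le_exp] at h3
    omega
  let P : HeightOneSpectrum (IntClosure g) := ⟨I, hprime, hbot⟩
  refine ⟨P, ?_⟩
  -- the valuation ring of `P` is the localization at the elements with value `1` under `v`
  have hone : ∀ h, P.valuation (BaseFunctionField g) h = 1 → v h = 1 := by
    have key : ∀ h, P.valuation (BaseFunctionField g) h ≤ 1 → v h ≤ 1 := by
      intro h hh
      obtain ⟨n, d, hnd⟩ := P.exists_primeCompl_mul_eq_of_integer h hh
      have hd : v (algebraMap (IntClosure g) (BaseFunctionField g) d) = 1 :=
        le_antisymm (hle d) (not_lt.mp d.2)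
      have h1 := congrArg v hnd
      rw [map_mul, hd, mul_one] at h1
      rw [h1]
      exact hle n
    intro h hh
    refine le_antisymm (key h hh.le) ?_
    have h1 := key h⁻¹ (by rw [map_inv₀, hh, inv_one])
    have h0 : v h ≠ 0 := by
      rw [Valuation.ne_zero_iff]; rintro rfl; simp at hh
    rw [map_inv₀] at h1
    exact (inv_le_one₀ (zero_lt_iff.mpr h0)).mp h1
  obtain ⟨π, hπ⟩ := P.intValuation_exists_uniformizer
  rw [← HeightOneSpectrum.valuation_of_algebraMap (K := BaseFunctionField g)] at hπ
  set ϖ := algebraMap (IntClosure g) (BaseFunctionField g) π with hϖ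
  have hϖ0 : ϖ ≠ 0 := by
    intro h
    have h1 : P.valuation (BaseFunctionField g) ϖ = exp (-1) := hπ
    rw [h, map_zero] at h1
    exact exp_ne_zero h1.symm
  -- both valuations of `h` are determined by the order of `h` with respect to `ϖ`
  have hpow : ∀ h, h ≠ 0 → ∃ m : ℤ, P.valuation (BaseFunctionField g) h = exp (-m) ∧
      v h = v ϖ ^ m := by
    intro h h0
    obtain ⟨m, hm⟩ : ∃ m : ℤ, P.valuation (BaseFunctionField g) h = exp m :=
      ⟨_, (exp_log ((Valuation.ne_zero_iff _).mpr h0)).symm⟩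
    have h1 := hone (h * ϖ ^ m) (by
      rw [map_mul, map_zpow₀, hm, hπ, ← exp_zsmul, ← exp_add, ← exp_zero]
      congr 1; simp)
    rw [map_mul, map_zpow₀] at h1
    refine ⟨-m, by rw [hm, neg_neg], ?_⟩
    rw [zpow_neg]
    exact eq_inv_of_mul_eq_one_left h1
  obtain ⟨n, hn⟩ : ∃ n : ℤ, v ϖ = exp n := ⟨_, (exp_log ((Valuation.ne_zero_iff _).mpr hϖ0)).symm⟩
  have hn1 : n = -1 := by
    have hneg : n < 0 := by
      have h1 : P.valuation (BaseFunctionField g) (algebraMap (IntClosure g) (BaseFunctionField g) π) < 1 := by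
        rw [← hϖ, hπ, ← exp_zero, exp_lt_exp]; omega
      rw [HeightOneSpectrum.valuation_lt_one_iff_mem] at h1
      have h2 : v ϖ < 1 := h1
      rwa [hn, ← exp_zero, exp_lt_exp] at h2
    obtain ⟨m, -, hm⟩ := hpow z (by rintro rfl; rw [map_zero] at hz; exact exp_ne_zero hz.symm)
    rw [hz, hn, ← exp_zsmul] at hm
    have h3 := exp_injective hm
    have h4 : n ∣ 1 := ⟨-m, by simp only [smul_eq_mul] at h3; linarith⟩
    have := Int.isUnit_iff.mp (isUnit_of_dvd_one h4)
    omega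
  ext h
  by_cases h0 : h = 0
  · simp [h0]
  obtain ⟨m, hm1, hm2⟩ := hpow h h0
  rw [hm1, hm2, hn, hn1, ← exp_zsmul]
  simp

theorem isPlace_valuation [IsDedekindDomain (IntClosure g)] (P : HeightOneSpectrum (IntClosure g)) :
    IsPlace (P.valuation (BaseFunctionField g)) where
  surjective := P.valuation_surjective _
  trivial c hc := by
    have h1 : ∀ c : K, P.valuation (BaseFunctionField g) (algebraMap K (BaseFunctionField g) c) ≤ 1 := by
      intro c
      have := P.valuation_le_one (K := BaseFunctionField g) (algebraMap K[X] (IntClosure g) (C c))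
      exact this
    refine le_antisymm (h1 c) ?_
    have h2 := h1 c⁻¹
    rw [map_inv₀, map_inv₀] at h2
    refine (inv_le_one₀ (zero_lt_iff.mpr ?_)).mp h2
    rw [Valuation.ne_zero_iff, _root_.map_ne_zero]
    exact hc

theorem valuation_genT_le_one [IsDedekindDomain (IntClosure g)]
    (P : HeightOneSpectrum (IntClosure g)) : P.valuation (BaseFunctionField g) (genT g) ≤ 1 := by
  have h := P.valuation_le_one (K := BaseFunctionField g) (algebraMap K[X] (IntClosure g) X)
  have h1 : algebraMap K[X] (BaseFunctionField g) X = genT g := by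
    rw [IsScalarTower.algebraMap_apply K[X] (RatFunc K), RatFunc.algebraMap_X]
  rw [← h1]
  exact h

/-- Over every closed point of the affine `t`-line there is a place. -/
theorem exists_isPlace_val_lt_one (h2 : (2 : K) ≠ 0) {p : K[X]} (hp : ¬ IsUnit p) (hp0 : p ≠ 0) :
    ∃ v : Valuation (BaseFunctionField g) ℤᵐ⁰, IsPlace v ∧ v (genT g) ≤ 1 ∧
      v (algebraMap K[X] _ p) < 1 := by
  have := isDedekindDomain_intClosure g h2
  have hinj : Function.Injective (algebraMap K[X] (IntClosure g)) :=
    FunctionField.ringOfIntegers.algebraMap_injective K (BaseFunctionField g)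
  have hint : Algebra.IsIntegral K[X] (IntClosure g) :=
    IsIntegralClosure.isIntegral_algebra K[X] (BaseFunctionField g)
  have hnu : ¬ IsUnit (algebraMap K[X] (IntClosure g) p) := fun h =>
    hp ((RingHom.IsIntegral.isLocalHom (f := algebraMap K[X] (IntClosure g))
      (fun x => hint.isIntegral x) hinj).map_nonunit p h)
  obtain ⟨I, hI, hpI⟩ := exists_max_ideal_of_mem_nonunits hnu
  have hbot : I ≠ ⊥ := by
    rintro rfl
    rw [Ideal.mem_bot] at hpI
    exact hp0 (hinj (hpI.trans (map_zero _).symm))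
  let P : HeightOneSpectrum (IntClosure g) := ⟨I, hI.isPrime, hbot⟩
  refine ⟨P.valuation _, isPlace_valuation P, valuation_genT_le_one P, ?_⟩
  exact (P.valuation_lt_one_iff_mem (K := BaseFunctionField g) _).mpr hpI

end FinitePlaces

/-! ### Fibres of the affine curve over the `t`-line -/

section Fibres

open IsDedekindDomain

variable {K : Type*} [Field K] {g : K[X]}

theorem algebraMap_polynomial_eq (p : K[X]) : algebraMap K[X] (BaseFunctionField g) p =
    algebraMap (RatFunc K) _ (algebraMap K[X] (RatFunc K) p) :=
  IsScalarTower.algebraMap_apply _ _ _ _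

variable [Fact (Irreducible (quadRel g))]
  {v v' v₁ v₂ : Valuation (BaseFunctionField g) ℤᵐ⁰}

/-- The composition of a valuation with the involution `s ↦ -s`. -/
abbrev conjVal (v : Valuation (BaseFunctionField g) ℤᵐ⁰) : Valuation (BaseFunctionField g) ℤᵐ⁰ :=
  v.comap (conj g : BaseFunctionField g →+* BaseFunctionField g)

theorem conjVal_apply (v : Valuation (BaseFunctionField g) ℤᵐ⁰) (h : BaseFunctionField g) :
    conjVal v h = v (conj g h) := rfl

theorem conjVal_conjVal (v : Valuation (BaseFunctionField g) ℤᵐ⁰) : conjVal (conjVal v) = v := by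
  ext h
  rw [conjVal_apply, conjVal_apply, conj_conj]

theorem conjVal_ratFunc (v : Valuation (BaseFunctionField g) ℤᵐ⁰) (a : RatFunc K) :
    conjVal v (algebraMap _ _ a) = v (algebraMap _ _ a) := by
  rw [conjVal_apply, AlgEquiv.commutes]

theorem isIntegral_conj {h : BaseFunctionField g} (hh : IsIntegral K[X] h) :
    IsIntegral K[X] (conj g h) :=
  hh.map ((conj g).toAlgHom.restrictScalars K[X])

/-- An integral element of `K(t)` is a polynomial. -/
theorem exists_polynomial_of_isIntegral {a : RatFunc K}
    (ha : IsIntegral K[X] (algebraMap (RatFunc K) (BaseFunctionField g) a)) :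
    ∃ p : K[X], a = algebraMap K[X] (RatFunc K) p := by
  rw [isIntegral_algebraMap_iff (algebraMap (RatFunc K) (BaseFunctionField g)).injective] at ha
  obtain ⟨p, hp⟩ := IsIntegrallyClosed.isIntegral_iff.mp ha
  exact ⟨p, hp.symm⟩

theorem exists_polynomial_mul_conj {h : BaseFunctionField g} (hh : IsIntegral K[X] h) :
    ∃ p : K[X], h * conj g h = algebraMap K[X] _ p := by
  obtain ⟨a, ha⟩ := exists_mul_conj_eq h
  obtain ⟨p, rfl⟩ := exists_polynomial_of_isIntegral (g := g) (a := a) (by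
    rw [← ha]; exact hh.mul (isIntegral_conj hh))
  exact ⟨p, by rw [ha, algebraMap_polynomial_eq]⟩

theorem valuation_notMem_of_ne [IsDedekindDomain (IntClosure g)]
    {P Q : HeightOneSpectrum (IntClosure g)} (h : P ≠ Q) : ¬ P.asIdeal ≤ Q.asIdeal := fun hle =>
  h (HeightOneSpectrum.ext (P.isMaximal.eq_of_le Q.isPrime.ne_top hle))

/-- Prime avoidance, in terms of places. -/
theorem exists_val_lt_one_and_eq_one [IsDedekindDomain (IntClosure g)] (hv : IsPlace v)
    (hv₁ : IsPlace v₁) (hv₂ : IsPlace v₂) (ht : v (genT g) ≤ 1) (ht₁ : v₁ (genT g) ≤ 1)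
    (ht₂ : v₂ (genT g) ≤ 1) (h₁ : v ≠ v₁) (h₂ : v ≠ v₂) :
    ∃ r : BaseFunctionField g, IsIntegral K[X] r ∧ v r < 1 ∧ v₁ r = 1 ∧ v₂ r = 1 := by
  obtain ⟨P, rfl⟩ := hv.exists_eq_valuation ht
  obtain ⟨P₁, rfl⟩ := hv₁.exists_eq_valuation ht₁
  obtain ⟨P₂, rfl⟩ := hv₂.exists_eq_valuation ht₂
  have hn : ¬ (P.asIdeal : Set (IntClosure g)) ⊆ P₁.asIdeal ∪ P₂.asIdeal := by
    rw [Ideal.subset_union]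
    rintro (h | h)
    · exact valuation_notMem_of_ne (by rintro rfl; exact h₁ rfl) h
    · exact valuation_notMem_of_ne (by rintro rfl; exact h₂ rfl) h
  obtain ⟨r, hr, hr'⟩ := Set.not_subset.mp hn
  rw [Set.mem_union, not_or] at hr'
  exact ⟨r, r.2, (P.valuation_lt_one_iff_mem r).mpr hr,
    (P₁.valuation_eq_one_iff_notMem).mpr hr'.1, (P₂.valuation_eq_one_iff_notMem).mpr hr'.2⟩

/-- A uniformizer at one place that is a unit at another: an element of the first prime ideal that
lies neither in its square nor in the second prime ideal. -/
theorem exists_uniformizer_and_eq_one [IsDedekindDomain (IntClosure g)] (hv : IsPlace v)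
    (hv₁ : IsPlace v₁) (ht : v (genT g) ≤ 1) (ht₁ : v₁ (genT g) ≤ 1) (h₁ : v ≠ v₁) :
    ∃ r : BaseFunctionField g, IsIntegral K[X] r ∧ v r = exp (-1) ∧ v₁ r = 1 := by
  obtain ⟨P, rfl⟩ := hv.exists_eq_valuation ht
  obtain ⟨P₁, rfl⟩ := hv₁.exists_eq_valuation ht₁
  have hn : ¬ (P.asIdeal : Set (IntClosure g)) ⊆ (P.asIdeal ^ 2 : Ideal _) ∪ P₁.asIdeal := by
    rw [Ideal.subset_union]
    rintro (h | h)
    · obtain ⟨π, hπ⟩ := P.intValuation_exists_uniformizer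
      have h1 : π ∈ P.asIdeal := by
        have := (P.intValuation_le_pow_iff_mem π 1).mp (by rw [hπ]; rfl)
        rwa [pow_one] at this
      have h2 := (P.intValuation_le_pow_iff_mem π 2).mpr (h h1)
      rw [hπ, exp_le_exp] at h2
      norm_num at h2
    · exact valuation_notMem_of_ne (by rintro rfl; exact h₁ rfl) h
  obtain ⟨r, hr, hr'⟩ := Set.not_subset.mp hn
  rw [Set.mem_union, not_or] at hr'
  refine ⟨r, r.2, ?_, (P₁.valuation_eq_one_iff_notMem).mpr hr'.2⟩
  have hP : P.valuation (BaseFunctionField g) r = P.intValuation r := P.valuation_of_algebraMap r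
  rw [hP]
  have h1 : P.intValuation r ≤ exp (-((1 : ℕ) : ℤ)) := by
    rw [P.intValuation_le_pow_iff_mem, pow_one]; exact hr
  have h2 : ¬ P.intValuation r ≤ exp (-((2 : ℕ) : ℤ)) := by
    rw [P.intValuation_le_pow_iff_mem]; exact hr'.1
  have h0 : P.intValuation r ≠ 0 := fun h => h2 (h ▸ zero_le)
  obtain ⟨n, hn⟩ : ∃ n : ℤ, P.intValuation r = exp n := ⟨_, (exp_log h0).symm⟩
  rw [hn, exp_le_exp] at h1 h2
  rw [hn]
  congr 1
  push_cast at h1 h2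
  omega

/-- The closed point of the affine `t`-line below a place. -/
theorem IsPlace.exists_irreducible (h2 : (2 : K) ≠ 0) (hv : IsPlace v) (ht : v (genT g) ≤ 1) :
    ∃ q : K[X], Irreducible q ∧ ∀ p : K[X], v (algebraMap K[X] _ p) < 1 ↔ q ∣ p := by
  have := isDedekindDomain_intClosure g h2
  let I : Ideal K[X] :=
    { carrier := {p | v (algebraMap K[X] _ p) < 1}
      zero_mem' := by simp
      add_mem' := fun {a b} ha hb => by
        change v _ < 1
        rw [map_add]
        exact (v.map_add _ _).trans_lt (max_lt ha hb)
      smul_mem' := fun c a ha => by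
        change v (algebraMap K[X] _ (c * a)) < 1
        rw [map_mul, map_mul]
        exact (mul_le_of_le_one_left' (hv.val_polynomial_le_one ht c)).trans_lt ha }
  have hmem : ∀ p, p ∈ I ↔ v (algebraMap K[X] (BaseFunctionField g) p) < 1 := fun r => Iff.rfl
  have hprime : I.IsPrime := by
    refine ⟨(Ideal.ne_top_iff_one I).mpr (by rw [hmem]; simp), fun {a b} hab => ?_⟩
    by_contra! h
    simp only [hmem, not_lt] at h hab
    have ha := le_antisymm (hv.val_polynomial_le_one ht a) h.1
    have hb := le_antisymm (hv.val_polynomial_le_one ht b) h.2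
    simp [ha, hb] at hab
  have hbot : I ≠ ⊥ := by
    obtain ⟨P, hP⟩ := hv.exists_eq_valuation ht
    obtain ⟨π, hπ⟩ := P.intValuation_exists_uniformizer
    have hvπ : v (π : BaseFunctionField g) = exp (-1) := by
      rw [hP, ← hπ]; exact P.valuation_of_algebraMap π
    obtain ⟨p, hp⟩ := exists_polynomial_mul_conj π.2
    have hp1 : p ∈ I := by
      rw [hmem, ← hp, map_mul, hvπ]
      refine (mul_le_of_le_one_right' (hv.val_intClosure_le_one ht ⟨_, isIntegral_conj π.2⟩)).trans_lt ?_
      rw [← exp_zero, exp_lt_exp]; omega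
    intro hI
    rw [hI, Ideal.mem_bot] at hp1
    rw [hp1, map_zero, mul_eq_zero, EmbeddingLike.map_eq_zero_iff, or_self] at hp
    rw [hp, map_zero] at hvπ
    exact exp_ne_zero hvπ.symm
  refine ⟨Submodule.IsPrincipal.generator I,
    (Submodule.IsPrincipal.prime_generator_of_isPrime I hbot).irreducible, fun p => ?_⟩
  rw [← hmem, Submodule.IsPrincipal.mem_iff_generator_dvd]

/-- The places over a closed point of the affine `t`-line are conjugate under `s ↦ -s`: otherwise
the norm of a function that vanishes at `v'`, but at neither `v` nor its conjugate, would be a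
polynomial that vanishes at `v'` and not at `v`. -/
theorem IsPlace.val_eq_one_of_ne (h2 : (2 : K) ≠ 0) (hv : IsPlace v) (ht : v (genT g) ≤ 1)
    {q : K[X]} (hq : Irreducible q) (hvq : ∀ p : K[X], v (algebraMap K[X] _ p) < 1 ↔ q ∣ p)
    (hv' : IsPlace v') (ht' : v' (genT g) ≤ 1) (h₁ : v' ≠ v) (h₂ : v' ≠ conjVal v) :
    v' (algebraMap K[X] _ q) = 1 := by
  have := isDedekindDomain_intClosure g h2
  by_contra hne
  have hlt := lt_of_le_of_ne (hv'.val_polynomial_le_one ht' q) hne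
  have htc : conjVal v (genT g) ≤ 1 := by rwa [conjVal_ratFunc]
  obtain ⟨r, hr, hr1, hr2, hr3⟩ := exists_val_lt_one_and_eq_one hv' hv hv.comap_conj ht' ht htc h₁ h₂
  obtain ⟨p, hp⟩ := exists_polynomial_mul_conj hr
  obtain ⟨q', hq', hvq'⟩ := hv'.exists_irreducible h2 ht'
  have hp1 : v' (algebraMap K[X] _ p) < 1 := by
    rw [← hp, map_mul]
    exact (mul_le_of_le_one_right' (hv'.val_intClosure_le_one ht' ⟨_, isIntegral_conj hr⟩)).trans_lt hr1
  have hqq : q ∣ q' := hq'.dvd_symm hq ((hvq' q).mp hlt)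
  have hp2 := (hvq p).mpr (hqq.trans ((hvq' p).mp hp1))
  rw [← hp, map_mul, hr2, one_mul] at hp2
  exact hp2.ne hr3

/-- On `K(t)`, a finite place is a power of its value at the polynomial `q` that defines the closed
point below it. -/
theorem IsPlace.exists_zpow (hv : IsPlace v) (ht : v (genT g) ≤ 1)
    {q : K[X]} (hq : Irreducible q) (hvq : ∀ p : K[X], v (algebraMap K[X] _ p) < 1 ↔ q ∣ p)
    {a : RatFunc K} (ha : a ≠ 0) : ∃ n : ℤ, resVal v a = v (algebraMap K[X] _ q) ^ n := by
  have hpoly : ∀ p : K[X], p ≠ 0 → ∃ n : ℕ, v (algebraMap K[X] _ p) = v (algebraMap K[X] _ q) ^ n := by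
    intro p hp
    obtain ⟨n, p', hp', rfl⟩ := WfDvdMonoid.max_power_factor hp hq
    refine ⟨n, ?_⟩
    have h1 : v (algebraMap K[X] _ p') = 1 :=
      le_antisymm (hv.val_polynomial_le_one ht _) (not_lt.mp fun h => hp' ((hvq p').mp h))
    rw [map_mul, map_mul, h1, mul_one, map_pow, map_pow]
  obtain ⟨m, hm⟩ := hpoly a.num (RatFunc.num_ne_zero ha)
  obtain ⟨n, hn⟩ := hpoly a.denom a.denom_ne_zero
  rw [algebraMap_polynomial_eq a.num] at hm
  rw [algebraMap_polynomial_eq a.denom] at hn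
  refine ⟨m - n, ?_⟩
  have hq0 : v (algebraMap K[X] _ q) ≠ 0 := by
    rw [Valuation.ne_zero_iff, algebraMap_polynomial_eq, _root_.map_ne_zero]
    simpa using hq.ne_zero
  conv_lhs => rw [← RatFunc.num_div_denom a]
  rw [map_div₀, Valuation.comap_apply, Valuation.comap_apply, hm, hn, zpow_sub₀ hq0, zpow_natCast,
    zpow_natCast]

theorem eq_exp_neg_one_of_zpow {x : ℤᵐ⁰} (hx : x < 1) {n : ℤ} (h : exp (-1) = x ^ n) :
    x = exp (-1) := by
  have h0 : x ≠ 0 := by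
    rintro rfl
    by_cases hn : n = 0
    · rw [hn, zpow_zero, ← exp_zero] at h
      have := exp_injective h; omega
    · rw [zero_zpow _ hn] at h; exact exp_ne_zero h
  obtain ⟨m, rfl⟩ : ∃ m : ℤ, x = exp m := ⟨_, (exp_log h0).symm⟩
  rw [← exp_zero, exp_lt_exp] at hx
  rw [← exp_zsmul] at h
  have h1 := exp_injective h
  have h4 : m ∣ 1 := ⟨-n, by simp only [smul_eq_mul] at h1; linarith⟩
  have := Int.isUnit_iff.mp (isUnit_of_dvd_one h4)
  congr 1
  omega

/-- A place that is not fixed by `s ↦ -s` is unramified over the `t`-line: the norm of a uniformizer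
that is a unit at the conjugate place has order one. -/
theorem IsPlace.val_eq_of_ne_conjVal (h2 : (2 : K) ≠ 0) (hv : IsPlace v) (ht : v (genT g) ≤ 1)
    {q : K[X]} (hq : Irreducible q) (hvq : ∀ p : K[X], v (algebraMap K[X] _ p) < 1 ↔ q ∣ p)
    (h : v ≠ conjVal v) : v (algebraMap K[X] _ q) = exp (-1) := by
  have := isDedekindDomain_intClosure g h2
  have htc : conjVal v (genT g) ≤ 1 := by rwa [conjVal_ratFunc]
  obtain ⟨r, hr, hr1, hr2⟩ := exists_uniformizer_and_eq_one hv hv.comap_conj ht htc h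
  obtain ⟨n, hn⟩ := exists_mul_conj_eq r
  have hvn : resVal v n = exp (-1) := by
    rw [Valuation.comap_apply, ← hn, map_mul, hr1, ← conjVal_apply, hr2, mul_one]
  obtain ⟨m, hm⟩ := hv.exists_zpow ht hq hvq (a := n) (by
    rintro rfl; rw [map_zero] at hvn; exact exp_ne_zero hvn.symm)
  exact eq_exp_neg_one_of_zpow ((hvq q).mpr dvd_rfl) (hvn.symm.trans hm)

/-- A place fixed by `s ↦ -s` at which `s` does not vanish is unramified over the `t`-line: if
`a + b s` and its conjugate are uniformizers, then `a` or `b` has order one. -/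
theorem IsPlace.val_eq_of_eq_conjVal (h2 : (2 : K) ≠ 0) (hv : IsPlace v) (ht : v (genT g) ≤ 1)
    {q : K[X]} (hq : Irreducible q) (hvq : ∀ p : K[X], v (algebraMap K[X] _ p) < 1 ↔ q ∣ p)
    (h : v = conjVal v) (hs : v (genS g) = 1) : v (algebraMap K[X] _ q) = exp (-1) := by
  obtain ⟨z, hz⟩ := hv.surjective (exp (-1))
  obtain ⟨a, b, rfl⟩ := exists_eq_add_mul_genS z
  have hz' := hz
  rw [h, conjVal_apply] at hz'
  simp only [map_add, map_mul, AlgEquiv.commutes, conj_genS] at hz'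
  set A := algebraMap (RatFunc K) (BaseFunctionField g) a
  set B := algebraMap (RatFunc K) (BaseFunctionField g) b
  have hv2 : v 2 = 1 := by
    have := hv.trivial 2 h2
    rwa [map_ofNat] at this
  have hA : v A ≤ exp (-1) := by
    have : v (2 * A) ≤ exp (-1) := by
      rw [show 2 * A = (A + B * genS g) + (A + B * -genS g) by ring]
      exact (v.map_add _ _).trans (max_le hz.le hz'.le)
    rwa [map_mul, hv2, one_mul] at this
  have hB : v B ≤ exp (-1) := by
    have : v (2 * (B * genS g)) ≤ exp (-1) := by
      rw [show 2 * (B * genS g) = (A + B * genS g) - (A + B * -genS g) by ring]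
      exact (v.map_sub _ _).trans (max_le hz.le hz'.le)
    rwa [map_mul, map_mul, hv2, one_mul, hs, mul_one] at this
  have hmax : exp (-1) ≤ max (v A) (v B) := by
    have := v.map_add A (B * genS g)
    rwa [map_mul, hs, mul_one, hz] at this
  have key : ∀ c : RatFunc K, v (algebraMap (RatFunc K) (BaseFunctionField g) c) = exp (-1) →
      v (algebraMap K[X] _ q) = exp (-1) := by
    intro c hc
    obtain ⟨m, hm⟩ := hv.exists_zpow ht hq hvq (a := c) (by
      rintro rfl; rw [map_zero, map_zero] at hc; exact exp_ne_zero hc.symm)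
    exact eq_exp_neg_one_of_zpow ((hvq q).mpr dvd_rfl) (hc.symm.trans hm)
  rcases le_max_iff.mp hmax with h1 | h1
  · exact key a (le_antisymm hA h1)
  · exact key b (le_antisymm hB h1)

/-- A function whose only zeros and poles lie over the pole of `t` is constant. -/
theorem exists_const_of_val_eq_one (h2 : (2 : K) ≠ 0) (hodd : Odd g.natDegree) {h : BaseFunctionField g}
    (hh : ∀ v : Valuation (BaseFunctionField g) ℤᵐ⁰, IsPlace v → v (genT g) ≤ 1 → v h = 1)
    {w : Valuation (BaseFunctionField g) ℤᵐ⁰} (hw : IsPlace w) (hwt : 1 < w (genT g)) :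
    ∃ c : K, c ≠ 0 ∧ h = algebraMap K _ c := by
  have := isDedekindDomain_intClosure g h2
  have hint : IsIntegral K[X] h := by
    obtain ⟨r, hr⟩ := HeightOneSpectrum.mem_integers_of_valuation_le_one
      (R := IntClosure g) (BaseFunctionField g) h
      (fun P => (hh _ (isPlace_valuation P) (valuation_genT_le_one P)).le)
    rw [← hr]; exact r.2
  obtain ⟨a, b, hab⟩ := exists_eq_add_mul_genS h
  obtain ⟨p, hp⟩ := exists_polynomial_mul_conj hint
  -- the norm of `h` is a polynomial without zeros
  have hpu : IsUnit p := by
    by_contra hpu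
    have key : ∀ v : Valuation (BaseFunctionField g) ℤᵐ⁰, IsPlace v → v (genT g) ≤ 1 →
        v (algebraMap K[X] _ p) = 1 := by
      intro v hv ht
      rw [← hp, map_mul, hh v hv ht, one_mul]
      exact hh _ hv.comap_conj (by rwa [conjVal_ratFunc])
    have hp0 : p ≠ 0 := by
      rintro rfl
      obtain ⟨v, hv, ht, -⟩ := exists_isPlace_val_lt_one (g := g) h2 (p := X) not_isUnit_X X_ne_zero
      have := key v hv ht
      simp at this
    obtain ⟨v, hv, ht, hvp⟩ := exists_isPlace_val_lt_one (g := g) h2 hpu hp0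
    exact hvp.ne (key v hv ht)
  obtain ⟨e, he, rfl⟩ := Polynomial.isUnit_iff.mp hpu
  have hCe : algebraMap K[X] (BaseFunctionField g) (C e) = algebraMap K _ e :=
    (IsScalarTower.algebraMap_apply K K[X] (BaseFunctionField g) e).symm
  rw [hCe] at hp
  obtain ⟨w1, w2, w3⟩ := hw.val_infinity hwt hodd
  have hwc : conjVal w = w :=
    hw.comap_conj.eq_of_infinity hw (by rwa [conjVal_ratFunc]) hwt hodd
  have hwh : w h = 1 := by
    have h1 := congrArg w hp
    rw [map_mul, ← conjVal_apply, hwc, hw.trivial e he.ne_zero, ← sq] at h1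
    exact (pow_eq_one_iff.mp h1).resolve_right two_ne_zero
  -- the trace of `h` is a polynomial without pole at infinity
  have ha : IsIntegral K[X] (algebraMap (RatFunc K) (BaseFunctionField g) a) := by
    have h1 : algebraMap (RatFunc K) (BaseFunctionField g) a =
        algebraMap K[X] _ (C (2⁻¹ : K)) * (h + conj g h) := by
      have h3 : algebraMap K[X] (BaseFunctionField g) (C (2⁻¹ : K)) * 2 = 1 := by
        rw [← map_ofNat (algebraMap K[X] (BaseFunctionField g)) 2, ← map_mul, ← map_ofNat C 2,
          ← map_mul, inv_mul_cancel₀ h2, map_one, map_one]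
      rw [hab]
      simp only [map_add, map_mul, AlgEquiv.commutes, conj_genS]
      linear_combination -(algebraMap (RatFunc K) (BaseFunctionField g) a) * h3
    rw [h1]
    exact isIntegral_algebraMap.mul (hint.add (isIntegral_conj hint))
  obtain ⟨q, rfl⟩ := exists_polynomial_of_isIntegral ha
  have hw' := hwh
  rw [hab, w3] at hw'
  have hq : q.natDegree = 0 := by
    by_cases hq0 : q = 0
    · simp [hq0]
    have h1 : resVal w (algebraMap K[X] (RatFunc K) q) ≤ 1 := hw' ▸ le_max_left _ _
    rw [w1 _ (by simpa using hq0), RatFunc.intDegree_polynomial, ← exp_zero, exp_le_exp] at h1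
    omega
  obtain ⟨c, rfl⟩ := natDegree_eq_zero.mp hq
  -- otherwise `b ^ 2 g` is a constant, although its degree is odd
  have hb : b = 0 := by
    by_contra hb
    obtain ⟨j, hj⟩ := hodd
    have h1 : b ^ 2 * algebraMap K[X] (RatFunc K) g = RatFunc.C (c ^ 2 - e) := by
      have h3 := mul_conj (g := g) (algebraMap K[X] (RatFunc K) (C c)) b
      rw [← hab, hp, IsScalarTower.algebraMap_apply K (RatFunc K)] at h3
      have h4 := (algebraMap (RatFunc K) (BaseFunctionField g)).injective h3
      rw [RatFunc.algebraMap_C, RatFunc.algebraMap_eq_C] at h4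
      rw [map_sub, map_pow, h4]
      ring
    have h3 := congrArg RatFunc.intDegree h1
    have hg0 : algebraMap K[X] (RatFunc K) g ≠ 0 := by
      simpa using (ne_zero_of_irreducible_quadRel (g := g))
    rw [RatFunc.intDegree_C, RatFunc.intDegree_mul (pow_ne_zero 2 hb) hg0, sq,
      RatFunc.intDegree_mul hb hb, RatFunc.intDegree_polynomial] at h3
    omega
  refine ⟨c, ?_, ?_⟩
  · rintro rfl
    rw [hab, hb] at hwh
    simp at hwh
  · rw [hab, hb, ← algebraMap_polynomial_eq, map_zero, zero_mul, add_zero]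
    exact (IsScalarTower.algebraMap_apply K K[X] (BaseFunctionField g) c).symm

end Fibres

/-! ### Divisor classes of order two on `s² = g(t)` with `g` of odd degree -/

section ModelDivisors

open IsDedekindDomain

variable {K : Type*} [Field K] {g : K[X]}

theorem algebraMap_X_sub_C (i : K) :
    algebraMap K[X] (BaseFunctionField g) (X - C i) = genT g - algebraMap K _ i := by
  rw [map_sub, algebraMap_polynomial_eq X, RatFunc.algebraMap_X]
  rfl

theorem ratFunc_X_sub_C_ne_zero (i : K) : algebraMap K[X] (RatFunc K) (X - C i) ≠ 0 :=
  (map_ne_zero_iff _ (IsFractionRing.injective K[X] (RatFunc K))).mpr (X_sub_C_ne_zero i)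

variable [Fact (Irreducible (quadRel g))]
  {P : Type*} {val : P → Valuation (BaseFunctionField g) ℤᵐ⁰}

/-- `val` enumerates the places of `K(t, s)` without repetition. -/
structure IsPlaceFamily (val : P → Valuation (BaseFunctionField g) ℤᵐ⁰) : Prop where
  injective : Function.Injective val
  isPlace : ∀ p, IsPlace (val p)
  exists_eq : ∀ v, IsPlace v → ∃ p, val p = v

/-- `D` is the divisor of the function `h`. -/
def IsDivOf (val : P → Valuation (BaseFunctionField g) ℤᵐ⁰) (D : P →₀ ℤ)
    (h : BaseFunctionField g) : Prop :=
  h ≠ 0 ∧ ∀ p, D p = -log (val p h)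

namespace IsDivOf

variable {D D' : P →₀ ℤ} {h h' : BaseFunctionField g}

theorem one : IsDivOf val 0 1 := ⟨one_ne_zero, fun p => by simp⟩

theorem mul (H : IsDivOf val D h) (H' : IsDivOf val D' h') : IsDivOf val (D + D') (h * h') :=
  ⟨mul_ne_zero H.1 H'.1, fun p => by
    rw [Finsupp.add_apply, H.2, H'.2, map_mul, log_mul ((Valuation.ne_zero_iff _).mpr H.1)
      ((Valuation.ne_zero_iff _).mpr H'.1)]
    ring⟩

theorem inv (H : IsDivOf val D h) : IsDivOf val (-D) h⁻¹ :=
  ⟨inv_ne_zero H.1, fun p => by rw [Finsupp.neg_apply, H.2, map_inv₀, log_inv]⟩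

theorem div (H : IsDivOf val D h) (H' : IsDivOf val D' h') : IsDivOf val (D - D') (h / h') := by
  rw [sub_eq_add_neg, div_eq_mul_inv]
  exact H.mul H'.inv

theorem pow (H : IsDivOf val D h) (n : ℕ) : IsDivOf val (n • D) (h ^ n) := by
  induction n with
  | zero => simpa using one
  | succ n ih => rw [succ_nsmul, pow_succ]; exact ih.mul H

theorem prod {ι : Type*} {D : ι → P →₀ ℤ} {h : ι → BaseFunctionField g} (S : Finset ι)
    (H : ∀ i ∈ S, IsDivOf val (D i) (h i)) : IsDivOf val (∑ i ∈ S, D i) (∏ i ∈ S, h i) := by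
  classical
  induction S using Finset.induction_on with
  | empty => simpa using one
  | insert a s ha ih =>
    rw [Finset.sum_insert ha, Finset.prod_insert ha]
    exact (H a (Finset.mem_insert_self _ _)).mul
      (ih fun i hi => H i (Finset.mem_insert_of_mem hi))

theorem val_eq (H : IsDivOf val D h) (p : P) : val p h = exp (-D p) := by
  rw [H.2, neg_neg, exp_log ((Valuation.ne_zero_iff _).mpr H.1)]

end IsDivOf

theorem isDivOf_of_val_eq {D : P →₀ ℤ} {h : BaseFunctionField g} (h0 : h ≠ 0)
    (H : ∀ p, val p h = exp (-D p)) : IsDivOf val D h :=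
  ⟨h0, fun p => by rw [H, log_exp, neg_neg]⟩

/-- Principal divisors. -/
def prinDiv (val : P → Valuation (BaseFunctionField g) ℤᵐ⁰) : AddSubgroup (P →₀ ℤ) where
  carrier := {D | ∃ h, IsDivOf val D h}
  zero_mem' := ⟨1, IsDivOf.one⟩
  add_mem' := fun ⟨h, H⟩ ⟨h', H'⟩ => ⟨h * h', H.mul H'⟩
  neg_mem' := fun ⟨h, H⟩ => ⟨h⁻¹, H.inv⟩

theorem IsDivOf.mem_prinDiv {D : P →₀ ℤ} {h : BaseFunctionField g} (H : IsDivOf val D h) :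
    D ∈ prinDiv val := ⟨h, H⟩

namespace IsPlaceFamily

variable (hval : IsPlaceFamily val)
include hval

/-- Functions have finitely many zeros and poles. -/
theorem exists_isDivOf (h2 : (2 : K) ≠ 0) (hodd : Odd g.natDegree) {h : BaseFunctionField g}
    (h0 : h ≠ 0) : ∃ D : P →₀ ℤ, IsDivOf val D h := by
  have := isDedekindDomain_intClosure g h2
  have hfin : {p | -log (val p h) ≠ 0}.Finite := by
    let A : Set (Valuation (BaseFunctionField g) ℤᵐ⁰) :=
      (fun Q : HeightOneSpectrum (IntClosure g) => Q.valuation (BaseFunctionField g)) ''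
        (HeightOneSpectrum.Support (IntClosure g) h ∪ HeightOneSpectrum.Support (IntClosure g) h⁻¹)
    let B : Set (Valuation (BaseFunctionField g) ℤᵐ⁰) := {v | IsPlace v ∧ 1 < v (genT g)}
    have hA : A.Finite := ((HeightOneSpectrum.Support.finite _ _).union
      (HeightOneSpectrum.Support.finite _ _)).image _
    have hB : B.Finite := Set.Subsingleton.finite fun v hv w hw =>
      hv.1.eq_of_infinity hw.1 hv.2 hw.2 hodd
    refine ((hA.union hB).preimage hval.injective.injOn).subset fun p hp => ?_
    by_cases ht : val p (genT g) ≤ 1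
    · left
      obtain ⟨Q, hQ⟩ := (hval.isPlace p).exists_eq_valuation ht
      refine ⟨Q, ?_, hQ.symm⟩
      change 1 < Q.valuation _ h ∨ 1 < Q.valuation _ h⁻¹
      rw [← hQ]
      by_contra! hle
      rw [map_inv₀] at hle
      have hne : val p h ≠ 0 := (Valuation.ne_zero_iff _).mpr h0
      have h1 := le_antisymm hle.1 ((inv_le_one₀ (zero_lt_iff.mpr hne)).mp hle.2)
      simp [h1] at hp
    · right
      exact ⟨hval.isPlace p, not_le.mp ht⟩
  exact ⟨Finsupp.ofSupportFinite (fun p => -log (val p h)) hfin, h0, fun p => rfl⟩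

theorem exists_conj (p : P) : ∃ p', val p' = conjVal (val p) :=
  hval.exists_eq _ (hval.isPlace p).comap_conj

end IsPlaceFamily

/-- The data of a hyperelliptic curve `s² = c ∏ (t - i)` of odd degree: an enumeration `val` of its
places, the place `w₀` at infinity and the places `w i` over the roots `i`, together with the
involution `conjP` of the set of places. The constant field has square roots. -/
structure OddModel (val : P → Valuation (BaseFunctionField g) ℤᵐ⁰) (c : K) (T : Finset K)
    (w₀ : P) (w : K → P) (conjP : P → P) : Prop where
  fam : IsPlaceFamily val
  eq : g = C c * ∏ i ∈ T, (X - C i)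
  odd : Odd T.card
  infinity : ∀ p, 1 < val p (genT g) ↔ p = w₀
  root : ∀ i ∈ T, ∀ p, val p (genT g - algebraMap K _ i) < 1 ↔ p = w i
  val_conjP : ∀ p, val (conjP p) = conjVal (val p)
  two : (2 : K) ≠ 0
  sqrt : ∀ d : K, ∃ e, e ^ 2 = d

namespace OddModel

variable {c : K} {T : Finset K} {w₀ : P} {w : K → P} {conjP : P → P}
  (hM : OddModel val c T w₀ w conjP)
include hM

theorem const_ne_zero : c ≠ 0 := by
  rintro rfl
  exact ne_zero_of_irreducible_quadRel (g := g) (by rw [hM.eq]; simp)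

theorem natDegree_eq : g.natDegree = T.card := by
  rw [hM.eq, natDegree_C_mul hM.const_ne_zero, natDegree_prod_of_monic _ _ fun i _ => monic_X_sub_C i]
  simp

theorem odd_natDegree : Odd g.natDegree := hM.natDegree_eq ▸ hM.odd

theorem one_lt_val : 1 < val w₀ (genT g) := (hM.infinity w₀).mpr rfl

theorem val_le_one {p : P} (hp : p ≠ w₀) : val p (genT g) ≤ 1 :=
  not_lt.mp fun h => hp ((hM.infinity p).mp h)

theorem conjP_conjP (p : P) : conjP (conjP p) = p :=
  hM.fam.injective (by rw [hM.val_conjP, hM.val_conjP, conjVal_conjVal])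

theorem conjP_infinity : conjP w₀ = w₀ := by
  rw [← hM.infinity, hM.val_conjP, conjVal_ratFunc]
  exact hM.one_lt_val

theorem root_ne_infinity {i : K} (hi : i ∈ T) : w i ≠ w₀ := by
  intro h
  have h1 := (hM.root i hi (w i)).mpr rfl
  have h3 := hM.one_lt_val
  rw [h] at h1
  have h4 : val w₀ (algebraMap K (BaseFunctionField g) i) ≤ 1 := by
    by_cases hi : i = 0
    · simp [hi]
    · exact ((hM.fam.isPlace w₀).trivial i hi).le
  have h5 := (val w₀).map_add (genT g - algebraMap K _ i) (algebraMap K _ i)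
  rw [sub_add_cancel] at h5
  exact absurd (h5.trans (max_le h1.le h4)) (not_le.mpr h3)

theorem val_const (p : P) {d : K} (hd : d ≠ 0) : val p (algebraMap K _ d) = 1 :=
  (hM.fam.isPlace p).trivial d hd

theorem isDivOf_const {d : K} (hd : d ≠ 0) : IsDivOf val 0 (algebraMap K (BaseFunctionField g) d) :=
  isDivOf_of_val_eq ((_root_.map_ne_zero _).mpr hd) fun p => by rw [hM.val_const p hd]; simp

theorem algebraMap_g : algebraMap K[X] (BaseFunctionField g) g =
    algebraMap K _ c * ∏ i ∈ T, (genT g - algebraMap K _ i) := by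
  rw [show algebraMap K[X] (BaseFunctionField g) g =
    algebraMap K[X] (BaseFunctionField g) (C c * ∏ i ∈ T, (X - C i)) from congrArg _ hM.eq,
    map_mul, map_prod]
  exact congrArg₂ _ rfl <| Finset.prod_congr rfl fun i _ => algebraMap_X_sub_C i

theorem val_sub_eq_one {p : P} (hp : p ≠ w₀) {i : K} (hi : i ∈ T) (hpi : p ≠ w i) :
    val p (genT g - algebraMap K _ i) = 1 := by
  refine le_antisymm ?_ (not_lt.mp fun h => hpi ((hM.root i hi p).mp h))
  rw [← algebraMap_X_sub_C]
  exact (hM.fam.isPlace p).val_polynomial_le_one (hM.val_le_one hp) _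

theorem root_injective {i j : K} (hi : i ∈ T) (hj : j ∈ T) (h : w i = w j) : i = j := by
  by_contra hij
  have h1 := (hM.root i hi (w i)).mpr rfl
  have h3 := (hM.root j hj (w i)).mpr h
  have h4 := (val (w i)).map_sub (genT g - algebraMap K _ i) (genT g - algebraMap K _ j)
  rw [sub_sub_sub_cancel_left, ← map_sub, hM.val_const _ (sub_ne_zero.mpr (Ne.symm hij))] at h4
  exact absurd (h4.trans_lt (max_lt h1 h3)) (lt_irrefl _)

theorem val_genS_sq_eq (p : P) :
    val p (genS g) ^ 2 = ∏ i ∈ T, val p (genT g - algebraMap K _ i) := by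
  rw [val_genS_sq, Valuation.comap_apply, ← algebraMap_polynomial_eq, hM.algebraMap_g, map_mul,
    hM.val_const _ hM.const_ne_zero, one_mul, map_prod]

theorem val_root_genS_sq {i : K} (hi : i ∈ T) :
    val (w i) (genS g) ^ 2 = val (w i) (genT g - algebraMap K _ i) := by
  rw [hM.val_genS_sq_eq]
  exact Finset.prod_eq_single_of_mem i hi fun j hj hji =>
    hM.val_sub_eq_one (hM.root_ne_infinity hi) hj
      fun h => hji (hM.root_injective hi hj h).symm

theorem val_root_genS_lt_one {i : K} (hi : i ∈ T) : val (w i) (genS g) < 1 := by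
  have h := (hM.root i hi (w i)).mpr rfl
  rw [← hM.val_root_genS_sq hi] at h
  exact (pow_lt_one_iff two_ne_zero).mp h

theorem val_root_ratFunc {i : K} (hi : i ∈ T) {a : RatFunc K} (ha : a ≠ 0) :
    ∃ m : ℤ, val (w i) (algebraMap _ (BaseFunctionField g) a) = val (w i) (genS g) ^ (2 * m) := by
  have hpl := hM.fam.isPlace (w i)
  have ht := hM.val_le_one (hM.root_ne_infinity hi)
  obtain ⟨q, hq, hvq⟩ := hpl.exists_irreducible hM.two ht
  have hqi : q ∣ X - C i := by
    rw [← hvq, algebraMap_X_sub_C]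
    exact (hM.root i hi (w i)).mpr rfl
  have hqi' : Associated q (X - C i) := hq.associated_of_dvd (irreducible_X_sub_C i) hqi
  have hvq' : ∀ p : K[X], val (w i) (algebraMap K[X] _ p) < 1 ↔ (X - C i) ∣ p := fun p =>
    (hvq p).trans hqi'.dvd_iff_dvd_left
  obtain ⟨m, hm⟩ := hpl.exists_zpow ht (irreducible_X_sub_C i) hvq' ha
  refine ⟨m, ?_⟩
  rw [algebraMap_X_sub_C, ← hM.val_root_genS_sq hi, Valuation.comap_apply] at hm
  rw [hm, zpow_mul]
  norm_cast

/-- At the place over a root `i` of `g` the function `s` is a uniformizer. -/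
theorem val_root_genS {i : K} (hi : i ∈ T) : val (w i) (genS g) = exp (-1) := by
  have hlt := hM.val_root_genS_lt_one hi
  obtain ⟨z, hz⟩ := (hM.fam.isPlace (w i)).surjective (exp (-1))
  obtain ⟨a, b, rfl⟩ := exists_eq_add_mul_genS z
  set x := val (w i) (genS g) with hx
  have hx0 : x ≠ 0 := (Valuation.ne_zero_iff _).mpr genS_ne_zero
  -- it suffices that the value `exp (-1)` is a power of the value of `s`
  by_cases ha : a = 0
  · by_cases hb : b = 0
    · rw [ha, hb] at hz
      simp only [map_zero, zero_mul, add_zero] at hz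
      exact absurd hz.symm exp_ne_zero
    · obtain ⟨m, hm⟩ := hM.val_root_ratFunc hi hb
      rw [ha, map_zero, zero_add, map_mul, hm, ← hx, ← zpow_add_one₀ hx0] at hz
      exact eq_exp_neg_one_of_zpow hlt hz.symm
  · obtain ⟨l, hl⟩ := hM.val_root_ratFunc hi ha
    by_cases hb : b = 0
    · rw [hb, map_zero, zero_mul, add_zero, hl] at hz
      exact eq_exp_neg_one_of_zpow hlt hz.symm
    · obtain ⟨m, hm⟩ := hM.val_root_ratFunc hi hb
      have hm' : val (w i) (algebraMap _ (BaseFunctionField g) b * genS g) = x ^ (2 * m + 1) := by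
        rw [map_mul, hm, ← hx, ← zpow_add_one₀ hx0]
      rw [Valuation.map_add_of_distinct_val _ (by
        rw [hl, hm']
        intro h
        have := zpow_right_injective₀ (zero_lt_iff.mpr hx0) hlt.ne h
        omega), hl, hm'] at hz
      rcases max_choice (x ^ (2 * l)) (x ^ (2 * m + 1)) with h | h
      · rw [h] at hz; exact eq_exp_neg_one_of_zpow hlt hz.symm
      · rw [h] at hz; exact eq_exp_neg_one_of_zpow hlt hz.symm

theorem val_infinity_sub (i : K) : val w₀ (genT g - algebraMap K _ i) = exp 2 := by
  obtain ⟨h1, -, -⟩ := (hM.fam.isPlace w₀).val_infinity hM.one_lt_val hM.odd_natDegree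
  rw [← algebraMap_X_sub_C, algebraMap_polynomial_eq]
  change resVal (val w₀) _ = _
  rw [h1 _ (ratFunc_X_sub_C_ne_zero i), RatFunc.intDegree_polynomial, natDegree_X_sub_C]
  rfl

/-- The divisor of `t - i` is `2 (w i) - 2 (w₀)`. -/
theorem isDivOf_sub {i : K} (hi : i ∈ T) :
    IsDivOf val (Finsupp.single (w i) 2 - Finsupp.single w₀ 2) (genT g - algebraMap K _ i) := by
  classical
  refine isDivOf_of_val_eq ?_ fun p => ?_
  · rw [← algebraMap_X_sub_C, algebraMap_polynomial_eq, _root_.map_ne_zero]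
    exact ratFunc_X_sub_C_ne_zero i
  · have hne := hM.root_ne_infinity hi
    rw [Finsupp.sub_apply, Finsupp.single_apply, Finsupp.single_apply]
    by_cases hp : p = w₀
    · subst hp
      rw [hM.val_infinity_sub, if_neg hne, if_pos rfl]
      simp
    · rw [if_neg (Ne.symm hp)]
      by_cases hpi : p = w i
      · subst hpi
        rw [if_pos rfl, ← hM.val_root_genS_sq hi, hM.val_root_genS hi, ← exp_nsmul]
        simp
      · rw [if_neg (Ne.symm hpi), hM.val_sub_eq_one hp hi hpi]
        simp

theorem eq_root_of_val_genS_lt_one {p : P} (h : val p (genS g) < 1) :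
    ∃ i ∈ T, p = w i := by
  by_contra! hne
  by_cases hp : p = w₀
  · subst hp
    obtain ⟨-, h1, -⟩ := (hM.fam.isPlace p).val_infinity hM.one_lt_val hM.odd_natDegree
    rw [h1, ← exp_zero, exp_lt_exp] at h
    omega
  · have h1 := hM.val_genS_sq_eq p
    rw [Finset.prod_eq_one fun i hi => hM.val_sub_eq_one hp hi (hne i hi)] at h1
    exact h.ne ((pow_eq_one_iff.mp h1).resolve_right two_ne_zero)

theorem val_genS_le_one {p : P} (hp : p ≠ w₀) : val p (genS g) ≤ 1 := by
  have h1 := val_genS_sq (val p)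
  rw [Valuation.comap_apply, ← algebraMap_polynomial_eq] at h1
  rw [← pow_le_one_iff (n := 2) two_ne_zero, h1]
  exact (hM.fam.isPlace p).val_polynomial_le_one (hM.val_le_one hp) _

/-- The divisor of `s` is the sum of the `w i` minus `deg g` times `w₀`. -/
theorem isDivOf_genS : IsDivOf val
    (∑ i ∈ T, Finsupp.single (w i) 1 - Finsupp.single w₀ (T.card : ℤ)) (genS g) := by
  classical
  refine isDivOf_of_val_eq genS_ne_zero fun p => ?_
  rw [Finsupp.sub_apply, Finsupp.finsetSum_apply, Finsupp.single_apply]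
  simp only [Finsupp.single_apply]
  by_cases hp : p = w₀
  · subst hp
    obtain ⟨-, h1, -⟩ := (hM.fam.isPlace p).val_infinity hM.one_lt_val hM.odd_natDegree
    rw [h1, hM.natDegree_eq, Finset.sum_eq_zero fun i hi => if_neg (hM.root_ne_infinity hi),
      if_pos rfl]
    simp
  · rw [if_neg (Ne.symm hp)]
    by_cases h : ∃ i ∈ T, p = w i
    · obtain ⟨i, hi, rfl⟩ := h
      rw [hM.val_root_genS hi, Finset.sum_eq_single_of_mem i hi fun j hj hji =>
        if_neg fun h => hji (hM.root_injective hj hi h), if_pos rfl]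
      simp
    · have h1 : val p (genS g) = 1 :=
        le_antisymm (hM.val_genS_le_one hp) (not_lt.mp fun hlt => h (hM.eq_root_of_val_genS_lt_one hlt))
      rw [h1, Finset.sum_eq_zero fun i hi => if_neg fun hh => h ⟨i, hi, hh.symm⟩]
      simp

/-- Only constants have a divisor supported at infinity. -/
theorem exists_const {n : ℤ} {h : BaseFunctionField g}
    (H : IsDivOf val (Finsupp.single w₀ n) h) : ∃ d : K, d ≠ 0 ∧ h = algebraMap K _ d := by
  refine exists_const_of_val_eq_one hM.two hM.odd_natDegree (fun v hv ht => ?_)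
    (hM.fam.isPlace w₀) hM.one_lt_val
  obtain ⟨p, rfl⟩ := hM.fam.exists_eq v hv
  have hp : p ≠ w₀ := fun h => absurd ((hM.infinity p).mpr h) (not_lt.mpr ht)
  rw [H.val_eq, Finsupp.single_eq_of_ne hp]
  simp

theorem eq_zero_of_single_mem {n : ℤ} (h : Finsupp.single w₀ n ∈ prinDiv val) : n = 0 := by
  obtain ⟨h, H⟩ := h
  obtain ⟨d, hd, rfl⟩ := hM.exists_const H
  have := H.val_eq w₀
  rw [hM.val_const _ hd, Finsupp.single_eq_same, ← exp_zero] at this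
  have := exp_injective this
  omega

end OddModel

end ModelDivisors

/-! ### The 2-torsion of the odd degree model -/

section ModelTwoTorsion

variable {K : Type*} [Field K] {g : K[X]}

/-- A product of distinct linear factors is the square of a rational function only
if it is empty. -/
theorem eq_empty_of_sq_eq_prod {S : Finset K} {a : RatFunc K}
    (h : a ^ 2 = algebraMap K[X] (RatFunc K) (∏ i ∈ S, (X - C i))) : S = ∅ := by
  have hint : IsIntegral K[X] a :=
    IsIntegral.of_pow (n := 2) two_pos (by rw [h]; exact isIntegral_algebraMap)
  obtain ⟨q, rfl⟩ := IsIntegrallyClosed.isIntegral_iff.mp hint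
  rw [← map_pow] at h
  have h1 := IsFractionRing.injective K[X] (RatFunc K) h
  have hsep : (∏ i ∈ S, (X - C i)).Separable :=
    separable_prod_X_sub_C_iff'.mpr fun x _ y _ h => h
  have hu : IsUnit q := hsep.squarefree q ⟨1, by rw [← h1]; ring⟩
  have hdeg := natDegree_eq_zero_of_isUnit (hu.pow 2)
  rw [h1, natDegree_prod_of_monic _ _ fun i _ => monic_X_sub_C i] at hdeg
  simpa using hdeg

variable [Fact (Irreducible (quadRel g))]
  {P : Type*} {val : P → Valuation (BaseFunctionField g) ℤᵐ⁰}

theorem eq_zero_of_add_mul_genS_eq (h2 : (2 : K) ≠ 0) {a b : RatFunc K}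
    (h : algebraMap _ (BaseFunctionField g) a + algebraMap _ (BaseFunctionField g) b * genS g = 0) :
    b = 0 := by
  have h' := congrArg (conj g) h
  simp only [map_add, map_mul, AlgEquiv.commutes, conj_genS, map_zero] at h'
  have h3 : (2 : BaseFunctionField g) * (algebraMap _ (BaseFunctionField g) b * genS g) = 0 := by
    linear_combination h - h'
  have h4 : (2 : BaseFunctionField g) ≠ 0 := by
    have := (_root_.map_ne_zero (algebraMap (RatFunc K) (BaseFunctionField g))).mpr
      (two_ne_zero_ratFunc h2)
    rwa [map_ofNat] at this
  have h5 := (mul_eq_zero.mp ((mul_eq_zero.mp h3).resolve_left h4)).resolve_right genS_ne_zero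
  exact (_root_.map_eq_zero _).mp h5

namespace OddModel

variable {c : K} {T : Finset K} {w₀ : P} {w : K → P} {conjP : P → P}
  (hM : OddModel val c T w₀ w conjP)
include hM

/-- A partial sum of Weierstrass points is principal, up to a multiple of the point at infinity,
only for the empty set and the full set of roots: if `h` has this divisor, then `h ^ 2` is
`∏ (t - i)` over `S` up to a constant, so for `h = a + b s` with `a b = 0` this product or that over
the complement of `S` is a square in `K(t)`. -/
theorem eq_empty_or_eq_of_mem_prinDiv {S : Finset K} (hS : S ⊆ T) {n : ℤ}
    (h : ∑ i ∈ S, Finsupp.single (w i) 1 + Finsupp.single w₀ n ∈ prinDiv val) :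
    S = ∅ ∨ S = T := by
  classical
  obtain ⟨h, H⟩ := h
  have H1 := IsDivOf.prod S fun i hi => hM.isDivOf_sub (hS hi)
  have H2 := (H.pow 2).div H1
  have hD : 2 • (∑ i ∈ S, Finsupp.single (w i) (1 : ℤ) + Finsupp.single w₀ n) -
      ∑ i ∈ S, (Finsupp.single (w i) (2 : ℤ) - Finsupp.single w₀ 2) =
        Finsupp.single w₀ (2 * n + 2 * S.card) := by
    rw [Finset.sum_sub_distrib, nsmul_add, Finset.smul_sum]
    simp only [Finsupp.smul_single, Finset.sum_const]
    simp only [nsmul_eq_mul, Nat.cast_ofNat, mul_one]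
    rw [Finsupp.single_add, mul_comm 2 (S.card : ℤ)]
    abel
  rw [hD] at H2
  obtain ⟨d, hd, hdh⟩ := hM.exists_const H2
  obtain ⟨e, rfl⟩ := hM.sqrt d
  have he : e ≠ 0 := by rintro rfl; simp at hd
  have hprod : ∏ i ∈ S, (genT g - algebraMap K (BaseFunctionField g) i) =
      algebraMap (RatFunc K) _ (algebraMap K[X] (RatFunc K) (∏ i ∈ S, (X - C i))) := by
    rw [← algebraMap_polynomial_eq, map_prod]
    exact Finset.prod_congr rfl fun i _ => (algebraMap_X_sub_C i).symm
  have he' : algebraMap K (BaseFunctionField g) e ≠ 0 := (_root_.map_ne_zero _).mpr he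
  have hsq : (h / algebraMap K _ e) ^ 2 =
      algebraMap (RatFunc K) _ (algebraMap K[X] (RatFunc K) (∏ i ∈ S, (X - C i))) := by
    rw [← hprod, div_pow, ← map_pow, div_eq_iff (by rw [map_pow]; exact pow_ne_zero 2 he'), ← hdh,
      mul_div_cancel₀ _ H1.1]
  set F := algebraMap (RatFunc K) (BaseFunctionField g) with hF
  obtain ⟨a, b, hab⟩ := exists_eq_add_mul_genS (h / algebraMap K _ e)
  rw [hab] at hsq
  have hrel : F (a ^ 2 + b ^ 2 * algebraMap K[X] (RatFunc K) g -
      algebraMap K[X] (RatFunc K) (∏ i ∈ S, (X - C i))) + F (2 * a * b) * genS g = 0 := by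
    rw [map_sub, map_add, map_mul, map_mul, map_mul, map_pow, map_pow, ← hsq, map_ofNat,
      hF, ← genS_sq]
    ring
  have hab0 := eq_zero_of_add_mul_genS_eq hM.two hrel
  rw [hab0, map_zero, zero_mul, add_zero, _root_.map_eq_zero, sub_eq_zero] at hrel
  rw [mul_assoc, mul_eq_zero, or_iff_right (two_ne_zero_ratFunc hM.two), mul_eq_zero] at hab0
  rcases hab0 with rfl | rfl
  · right
    obtain ⟨c', hc'⟩ := hM.sqrt c
    set π := algebraMap K[X] (RatFunc K) (∏ i ∈ S, (X - C i)) with hπ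
    set π' := algebraMap K[X] (RatFunc K) (∏ i ∈ T \ S, (X - C i)) with hπ'
    have hπ0 : π ≠ 0 := by
      rw [hπ, map_prod]
      exact Finset.prod_ne_zero_iff.mpr fun i _ => ratFunc_X_sub_C_ne_zero i
    have hc0 : RatFunc.C c' ≠ 0 := by
      rw [_root_.map_ne_zero]
      rintro rfl
      exact hM.const_ne_zero (by rw [← hc']; simp)
    have hg : algebraMap K[X] (RatFunc K) g = RatFunc.C c' ^ 2 * (π' * π) := by
      have : algebraMap K[X] (RatFunc K) g =
        algebraMap K[X] (RatFunc K) (C c * ∏ i ∈ T, (X - C i)) := congrArg _ hM.eq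
      rw [this, map_mul, ← Finset.prod_sdiff hS, map_mul, RatFunc.algebraMap_C, ← hc', map_pow]
    have hsq' : (b * RatFunc.C c' * π') ^ 2 = π' := by
      have : π * ((b * RatFunc.C c' * π') ^ 2 - π') = 0 := by
        rw [hg] at hrel
        linear_combination π' * hrel
      exact sub_eq_zero.mp ((mul_eq_zero.mp this).resolve_left hπ0)
    have := eq_empty_of_sq_eq_prod hsq'
    exact Finset.Subset.antisymm hS (Finset.sdiff_eq_empty_iff_subset.mp this)
  · left
    rw [zero_pow two_ne_zero, zero_mul, add_zero] at hrel
    exact eq_empty_of_sq_eq_prod hrel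

/-- The sum of a place and its conjugate is equivalent to a multiple of the place at infinity, and
so is a place equal to its conjugate, unless it is a Weierstrass point. -/
theorem exists_add_conjP_mem {p : P} (hp : p ≠ w₀) :
    (∃ n : ℤ, Finsupp.single p 1 + Finsupp.single (conjP p) 1 - Finsupp.single w₀ n ∈
      prinDiv val) ∧
    (conjP p = p → (∃ i ∈ T, p = w i) ∨
      ∃ n : ℤ, Finsupp.single p 1 - Finsupp.single w₀ n ∈ prinDiv val) := by
  classical
  have hpl := hM.fam.isPlace p
  have ht := hM.val_le_one hp
  obtain ⟨q, hq, hvq⟩ := hpl.exists_irreducible hM.two ht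
  have hq0 : algebraMap K[X] (BaseFunctionField g) q ≠ 0 := by
    rw [algebraMap_polynomial_eq, _root_.map_ne_zero]
    exact (map_ne_zero_iff _ (IsFractionRing.injective K[X] (RatFunc K))).mpr hq.ne_zero
  have hcp : conjP p ≠ w₀ := fun h => hp (by
    rw [← hM.conjP_conjP p, h, hM.conjP_infinity])
  -- `q` has zeros only at `p` and at its conjugate
  have hother : ∀ p', p' ≠ w₀ → p' ≠ p → p' ≠ conjP p →
      val p' (algebraMap K[X] _ q) = 1 := by
    intro p' h0 h1 h2
    refine hpl.val_eq_one_of_ne hM.two ht hq hvq (hM.fam.isPlace p') (hM.val_le_one h0)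
      (fun h => h1 (hM.fam.injective h)) (fun h => h2 (hM.fam.injective ?_))
    rw [h, hM.val_conjP]
  obtain ⟨D, hD⟩ := hM.fam.exists_isDivOf hM.two hM.odd_natDegree hq0
  have hDother : ∀ p', p' ≠ w₀ → p' ≠ p → p' ≠ conjP p → D p' = 0 := by
    intro p' h0 h1 h2
    rw [hD.2, hother p' h0 h1 h2]; simp
  by_cases hc : conjP p = p
  · by_cases hroot : ∃ i ∈ T, p = w i
    · refine ⟨?_, fun _ => Or.inl hroot⟩
      obtain ⟨i, hi, hpi⟩ := hroot
      refine ⟨2, ?_⟩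
      rw [hc, ← Finsupp.single_add, hpi]
      exact (hM.isDivOf_sub hi).mem_prinDiv
    · have hs : val p (genS g) = 1 := le_antisymm (hM.val_genS_le_one hp)
        (not_lt.mp fun h => hroot (hM.eq_root_of_val_genS_lt_one h))
      have hval := hpl.val_eq_of_eq_conjVal hM.two ht hq hvq (by rw [← hM.val_conjP, hc]) hs
      have hmem : Finsupp.single p 1 - Finsupp.single w₀ (-D w₀) ∈ prinDiv val := by
        convert hD.mem_prinDiv using 1
        ext p'
        rw [Finsupp.sub_apply, Finsupp.single_apply, Finsupp.single_apply]
        by_cases h0 : p' = w₀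
        · subst h0; rw [if_neg hp, if_pos rfl]; ring
        · rw [if_neg (Ne.symm h0)]
          by_cases h1 : p' = p
          · subst h1; rw [if_pos rfl, hD.2, hval]; simp
          · rw [if_neg (Ne.symm h1), hDother p' h0 h1 (by rwa [hc])]; simp
      refine ⟨⟨2 * -D w₀, ?_⟩, fun _ => Or.inr ⟨_, hmem⟩⟩
      have := (prinDiv val).add_mem hmem hmem
      rw [hc, two_mul, Finsupp.single_add]
      convert this using 1
      abel
  · refine ⟨⟨-D w₀, ?_⟩, fun h => absurd h hc⟩
    have hne : val p ≠ conjVal (val p) := by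
      rw [← hM.val_conjP]; exact fun h => hc (hM.fam.injective h).symm
    have hval := hpl.val_eq_of_ne_conjVal hM.two ht hq hvq hne
    have hval' : val (conjP p) (algebraMap K[X] _ q) = exp (-1) := by
      rw [hM.val_conjP, algebraMap_polynomial_eq, conjVal_ratFunc, ← algebraMap_polynomial_eq, hval]
    convert hD.mem_prinDiv using 1
    ext p'
    rw [Finsupp.sub_apply, Finsupp.add_apply, Finsupp.single_apply, Finsupp.single_apply,
      Finsupp.single_apply]
    by_cases h0 : p' = w₀
    · subst h0; rw [if_neg hp, if_neg hcp, if_pos rfl]; ring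
    · rw [if_neg (Ne.symm h0)]
      by_cases h1 : p' = p
      · subst h1; rw [if_pos rfl, if_neg hc, hD.2, hval]; simp
      · rw [if_neg (Ne.symm h1)]
        by_cases h2 : p' = conjP p
        · subst h2; rw [if_pos rfl, hD.2, hval']; simp
        · rw [if_neg (Ne.symm h2), hDother p' h0 h1 h2]; simp

/-- The subgroup of divisors that are equivalent to a combination of Weierstrass points. -/
def weierstrassDiv (_ : OddModel val c T w₀ w conjP) : AddSubgroup (P →₀ ℤ) :=
  prinDiv val ⊔ AddSubgroup.closure
    (insert (Finsupp.single w₀ 1) ((fun i => Finsupp.single (w i) 1) '' (T : Set K)))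

theorem prinDiv_le : prinDiv val ≤ hM.weierstrassDiv := le_sup_left

theorem single_infinity_mem (n : ℤ) : Finsupp.single w₀ n ∈ hM.weierstrassDiv := by
  have h : Finsupp.single w₀ (1 : ℤ) ∈ hM.weierstrassDiv :=
    (le_sup_right : _ ≤ hM.weierstrassDiv) (AddSubgroup.subset_closure (Set.mem_insert _ _))
  have := hM.weierstrassDiv.zsmul_mem h n
  simpa using this

theorem single_root_mem {i : K} (hi : i ∈ T) : Finsupp.single (w i) 1 ∈ hM.weierstrassDiv :=
  (le_sup_right : _ ≤ hM.weierstrassDiv)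
    (AddSubgroup.subset_closure (Set.mem_insert_of_mem _ ⟨i, hi, rfl⟩))

/-- The action of `s ↦ -s` on divisors. -/
abbrev conjDiv (_ : OddModel val c T w₀ w conjP) : (P →₀ ℤ) →+ (P →₀ ℤ) :=
  Finsupp.mapDomain.addMonoidHom conjP

theorem conjDiv_apply (D : P →₀ ℤ) (p : P) : hM.conjDiv D p = D (conjP p) := by
  have hinj : Function.Injective conjP := (show Function.Involutive conjP from hM.conjP_conjP).injective
  have h := Finsupp.mapDomain_apply hinj D (conjP p)
  rwa [hM.conjP_conjP] at h

theorem conjDiv_conjDiv (D : P →₀ ℤ) : hM.conjDiv (hM.conjDiv D) = D := by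
  ext p
  rw [hM.conjDiv_apply, hM.conjDiv_apply, hM.conjP_conjP]

theorem isDivOf_conjDiv {D : P →₀ ℤ} {h : BaseFunctionField g} (H : IsDivOf val D h) :
    IsDivOf val (hM.conjDiv D) (conj g h) :=
  ⟨(map_ne_zero_iff _ (conj g).injective).mpr H.1, fun p => by
    rw [hM.conjDiv_apply, H.2, hM.val_conjP]; rfl⟩

/-- Divisors invariant under `s ↦ -s` are equivalent to combinations of Weierstrass points. -/
theorem mem_weierstrassDiv_of_conjDiv_eq {D : P →₀ ℤ} (hD : hM.conjDiv D = D) :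
    D ∈ hM.weierstrassDiv := by
  classical
  induction hn : D.support.card using Nat.strong_induction_on generalizing D with
  | _ n ih =>
    have hDc : ∀ p, D (conjP p) = D p := fun p => by rw [← hM.conjDiv_apply, hD]
    by_cases h0 : D = 0
    · rw [h0]; exact zero_mem _
    obtain ⟨p, hp⟩ := Finsupp.support_nonempty_iff.mpr h0
    -- subtract the part of `D` supported on the orbit of `p`
    have step : ∀ E ∈ hM.weierstrassDiv, hM.conjDiv E = E → (∀ p', D p' = 0 → E p' = 0) →
        E p = D p → D ∈ hM.weierstrassDiv := by
      intro E hE hEc hsupp hEp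
      have h1 : D - E ∈ hM.weierstrassDiv := by
        refine ih _ ?_ (D := D - E) (by rw [map_sub, hD, hEc]) rfl
        rw [← hn]
        refine Finset.card_lt_card ⟨fun p' hp' => ?_, fun hsub => ?_⟩
        · rw [Finsupp.mem_support_iff, Finsupp.sub_apply] at hp'
          rw [Finsupp.mem_support_iff]
          intro h
          exact hp' (by rw [h, hsupp p' h, sub_zero])
        · have := hsub hp
          rw [Finsupp.mem_support_iff, Finsupp.sub_apply, hEp, sub_self] at this
          exact this rfl
      simpa using add_mem h1 hE
    by_cases hpw : p = w₀
    · subst hpw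
      refine step (Finsupp.single p (D p)) (hM.single_infinity_mem _) ?_ ?_ (by simp)
      · simp [hM.conjP_infinity]
      · intro p' hp'
        rw [Finsupp.single_apply]
        split_ifs with h
        · rwa [h]
        · rfl
    obtain ⟨⟨m, hm⟩, hfix⟩ := hM.exists_add_conjP_mem hpw
    by_cases hc : conjP p = p
    · have hmem : Finsupp.single p (1 : ℤ) ∈ hM.weierstrassDiv := by
        rcases hfix hc with ⟨i, hi, rfl⟩ | ⟨n', hn'⟩
        · exact hM.single_root_mem hi
        · have := add_mem (hM.prinDiv_le hn') (hM.single_infinity_mem n')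
          simpa using this
      refine step (Finsupp.single p (D p)) ?_ ?_ ?_ (by simp)
      · have := hM.weierstrassDiv.zsmul_mem hmem (D p)
        simpa using this
      · simp [hc]
      · intro p' hp'
        rw [Finsupp.single_apply]
        split_ifs with h
        · rwa [h]
        · rfl
    · have hmem : Finsupp.single p (1 : ℤ) + Finsupp.single (conjP p) 1 ∈ hM.weierstrassDiv := by
        have := add_mem (hM.prinDiv_le hm) (hM.single_infinity_mem m)
        simpa using this
      refine step (Finsupp.single p (D p) + Finsupp.single (conjP p) (D p)) ?_ ?_ ?_ ?_
      · have := hM.weierstrassDiv.zsmul_mem hmem (D p)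
        simpa using this
      · rw [map_add, Finsupp.mapDomain.addMonoidHom_apply, Finsupp.mapDomain.addMonoidHom_apply,
          Finsupp.mapDomain_single, Finsupp.mapDomain_single, hM.conjP_conjP, add_comm]
      · intro p' hp'
        rw [Finsupp.add_apply, Finsupp.single_apply, Finsupp.single_apply]
        have h1 : p = p' → D p = 0 := fun h => by rwa [h]
        have h2 : conjP p = p' → D p = 0 := fun h => by rwa [← hDc, h]
        split_ifs with h h' h'
        · rw [h1 h]; rfl
        · rw [h1 h]; rfl
        · rw [h2 h']; rfl
        · rfl
      · rw [Finsupp.add_apply, Finsupp.single_eq_same, Finsupp.single_eq_of_ne (Ne.symm hc), add_zero]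

/-- The sum of a divisor and its conjugate is equivalent to a multiple of the place at infinity. -/
theorem exists_add_conjDiv_mem (D : P →₀ ℤ) :
    ∃ n : ℤ, D + hM.conjDiv D - Finsupp.single w₀ n ∈ prinDiv val := by
  induction D using Finsupp.induction_linear with
  | zero => exact ⟨0, by simp [zero_mem]⟩
  | add D E hD hE =>
    obtain ⟨m, hm⟩ := hD
    obtain ⟨n, hn⟩ := hE
    refine ⟨m + n, ?_⟩
    convert add_mem hm hn using 1
    rw [map_add, Finsupp.single_add]
    abel
  | single p a =>
    by_cases hp : p = w₀
    · subst hp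
      refine ⟨2 * a, ?_⟩
      simp [hM.conjP_infinity, two_mul, zero_mem]
    · obtain ⟨⟨m, hm⟩, -⟩ := hM.exists_add_conjP_mem hp
      refine ⟨a * m, ?_⟩
      have := (prinDiv val).zsmul_mem hm a
      simpa [zsmul_sub, zsmul_add] using this

/-- A divisor whose double is principal is equivalent to a combination of Weierstrass points: as its
class is fixed by `s ↦ -s`, Hilbert 90 makes the divisor itself invariant after subtracting a
principal divisor. -/
theorem mem_weierstrassDiv_of_two_nsmul_mem {D : P →₀ ℤ} (hD : 2 • D ∈ prinDiv val) :
    D ∈ hM.weierstrassDiv := by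
  obtain ⟨n, hn⟩ := hM.exists_add_conjDiv_mem D
  have h1 : D - hM.conjDiv D + Finsupp.single w₀ n ∈ prinDiv val := by
    convert sub_mem hD hn using 1
    rw [two_nsmul]; abel
  have h2 : hM.conjDiv D - D + Finsupp.single w₀ n ∈ prinDiv val := by
    obtain ⟨h, H⟩ := h1
    convert (hM.isDivOf_conjDiv H).mem_prinDiv using 1
    rw [map_add, map_sub, hM.conjDiv_conjDiv]
    simp [hM.conjP_infinity]
  have hn0 : n = 0 := by
    have := hM.eq_zero_of_single_mem (n := n + n) (by
      convert add_mem h1 h2 using 1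
      rw [Finsupp.single_add]; abel)
    omega
  rw [hn0, Finsupp.single_zero, add_zero] at h1
  obtain ⟨h, H⟩ := h1
  -- the norm of `h` has trivial divisor, hence is a constant, which may be taken to be `1`
  have hN := H.mul (hM.isDivOf_conjDiv H)
  rw [map_sub, hM.conjDiv_conjDiv, sub_add_sub_cancel, sub_self, ← Finsupp.single_zero w₀] at hN
  obtain ⟨d, hd, hdh⟩ := hM.exists_const hN
  obtain ⟨e, rfl⟩ := hM.sqrt d
  have he : e ≠ 0 := by rintro rfl; simp at hd
  have he' : algebraMap K (BaseFunctionField g) e ≠ 0 := (_root_.map_ne_zero _).mpr he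
  have hce : conj g (algebraMap K _ e) = algebraMap K _ e := by
    rw [IsScalarTower.algebraMap_apply K (RatFunc K), AlgEquiv.commutes]
  set h' := h / algebraMap K _ e with hh'
  have hN' : h' * conj g h' = 1 := by
    rw [hh', map_div₀, hce, div_mul_div_comm, hdh, map_pow, ← sq, div_self (pow_ne_zero 2 he')]
  have H' : IsDivOf val (D - hM.conjDiv D) h' := by
    have := H.div (hM.isDivOf_const he)
    rwa [sub_zero] at this
  -- Hilbert 90 for the quadratic extension: `u = 1 + h'`, or `u = s` if this vanishes
  obtain ⟨u, hu0, hu⟩ : ∃ u : BaseFunctionField g, u ≠ 0 ∧ h' * conj g u = u := by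
    by_cases h1 : 1 + h' = 0
    · refine ⟨genS g, genS_ne_zero, ?_⟩
      rw [conj_genS]
      linear_combination -(genS g) * h1
    · exact ⟨1 + h', h1, by rw [map_add, map_one]; linear_combination hN'⟩
  obtain ⟨E, hE⟩ := hM.fam.exists_isDivOf hM.two hM.odd_natDegree hu0
  have hinv : hM.conjDiv (D - E) = D - E := by
    have h3 := H'.mul (hM.isDivOf_conjDiv hE)
    rw [hu] at h3
    have h4 : D - hM.conjDiv D + hM.conjDiv E = E := by
      ext p; rw [h3.2, hE.2]
    rw [map_sub]
    conv_rhs => rw [← h4]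
    abel
  have := add_mem (hM.mem_weierstrassDiv_of_conjDiv_eq hinv) (hM.prinDiv_le ⟨u, hE⟩)
  simpa using this

theorem two_nsmul_single_sub_mem {i : K} (hi : i ∈ T) :
    (2 : ℤ) • (Finsupp.single (w i) (1 : ℤ) - Finsupp.single w₀ 1) ∈ prinDiv val := by
  have := (hM.isDivOf_sub hi).mem_prinDiv
  simpa [smul_sub] using this

/-- Combinations of Weierstrass points, in terms of the differences `(w i) - (w₀)`. -/
theorem exists_sum_smul_sub_mem {E : P →₀ ℤ} (hE : E ∈ hM.weierstrassDiv) :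
    ∃ (a : K → ℤ) (n : ℤ),
      E - ∑ i ∈ T, a i • (Finsupp.single (w i) (1 : ℤ) - Finsupp.single w₀ 1) -
        Finsupp.single w₀ n ∈ prinDiv val := by
  classical
  obtain ⟨E₁, hE₁, E₂, hE₂, rfl⟩ := AddSubgroup.mem_sup.mp hE
  clear hE
  suffices h : ∃ (a : K → ℤ) (n : ℤ),
      E₂ - ∑ i ∈ T, a i • (Finsupp.single (w i) (1 : ℤ) - Finsupp.single w₀ 1) -
        Finsupp.single w₀ n ∈ prinDiv val by
    obtain ⟨a, n, h⟩ := h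
    refine ⟨a, n, ?_⟩
    convert add_mem hE₁ h using 1
    abel
  induction hE₂ using AddSubgroup.closure_induction with
  | mem x hx =>
    rcases hx with rfl | ⟨i, hi, rfl⟩
    · exact ⟨0, 1, by simp [zero_mem]⟩
    · refine ⟨Pi.single i 1, 1, ?_⟩
      rw [Finset.sum_eq_single_of_mem i hi fun j _ hj => by rw [Pi.single_eq_of_ne hj, zero_smul]]
      simp [zero_mem]
  | zero => exact ⟨0, 0, by simp [zero_mem]⟩
  | add x y _ _ hx hy =>
    obtain ⟨a, m, ha⟩ := hx
    obtain ⟨b, n, hb⟩ := hy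
    refine ⟨a + b, m + n, ?_⟩
    convert add_mem ha hb using 1
    simp only [Pi.add_apply, add_smul, Finset.sum_add_distrib, Finsupp.single_add]
    abel
  | neg x _ hx =>
    obtain ⟨a, m, ha⟩ := hx
    refine ⟨-a, -m, ?_⟩
    convert neg_mem ha using 1
    simp only [Pi.neg_apply, neg_smul, Finset.sum_neg_distrib, Finsupp.single_neg]
    abel

/-- Every divisor class of order two is represented by a sum of distinct Weierstrass points. -/
theorem exists_sum_sub_mem {D : P →₀ ℤ} (hD : 2 • D ∈ prinDiv val) :
    ∃ S ⊆ T, D - ∑ i ∈ S, (Finsupp.single (w i) 1 - Finsupp.single w₀ 1) ∈ prinDiv val := by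
  classical
  obtain ⟨a, n, hn⟩ := hM.exists_sum_smul_sub_mem (hM.mem_weierstrassDiv_of_two_nsmul_mem hD)
  set x : K → P →₀ ℤ := fun i => Finsupp.single (w i) 1 - Finsupp.single w₀ 1 with hx
  have h2 : 2 • ∑ i ∈ T, a i • x i ∈ prinDiv val := by
    rw [Finset.smul_sum]
    refine sum_mem fun i hi => ?_
    rw [← natCast_zsmul, smul_comm]
    exact zsmul_mem (hM.two_nsmul_single_sub_mem hi) _
  -- the multiple of the place at infinity vanishes, as twice the class of `D` is zero
  have hn0 : n = 0 := by
    have h3 : Finsupp.single w₀ (2 * n) ∈ prinDiv val := by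
      convert sub_mem (sub_mem hD h2) ((prinDiv val).nsmul_mem hn 2) using 1
      rw [two_mul, Finsupp.single_add]
      simp only [two_nsmul]
      abel
    have := hM.eq_zero_of_single_mem h3
    omega
  rw [hn0, Finsupp.single_zero, sub_zero] at hn
  refine ⟨T.filter fun i => Odd (a i), Finset.filter_subset _ _, ?_⟩
  have h4 : ∑ i ∈ T, a i • x i - ∑ i ∈ T with Odd (a i), x i ∈ prinDiv val := by
    rw [Finset.sum_filter, ← Finset.sum_sub_distrib]
    refine sum_mem fun i hi => ?_
    have h2i := hM.two_nsmul_single_sub_mem hi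
    split_ifs with h
    · obtain ⟨m, hm⟩ := h
      rw [hm, add_smul, one_smul, add_sub_cancel_right, mul_comm, mul_smul]
      exact zsmul_mem h2i m
    · obtain ⟨m, hm⟩ := Int.not_odd_iff_even.mp h
      rw [hm, sub_zero, ← two_mul, mul_comm, mul_smul]
      exact zsmul_mem h2i m
  convert add_mem hn h4 using 1
  abel

end OddModel
end ModelTwoTorsion

/-! ### Moving a Weierstrass point to infinity -/

section OddDegreeModel

theorem irreducible_quadRel_of_odd {K : Type*} [Field K] {g : K[X]} (h : Odd g.natDegree) :
    Irreducible (quadRel g) := by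
  refine X_pow_sub_C_irreducible_of_prime Nat.prime_two fun b hb => ?_
  have hg : g ≠ 0 := by rintro rfl; simp at h
  have hb0 : b ≠ 0 := by
    rintro rfl
    rw [zero_pow two_ne_zero] at hb
    exact (map_ne_zero_iff _ (IsFractionRing.injective K[X] (RatFunc K))).mpr hg hb.symm
  have h1 := congrArg RatFunc.intDegree hb
  rw [sq, RatFunc.intDegree_mul hb0 hb0, RatFunc.intDegree_polynomial] at h1
  obtain ⟨j, hj⟩ := h
  omega

variable {k : Type*} [Field k] {f : k[X]} {K : Type*} [Field K] [Algebra k K]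

/-- The roots of the odd degree model: the points `1 / (ω - ω₀)` for the other roots `ω`. -/
def oddRoots (Ω : Finset K) (ω₀ : K) : Finset K :=
  open Classical in (Ω.erase ω₀).image fun ω => (ω - ω₀)⁻¹

/-- The leading coefficient of the odd degree model. -/
def oddLead (a : K) (Ω : Finset K) (ω₀ : K) : K :=
  open Classical in a * ∏ ω ∈ Ω.erase ω₀, (ω₀ - ω)

/-- The polynomial `t ^ 6 f(ω₀ + 1 / t)`, for `f = a ∏ (x - ω)` of degree six. -/
def oddPoly (a : K) (Ω : Finset K) (ω₀ : K) : K[X] :=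
  C (oddLead a Ω ω₀) * ∏ i ∈ oddRoots Ω ω₀, (X - C i)

/-- The factorization of `f` over `K`, with a choice of a root `ω₀`. -/
structure SplitSextic (f : k[X]) (a : K) (Ω : Finset K) (ω₀ : K) : Prop where
  map_eq : f.map (algebraMap k K) = C a * ∏ ω ∈ Ω, (X - C ω)
  card : Ω.card = 6
  ne_zero : a ≠ 0
  mem : ω₀ ∈ Ω

namespace SplitSextic

variable {a : K} {Ω : Finset K} {ω₀ : K} (hf : SplitSextic f a Ω ω₀)
include hf

theorem card_oddRoots : (oddRoots Ω ω₀).card = 5 := by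
  classical
  unfold oddRoots
  rw [Finset.card_image_of_injective _ fun x y h => by simpa using h]
  have := Finset.card_erase_of_mem hf.mem
  rw [hf.card] at this
  convert this

theorem oddLead_ne_zero : oddLead a Ω ω₀ ≠ 0 := by
  classical
  refine mul_ne_zero hf.ne_zero (Finset.prod_ne_zero_iff.mpr fun ω hω => ?_)
  exact sub_ne_zero.mpr (Finset.ne_of_mem_erase hω).symm

theorem odd_natDegree : Odd (oddPoly a Ω ω₀).natDegree := by
  rw [oddPoly, natDegree_C_mul hf.oddLead_ne_zero, natDegree_prod_of_monic _ _ fun i _ => monic_X_sub_C i]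
  simp only [natDegree_X_sub_C, Finset.sum_const, hf.card_oddRoots]
  decide

theorem fact_irreducible : Fact (Irreducible (quadRel (oddPoly a Ω ω₀))) :=
  ⟨irreducible_quadRel_of_odd hf.odd_natDegree⟩

/-- `t ^ 6 f(ω₀ + u) = g(t)` whenever `t u = 1`. -/
theorem aeval_mul_pow_six {B : Type*} [CommRing B] [Algebra K B] [Algebra k B] [IsScalarTower k K B]
    {t u : B} (htu : t * u = 1) :
    aeval (algebraMap K B ω₀ + u) f * t ^ 6 = aeval t (oddPoly a Ω ω₀) := by
  classical
  have h1 : aeval (algebraMap K B ω₀ + u) f = algebraMap K B a *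
      ∏ ω ∈ Ω, (algebraMap K B ω₀ + u - algebraMap K B ω) := by
    rw [← aeval_map_algebraMap K, hf.map_eq, map_mul, map_prod, aeval_C]
    simp
  have h2 : ∀ ω ∈ Ω.erase ω₀, (algebraMap K B ω₀ + u - algebraMap K B ω) * t =
      algebraMap K B (ω₀ - ω) * (t - algebraMap K B (ω - ω₀)⁻¹) := by
    intro ω hω
    have h3 : algebraMap K B (ω₀ - ω) * algebraMap K B (ω - ω₀)⁻¹ = -1 := by
      rw [← map_mul, ← neg_sub, neg_mul, mul_inv_cancel₀
        (sub_ne_zero.mpr (Finset.ne_of_mem_erase hω)), map_neg, map_one]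
    rw [mul_sub, h3, map_sub]
    linear_combination htu
  have h3 : ∏ ω ∈ Ω, ((algebraMap K B ω₀ + u - algebraMap K B ω) * t) =
      ∏ ω ∈ Ω.erase ω₀, algebraMap K B (ω₀ - ω) * (t - algebraMap K B (ω - ω₀)⁻¹) := by
    rw [← Finset.mul_prod_erase _ _ hf.mem, Finset.prod_congr rfl h2, add_sub_cancel_left, mul_comm u,
      htu, one_mul]
  rw [Finset.prod_mul_distrib, Finset.prod_const, hf.card, Finset.prod_mul_distrib] at h3
  rw [h1, mul_assoc, h3, oddPoly, oddLead, oddRoots, Finset.prod_image fun x _ y _ h => by simpa using h]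
  simp only [map_mul, map_prod, aeval_C, map_sub, aeval_X]
  rw [mul_assoc]

end SplitSextic

/-- The abscissa `ω₀ + 1 / t`. -/
def oddX (ω₀ : K) : RatFunc K := algebraMap K _ ω₀ + RatFunc.X⁻¹

theorem transcendental_oddX (ω₀ : K) : Transcendental K (oddX ω₀) := by
  intro h
  have h1 : IsAlgebraic K (oddX ω₀ - algebraMap K _ ω₀) := h.sub (isAlgebraic_algebraMap ω₀)
  rw [oddX, add_sub_cancel_left] at h1
  exact RatFunc.transcendental_X (inv_inv (RatFunc.X (K := K)) ▸ h1.inv)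

variable (k) in
/-- The embedding of `k(x)` into `K(t)` that sends `x` to `ω₀ + 1 / t`. -/
def oddRat (ω₀ : K) : RatFunc k →ₐ[k] RatFunc K :=
  IsLocalization.liftAlgHom (M := nonZeroDivisors k[X]) (f := aeval (oddX ω₀)) fun p => by
    refine IsUnit.mk0 _ fun h => ?_
    have ht : Transcendental k (oddX ω₀) :=
      (transcendental_oddX ω₀).restrictScalars (algebraMap k K).injective
    exact nonZeroDivisors.coe_ne_zero p (transcendental_iff.mp ht _ h)

theorem oddRat_algebraMap (ω₀ : K) (p : k[X]) :
    oddRat k ω₀ (algebraMap k[X] (RatFunc k) p) = aeval (oddX ω₀) p := by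
  unfold oddRat
  rw [IsLocalization.coe_liftAlgHom, IsLocalization.lift_eq]
  rfl

/-- Two algebra homomorphisms on a field of rational functions agree if they agree on the
variable. -/
theorem ratFunc_algHom_ext {F B : Type*} [Field F] [CommRing B] [Algebra F B]
    {φ ψ : RatFunc F →ₐ[F] B} (h : φ RatFunc.X = ψ RatFunc.X) : φ = ψ := by
  refine IsLocalization.algHom_ext (nonZeroDivisors F[X]) ?_
  refine Polynomial.algHom_ext ?_
  change φ (algebraMap F[X] (RatFunc F) X) = ψ (algebraMap F[X] (RatFunc F) X)
  rwa [RatFunc.algebraMap_X]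

theorem coordX_eq_aeval (p : k[X]) : aeval (coordX f K) p =
    1 ⊗ₜ AdjoinRoot.of _ (algebraMap k[X] (RatFunc k) p) := by
  have : (aeval (coordX f K) : k[X] →ₐ[k] _) =
      ((Algebra.TensorProduct.includeRight : BaseFunctionField f →ₐ[k] CurveFunctionField f K).comp
        (AdjoinRoot.ofAlgHom k (quadRel f))).comp (Algebra.algHom k k[X] (RatFunc k)) := by
    refine Polynomial.algHom_ext ?_
    simp [coordX, Algebra.algHom]
  exact DFunLike.congr_fun this p

theorem coordY_sq : coordY f K ^ 2 = aeval (coordX f K) f := by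
  rw [coordX_eq_aeval, coordY, Algebra.TensorProduct.tmul_pow, one_pow]
  exact congrArg _ (genS_sq f)

/-- A nonzero polynomial over `K` is invertible in the function field `K ⊗ k(C)`. -/
theorem isUnit_aeval_coordX [Algebra.IsAlgebraic k K] {p : K[X]} (hp : p ≠ 0) :
    IsUnit (aeval (coordX f K) p) := by
  let : Algebra k[X] K[X] := Polynomial.algebra k K
  obtain ⟨q, hq0, hq⟩ : ∃ q : k[X], q ≠ 0 ∧ p ∣ q.map (algebraMap k K) := by
    have := Ideal.comap_ne_bot_of_integral_mem (R := k[X]) hp (Ideal.mem_span_singleton_self p)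
      (Algebra.IsIntegral.isIntegral p)
    obtain ⟨q, hq, hq0⟩ := Submodule.exists_mem_ne_zero_of_ne_bot this
    exact ⟨q, hq0, Ideal.mem_span_singleton.mp hq⟩
  refine isUnit_of_dvd_unit (map_dvd (aeval (coordX f K)) hq) ?_
  rw [aeval_map_algebraMap, coordX_eq_aeval]
  have hu : IsUnit (algebraMap k[X] (RatFunc k) q) := by
    rw [isUnit_iff_ne_zero]
    exact (map_ne_zero_iff _ (IsFractionRing.injective k[X] (RatFunc k))).mpr hq0
  exact (hu.map (AdjoinRoot.of (quadRel f))).map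
    (Algebra.TensorProduct.includeRight : BaseFunctionField f →ₐ[k] CurveFunctionField f K)

/-- `x - ω₀` as a unit of the function field. -/
def unitSub (f : k[X]) [Algebra.IsAlgebraic k K] (ω₀ : K) : (CurveFunctionField f K)ˣ :=
  (isUnit_aeval_coordX (f := f) (X_sub_C_ne_zero ω₀)).unit

theorem unitSub_val [Algebra.IsAlgebraic k K] (ω₀ : K) :
    (unitSub f ω₀ : CurveFunctionField f K) = coordX f K - algebraMap K _ ω₀ := by
  change aeval (coordX f K) (X - C ω₀) = _
  simp

variable (f) in
/-- The embedding of `K(t)` into `K ⊗ k(C)` that sends `t` to `1 / (x - ω₀)`. -/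
def oddRatInv [Algebra.IsAlgebraic k K] (ω₀ : K) : RatFunc K →ₐ[K] CurveFunctionField f K :=
  IsLocalization.liftAlgHom (M := nonZeroDivisors K[X])
    (f := aeval ((unitSub f ω₀)⁻¹ : (CurveFunctionField f K)ˣ).val) fun p => by
    let := (unitSub f ω₀)⁻¹.invertible
    have h1 := eval₂_reverse_mul_pow (algebraMap K (CurveFunctionField f K))
      ((unitSub f ω₀)⁻¹ : (CurveFunctionField f K)ˣ).val (p : K[X])
    change IsUnit (eval₂ (algebraMap K (CurveFunctionField f K)) _ (p : K[X]))
    rw [← h1]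
    refine IsUnit.mul ?_ ((Units.isUnit _).pow _)
    have h3 : ⅟(((unitSub f ω₀)⁻¹ : (CurveFunctionField f K)ˣ).val) =
        aeval (coordX f K) (X - C ω₀) := rfl
    rw [h3]
    change IsUnit (aeval (aeval (coordX f K) (X - C ω₀)) (reverse (p : K[X])))
    rw [← aeval_comp]
    refine isUnit_aeval_coordX ?_
    intro h0
    rw [comp_eq_zero_iff] at h0
    rcases h0 with h0 | ⟨-, h0⟩
    · rw [reverse_eq_zero] at h0
      exact nonZeroDivisors.coe_ne_zero p h0
    · have := congrArg natDegree h0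
      rw [natDegree_X_sub_C, natDegree_C] at this
      omega

theorem oddRatInv_algebraMap [Algebra.IsAlgebraic k K] (ω₀ : K) (p : K[X]) :
    oddRatInv f ω₀ (algebraMap K[X] (RatFunc K) p) =
      aeval ((unitSub f ω₀)⁻¹ : (CurveFunctionField f K)ˣ).val p := by
  unfold oddRatInv
  rw [IsLocalization.coe_liftAlgHom, IsLocalization.lift_eq]
  rfl

theorem oddRatInv_X [Algebra.IsAlgebraic k K] (ω₀ : K) :
    oddRatInv f ω₀ RatFunc.X = ((unitSub f ω₀)⁻¹ : (CurveFunctionField f K)ˣ).val := by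
  rw [← RatFunc.algebraMap_X, oddRatInv_algebraMap, aeval_X]

namespace SplitSextic

variable {a : K} {Ω : Finset K} {ω₀ : K}

/-- The map `K ⊗ k(C) → K(t, s)` with `x ↦ ω₀ + 1 / t` and `y ↦ s / t ^ 3`. -/
def toOdd (hf : SplitSextic f a Ω ω₀) :
    CurveFunctionField f K →ₐ[K] BaseFunctionField (oddPoly a Ω ω₀) :=
  Algebra.TensorProduct.lift (Algebra.ofId K _)
    (AdjoinRoot.liftAlgHom (quadRel f)
      ((Algebra.algHom k (RatFunc K) (BaseFunctionField (oddPoly a Ω ω₀))).comp (oddRat k ω₀))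
      (genS (oddPoly a Ω ω₀) * algebraMap (RatFunc K) _ (RatFunc.X⁻¹ ^ 3)) (by
        simp only [quadRel, eval₂_sub, eval₂_pow, eval₂_X, eval₂_C, sub_eq_zero]
        have h1 := hf.aeval_mul_pow_six (t := (RatFunc.X : RatFunc K)) (u := RatFunc.X⁻¹)
          (mul_inv_cancel₀ RatFunc.X_ne_zero)
        have h3 : oddRat k ω₀ (algebraMap k[X] (RatFunc k) f) =
            algebraMap K[X] (RatFunc K) (oddPoly a Ω ω₀) * (RatFunc.X⁻¹ ^ 3) ^ 2 := by
          rw [oddRat_algebraMap, oddX, ← pow_mul, inv_pow, eq_mul_inv_iff_mul_eq₀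
            (pow_ne_zero _ RatFunc.X_ne_zero), h1, ← RatFunc.algebraMap_X, aeval_algebraMap_apply,
            aeval_X_left_apply]
        change _ = algebraMap (RatFunc K) _ (oddRat k ω₀ _)
        rw [h3, mul_pow, genS_sq, map_mul, map_pow _ _ 2]))
    (fun _ _ => Commute.all _ _)

theorem toOdd_coordX (hf : SplitSextic f a Ω ω₀) :
    hf.toOdd (coordX f K) = algebraMap (RatFunc K) _ (oddX ω₀) := by
  rw [toOdd, coordX, Algebra.TensorProduct.lift_tmul, map_one, one_mul, AdjoinRoot.liftAlgHom_of]
  change algebraMap (RatFunc K) _ (oddRat k ω₀ _) = _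
  rw [← RatFunc.algebraMap_X, oddRat_algebraMap, aeval_X]

theorem toOdd_coordY (hf : SplitSextic f a Ω ω₀) :
    hf.toOdd (coordY f K) = genS (oddPoly a Ω ω₀) * algebraMap (RatFunc K) _ (RatFunc.X⁻¹ ^ 3) := by
  rw [toOdd, coordY, Algebra.TensorProduct.lift_tmul, map_one, one_mul, AdjoinRoot.liftAlgHom_root]

variable [Algebra.IsAlgebraic k K]

/-- The map `K(t, s) → K ⊗ k(C)` with `t ↦ 1 / (x - ω₀)` and `s ↦ y / (x - ω₀) ^ 3`. -/
def ofOdd (hf : SplitSextic f a Ω ω₀) :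
    BaseFunctionField (oddPoly a Ω ω₀) →ₐ[K] CurveFunctionField f K :=
  AdjoinRoot.liftAlgHom (quadRel (oddPoly a Ω ω₀)) (oddRatInv f ω₀)
    (coordY f K * ((unitSub f ω₀)⁻¹ : (CurveFunctionField f K)ˣ).val ^ 3) (by
      simp only [quadRel, eval₂_sub, eval₂_pow, eval₂_X, eval₂_C, sub_eq_zero]
      change _ = oddRatInv f ω₀ _
      rw [oddRatInv_algebraMap, ← hf.aeval_mul_pow_six (Units.inv_mul (unitSub f ω₀)), mul_pow,
        coordY_sq, ← pow_mul, unitSub_val, add_sub_cancel])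

theorem ofOdd_algebraMap (hf : SplitSextic f a Ω ω₀) (r : RatFunc K) :
    hf.ofOdd (algebraMap (RatFunc K) _ r) = oddRatInv f ω₀ r :=
  AdjoinRoot.liftAlgHom_of _ _ _ _ _

theorem ofOdd_genS (hf : SplitSextic f a Ω ω₀) : hf.ofOdd (genS _) =
    coordY f K * ((unitSub f ω₀)⁻¹ : (CurveFunctionField f K)ˣ).val ^ 3 :=
  AdjoinRoot.liftAlgHom_root _ _ _ _

theorem ofOdd_oddX (hf : SplitSextic f a Ω ω₀) :
    hf.ofOdd (algebraMap (RatFunc K) _ (oddX ω₀)) = coordX f K := by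
  have h : oddRatInv f ω₀ (RatFunc.X⁻¹) = (unitSub f ω₀ : CurveFunctionField f K) := by
    have h1 : oddRatInv f ω₀ (RatFunc.X⁻¹) * oddRatInv f ω₀ RatFunc.X = 1 := by
      rw [← map_mul, inv_mul_cancel₀ RatFunc.X_ne_zero, map_one]
    rw [oddRatInv_X] at h1
    exact (Units.mul_inv_eq_one.mp h1)
  rw [ofOdd_algebraMap, oddX, map_add, AlgHom.commutes, h, unitSub_val, add_sub_cancel]

/-- The function field of `y² = f(x)` over `K` is that of the odd degree model. -/
def equivOdd (hf : SplitSextic f a Ω ω₀) :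
    CurveFunctionField f K ≃ₐ[K] BaseFunctionField (oddPoly a Ω ω₀) :=
  have hX : hf.toOdd ((unitSub f ω₀)⁻¹ : (CurveFunctionField f K)ˣ).val =
      algebraMap (RatFunc K) _ RatFunc.X := by
    have h1 : hf.toOdd (unitSub f ω₀ : CurveFunctionField f K) =
        algebraMap (RatFunc K) _ RatFunc.X⁻¹ := by
      rw [unitSub_val, map_sub, toOdd_coordX, AlgHom.commutes,
        IsScalarTower.algebraMap_apply K (RatFunc K), ← map_sub, oddX, add_sub_cancel_left]
    have h2 : hf.toOdd ((unitSub f ω₀)⁻¹ : (CurveFunctionField f K)ˣ).val *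
        hf.toOdd (unitSub f ω₀ : CurveFunctionField f K) = 1 := by
      rw [← map_mul, Units.inv_mul, map_one]
    have h3 : algebraMap (RatFunc K) (BaseFunctionField (oddPoly a Ω ω₀)) RatFunc.X⁻¹ *
        algebraMap (RatFunc K) _ RatFunc.X = 1 := by
      rw [← map_mul, inv_mul_cancel₀ RatFunc.X_ne_zero, map_one]
    rw [h1] at h2
    exact left_inv_eq_right_inv h2 h3
  AlgEquiv.ofAlgHom hf.toOdd hf.ofOdd
    (by
      refine AdjoinRoot.algHom_ext' ?_ ?_
      · refine ratFunc_algHom_ext ?_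
        change hf.toOdd (hf.ofOdd (algebraMap (RatFunc K) _ RatFunc.X)) =
          algebraMap (RatFunc K) _ RatFunc.X
        rw [ofOdd_algebraMap, oddRatInv_X, hX]
      · change hf.toOdd (hf.ofOdd (genS _)) = genS _
        rw [ofOdd_genS, map_mul, map_pow, hX, toOdd_coordY, ← map_pow, mul_assoc, ← map_mul,
          inv_pow, inv_mul_cancel₀ (pow_ne_zero 3 RatFunc.X_ne_zero), map_one, mul_one])
    (by
      refine Algebra.TensorProduct.ext (Subsingleton.elim _ _) ?_
      refine AdjoinRoot.algHom_ext' ?_ ?_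
      · refine ratFunc_algHom_ext ?_
        change hf.ofOdd (hf.toOdd (coordX f K)) = coordX f K
        rw [toOdd_coordX, ofOdd_oddX]
      · change hf.ofOdd (hf.toOdd (coordY f K)) = coordY f K
        rw [toOdd_coordY, map_mul, ofOdd_genS, ofOdd_algebraMap, mul_assoc, ← oddRatInv_X,
          ← map_pow, ← map_mul, inv_pow, mul_inv_cancel₀ (pow_ne_zero 3 RatFunc.X_ne_zero), map_one,
          mul_one])

end SplitSextic
end OddDegreeModel

/-! ### The Weierstrass points of `y² = f(x)` and the 2-torsion of its Picard group -/

section Weierstrass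

variable {k : Type*} [Field k] {f : k[X]} {K : Type*} [Field K] [Algebra k K]

/-- A separable polynomial of degree six splits into distinct linear factors over a separable
closure. -/
theorem splitSextic [IsSepClosure k K] (hdeg : f.natDegree = 6) (hsep : f.Separable)
    (ω₀ : f.rootSet K) :
    SplitSextic f (algebraMap k K f.leadingCoeff) (f.rootSet K).toFinset (ω₀ : K) := by
  classical
  have := IsSepClosure.sep_closed k (K := K)
  have hf0 : f ≠ 0 := hsep.ne_zero
  have hs : (f.map (algebraMap k K)).Splits := IsSepClosed.splits_codomain f hsep
  have hnd : (f.map (algebraMap k K)).roots.Nodup := nodup_roots hsep.map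
  have hΩ : (f.rootSet K).toFinset.val = (f.map (algebraMap k K)).roots := by
    have h : (f.rootSet K).toFinset = (f.map (algebraMap k K)).roots.toFinset := by
      ext x
      rw [Set.mem_toFinset, rootSet_def]
      rfl
    rw [h, Multiset.toFinset_val, Multiset.dedup_eq_self.mpr hnd]
  refine ⟨?_, ?_, ?_, by simp [ω₀.2]⟩
  · conv_lhs => rw [hs.eq_prod_roots]
    rw [leadingCoeff_map, ← hΩ]
    rfl
  · rw [Finset.card, hΩ, ← hs.natDegree_eq_card_roots, natDegree_map, hdeg]
  · simpa using hf0

theorem exists_sq_eq [IsSepClosure k K] (h2 : (2 : k) ≠ 0) (d : K) : ∃ e : K, e ^ 2 = d := by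
  have := IsSepClosure.sep_closed k (K := K)
  have h2' : (2 : K) ≠ 0 := by
    have := (_root_.map_ne_zero (algebraMap k K)).mpr h2
    rwa [map_ofNat] at this
  have : NeZero ((2 : ℕ) : K) := ⟨by exact_mod_cast h2'⟩
  exact IsSepClosed.exists_pow_nat_eq d 2

namespace Place

theorem val_const (p : Place f K) {c : K} (hc : c ≠ 0) :
    p.val (algebraMap K (CurveFunctionField f K) c) = 1 := p.trivial_on_constants c hc

theorem val_ne_zero (p : Place f K) (u : (CurveFunctionField f K)ˣ) :
    p.val (u : CurveFunctionField f K) ≠ 0 := (u.isUnit.map p.val).ne_zero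

theorem val_inv (p : Place f K) (u : (CurveFunctionField f K)ˣ) :
    p.val ((u⁻¹ : (CurveFunctionField f K)ˣ) : CurveFunctionField f K) =
      (p.val (u : CurveFunctionField f K))⁻¹ := by
  refine eq_inv_of_mul_eq_one_left ?_
  rw [← map_mul, Units.inv_mul, map_one]

variable (f) in
theorem sub_eq_sub_add (ω ω' : K) : coordX f K - algebraMap K _ ω' =
    (coordX f K - algebraMap K _ ω) + algebraMap K _ (ω - ω') := by
  rw [map_sub]; ring

theorem val_sub_eq_one (p : Place f K) {ω ω' : K} (h : p.val (coordX f K - algebraMap K _ ω) < 1)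
    (hne : ω ≠ ω') : p.val (coordX f K - algebraMap K _ ω') = 1 := by
  have h1 := p.val_const (f := f) (sub_ne_zero.mpr hne)
  rw [sub_eq_sub_add f ω ω']
  exact (Valuation.map_add_eq_of_lt_right _ (by rwa [h1])).trans h1

variable [Algebra.IsAlgebraic k K]

theorem inv_unitSub_sub {ω ω₀ : K} (hne : ω ≠ ω₀) :
    ((unitSub f ω₀)⁻¹ : (CurveFunctionField f K)ˣ).val - algebraMap K _ (ω - ω₀)⁻¹ =
      -(((unitSub f ω₀)⁻¹ : (CurveFunctionField f K)ˣ).val * algebraMap K _ (ω - ω₀)⁻¹ *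
        (coordX f K - algebraMap K _ ω)) := by
  have h1 : ((unitSub f ω₀)⁻¹ : (CurveFunctionField f K)ˣ).val *
      (coordX f K - algebraMap K _ ω₀) = 1 := by
    rw [← unitSub_val, Units.inv_mul]
  have h2 : algebraMap K (CurveFunctionField f K) (ω - ω₀)⁻¹ * algebraMap K _ (ω - ω₀) = 1 := by
    rw [← map_mul, inv_mul_cancel₀ (sub_ne_zero.mpr hne), map_one]
  rw [sub_eq_sub_add f ω ω₀] at h1
  linear_combination (algebraMap K (CurveFunctionField f K) (ω - ω₀)⁻¹) * h1 -
    ((unitSub f ω₀)⁻¹ : (CurveFunctionField f K)ˣ).val * h2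

theorem val_inv_unitSub_sub_lt_one_iff (p : Place f K) {ω ω₀ : K} (hne : ω ≠ ω₀) :
    p.val (((unitSub f ω₀)⁻¹ : (CurveFunctionField f K)ˣ).val - algebraMap K _ (ω - ω₀)⁻¹) < 1 ↔
      p.val (coordX f K - algebraMap K _ ω) < 1 := by
  rw [inv_unitSub_sub hne, Valuation.map_neg, map_mul, map_mul,
    p.val_const (inv_ne_zero (sub_ne_zero.mpr hne)), mul_one, p.val_inv, unitSub_val]
  have hne0 := p.val_ne_zero (unitSub f ω₀)
  rw [unitSub_val] at hne0
  constructor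
  · intro h
    rw [← div_eq_inv_mul, div_lt_one₀ (zero_lt_iff.mpr hne0)] at h
    by_contra! h1
    have h3 : p.val (coordX f K - algebraMap K _ ω₀) ≤ p.val (coordX f K - algebraMap K _ ω) := by
      rw [sub_eq_sub_add f ω ω₀]
      refine (p.val.map_add _ _).trans (max_le le_rfl ?_)
      rwa [p.val_const (sub_ne_zero.mpr hne)]
    exact absurd h (not_lt.mpr h3)
  · intro h
    rw [p.val_sub_eq_one h hne, inv_one, one_mul]
    exact h

end Place

variable {a : K} {Ω : Finset K} {ω₀ : K}

theorem aeval_coordX_eq (hf : SplitSextic f a Ω ω₀) :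
    aeval (coordX f K) f = algebraMap K _ a * ∏ ω ∈ Ω, (coordX f K - algebraMap K _ ω) := by
  rw [← aeval_map_algebraMap K, hf.map_eq, map_mul, map_prod, aeval_C]
  simp

/-- `y` vanishes at the points where `x` takes the value of a root. -/
theorem val_coordY_lt_one (hf : SplitSextic f a Ω ω₀) {p : Place f K}
    (hp : p.val (coordX f K - algebraMap K _ ω₀) < 1) : p.val (coordY f K) < 1 := by
  classical
  rw [← pow_lt_one_iff two_ne_zero, ← map_pow, coordY_sq, aeval_coordX_eq hf, map_mul,
    p.val_const hf.ne_zero, one_mul, map_prod, ← Finset.mul_prod_erase _ _ hf.mem,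
    Finset.prod_eq_one fun ω hω => p.val_sub_eq_one hp (Finset.ne_of_mem_erase hω).symm, mul_one]
  exact hp

section Model

variable [Algebra.IsAlgebraic k K]

namespace SplitSextic

/-- A place of the curve, as a valuation of the odd degree model. -/
abbrev oddVal (hf : SplitSextic f a Ω ω₀) (p : Place f K) :
    Valuation (BaseFunctionField (oddPoly a Ω ω₀)) ℤᵐ⁰ :=
  p.val.comap (hf.equivOdd.symm : _ →+* CurveFunctionField f K)

theorem oddVal_apply (hf : SplitSextic f a Ω ω₀) (p : Place f K)
    (h : BaseFunctionField (oddPoly a Ω ω₀)) : hf.oddVal p h = p.val (hf.equivOdd.symm h) := rfl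

theorem equivOdd_symm_genT (hf : SplitSextic f a Ω ω₀) :
    hf.equivOdd.symm (genT _) = ((unitSub f ω₀)⁻¹ : (CurveFunctionField f K)ˣ).val :=
  (hf.ofOdd_algebraMap _).trans (oddRatInv_X ω₀)

theorem isPlaceFamily (hf : SplitSextic f a Ω ω₀) [Fact (Irreducible (quadRel (oddPoly a Ω ω₀)))] :
    IsPlaceFamily hf.oddVal where
  injective p q h := Place.ext' (by
    ext z
    have := DFunLike.congr_fun h (hf.equivOdd z)
    rwa [oddVal_apply, oddVal_apply, AlgEquiv.symm_apply_apply] at this)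
  isPlace p :=
    { surjective := p.surjective.comp hf.equivOdd.symm.surjective
      trivial := fun c hc => by
        rw [oddVal_apply, AlgEquiv.commutes]
        exact p.val_const hc }
  exists_eq v hv := ⟨{
      val := v.comap (hf.equivOdd : CurveFunctionField f K →+* _)
      surjective := hv.surjective.comp hf.equivOdd.surjective
      trivial_on_constants := fun c hc => by
        change v (hf.equivOdd _) = 1
        rw [AlgEquiv.commutes]
        exact hv.trivial c hc }, by
      ext z
      exact congrArg v (hf.equivOdd.apply_symm_apply z)⟩

theorem one_lt_oddVal_iff (hf : SplitSextic f a Ω ω₀) (p : Place f K) :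
    1 < hf.oddVal p (genT _) ↔ p.val (coordX f K - algebraMap K _ ω₀) < 1 := by
  rw [oddVal_apply, equivOdd_symm_genT, p.val_inv, unitSub_val]
  have hne0 := p.val_ne_zero (unitSub f ω₀)
  rw [unitSub_val] at hne0
  exact one_lt_inv₀ (zero_lt_iff.mpr hne0)

theorem mem_principalDiv_iff (hf : SplitSextic f a Ω ω₀)
    [Fact (Irreducible (quadRel (oddPoly a Ω ω₀)))] (D : CurveDiv f K) :
    D ∈ principalDiv f K ↔ D ∈ prinDiv hf.oddVal := by
  constructor
  · rintro ⟨u, hu⟩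
    refine ⟨hf.equivOdd u, (u.isUnit.map hf.equivOdd).ne_zero, fun p => ?_⟩
    rw [hu, oddVal_apply, AlgEquiv.symm_apply_apply]
    rfl
  · rintro ⟨h, h0, hD⟩
    exact ⟨((isUnit_iff_ne_zero.mpr h0).map hf.equivOdd.symm).unit, hD⟩

theorem oddVal_sub (hf : SplitSextic f a Ω ω₀) (p : Place f K) {ω : K} (hne : ω ≠ ω₀) :
    hf.oddVal p (genT _ - algebraMap K _ (ω - ω₀)⁻¹) < 1 ↔
      p.val (coordX f K - algebraMap K _ ω) < 1 := by
  rw [oddVal_apply, map_sub, equivOdd_symm_genT, AlgEquiv.commutes,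
    p.val_inv_unitSub_sub_lt_one_iff hne]

/-- There is a unique place at which `x - ω₀` vanishes. -/
theorem existsUnique_place (hf : SplitSextic f a Ω ω₀) (h2 : (2 : K) ≠ 0) :
    ∃! p : Place f K, p.val (coordX f K - algebraMap K _ ω₀) < 1 := by
  classical
  obtain ⟨ω₁, hω₁, hne⟩ : ∃ ω₁ ∈ Ω, ω₁ ≠ ω₀ :=
    Finset.exists_mem_ne (by rw [hf.card]; norm_num) ω₀
  refine existsUnique_of_exists_of_unique ?_ fun p q hp hq => ?_
  · have hf' : SplitSextic f a Ω ω₁ := ⟨hf.map_eq, hf.card, hf.ne_zero, hω₁⟩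
    have := hf'.fact_irreducible
    obtain ⟨v, hv, -, hlt⟩ := exists_isPlace_val_lt_one (g := oddPoly a Ω ω₁) h2
      (not_isUnit_X_sub_C (ω₀ - ω₁)⁻¹) (X_sub_C_ne_zero _)
    obtain ⟨p, rfl⟩ := hf'.isPlaceFamily.exists_eq v hv
    refine ⟨p, ?_⟩
    rwa [algebraMap_X_sub_C, hf'.oddVal_sub p hne.symm] at hlt
  · have := hf.fact_irreducible
    have hfam := hf.isPlaceFamily
    exact hfam.injective ((hfam.isPlace p).eq_of_infinity (hfam.isPlace q)
      ((hf.one_lt_oddVal_iff p).mpr hp) ((hf.one_lt_oddVal_iff q).mpr hq) hf.odd_natDegree)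

/-- The Weierstrass points have degree one. -/
theorem degree_eq_one (hf : SplitSextic f a Ω ω₀) {p : Place f K}
    (hp : p.val (coordX f K - algebraMap K _ ω₀) < 1) : p.degree = 1 := by
  have := hf.fact_irreducible
  have hpl := hf.isPlaceFamily.isPlace p
  have key : ∀ z : CurveFunctionField f K, p.val z ≤ 1 → ∃ c : K, p.val (z - algebraMap K _ c) < 1 := by
    intro z hz
    obtain ⟨c, hc⟩ := hpl.exists_val_sub_lt_one ((hf.one_lt_oddVal_iff p).mpr hp) hf.odd_natDegree
      (h := hf.equivOdd z) (by rwa [oddVal_apply, AlgEquiv.symm_apply_apply])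
    refine ⟨c, ?_⟩
    rwa [oddVal_apply, map_sub, AlgEquiv.symm_apply_apply, AlgEquiv.commutes] at hc
  let e : p.localRing := ⟨1, (map_one p.val).le⟩
  refine finrank_eq_one (Submodule.Quotient.mk e) ?_ fun r => ?_
  · rw [Ne, Submodule.Quotient.mk_eq_zero]
    intro h
    have h1 : p.val 1 < 1 := h
    rw [map_one] at h1
    exact lt_irrefl _ h1
  · induction r using Submodule.Quotient.induction_on with
    | H z =>
      obtain ⟨c, hc⟩ := key z z.2
      refine ⟨c, ?_⟩
      rw [← Submodule.Quotient.mk_smul, eq_comm, Submodule.Quotient.eq]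
      change p.val ((z : CurveFunctionField f K) - c • (1 : CurveFunctionField f K)) < 1
      rwa [← Algebra.algebraMap_eq_smul_one]

end SplitSextic

end Model

section Family

/-- The Weierstrass points, indexed by the roots of `f`: `w ω` is the only place at which `x - ω`
vanishes. There `y` vanishes as well, by `val_coordY_lt_one`. -/
def IsWeierstrassFamily (w : f.rootSet K → Place f K) : Prop :=
  ∀ ω p, p.val (coordX f K - algebraMap K _ (ω : K)) < 1 ↔ p = w ω

variable {w : f.rootSet K → Place f K}

theorem mem_oddRoots_iff {ω₀ : f.rootSet K} {i : K} :
    i ∈ oddRoots (f.rootSet K).toFinset (ω₀ : K) ↔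
      ∃ ω : f.rootSet K, ω ≠ ω₀ ∧ ((ω : K) - ω₀)⁻¹ = i := by
  classical
  unfold oddRoots
  rw [Finset.mem_image]
  constructor
  · rintro ⟨ω, hω, rfl⟩
    have h1 := Finset.mem_erase.mp hω
    lift ω to f.rootSet K using by simpa using h1.2
    exact ⟨ω, fun h => h1.1 (congrArg _ h), rfl⟩
  · rintro ⟨ω, hne, rfl⟩
    exact ⟨ω, Finset.mem_erase.mpr ⟨fun h => hne (Subtype.ext h), by simp [ω.2]⟩, rfl⟩

theorem invSub_injective (ω₀ : f.rootSet K) :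
    Function.Injective fun ω : f.rootSet K => ((ω : K) - ω₀)⁻¹ :=
  fun x y h => Subtype.ext (by simpa using h)

theorem sum_image_eq [DecidableEq K] {ω₀ : f.rootSet K} {S : Finset (f.rootSet K)} (hS : ω₀ ∉ S)
    {w' : K → Place f K} (hw' : ∀ ω, ω ≠ ω₀ → w' ((ω : K) - ω₀)⁻¹ = w ω) :
    ∑ i ∈ S.image (fun ω : f.rootSet K => ((ω : K) - ω₀)⁻¹),
      (Finsupp.single (w' i) (1 : ℤ) - Finsupp.single (w ω₀) 1) =
    ∑ ω ∈ S, (Finsupp.single (w ω) (1 : ℤ) - Finsupp.single (w ω₀) 1) := by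
  rw [Finset.sum_image (invSub_injective ω₀).injOn]
  exact Finset.sum_congr rfl fun ω hω => by rw [hw' ω fun h => hS (h ▸ hω)]

theorem oddRoots_eq_image [DecidableEq K] [DecidableEq (f.rootSet K)] (ω₀ : f.rootSet K) :
    oddRoots (f.rootSet K).toFinset (ω₀ : K) =
      (Finset.univ.erase ω₀).image (fun ω : f.rootSet K => ((ω : K) - ω₀)⁻¹) := by
  ext i
  rw [mem_oddRoots_iff]
  simp

variable [IsSepClosure k K]

theorem exists_isWeierstrassFamily (h2 : (2 : k) ≠ 0) (hdeg : f.natDegree = 6)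
    (hsep : f.Separable) : ∃ w : f.rootSet K → Place f K, IsWeierstrassFamily w := by
  have h2' : (2 : K) ≠ 0 := by
    have := (_root_.map_ne_zero (algebraMap k K)).mpr h2
    rwa [map_ofNat] at this
  choose w hw hw' using fun ω : f.rootSet K => (splitSextic hdeg hsep ω).existsUnique_place h2'
  exact ⟨w, fun ω p => ⟨hw' ω p, fun h => h ▸ hw ω⟩⟩

namespace IsWeierstrassFamily

variable (hw : IsWeierstrassFamily w)
include hw

theorem isWeierstrassPoint_iff (hdeg : f.natDegree = 6) (hsep : f.Separable) (ω : f.rootSet K)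
    (p : Place f K) : IsWeierstrassPoint ω p ↔ p = w ω := by
  rw [← hw ω p]
  exact ⟨And.left, fun h => ⟨h, val_coordY_lt_one (splitSextic hdeg hsep ω) h⟩⟩

theorem degree_eq_one (hdeg : f.natDegree = 6) (hsep : f.Separable) (ω : f.rootSet K) :
    (w ω).degree = 1 := by
  exact (splitSextic hdeg hsep ω).degree_eq_one ((hw ω _).mpr rfl)

/-- The odd degree model with the Weierstrass point `ω₀` at infinity. -/
theorem exists_oddModel (h2 : (2 : k) ≠ 0) (hdeg : f.natDegree = 6) (hsep : f.Separable)
    (ω₀ : f.rootSet K)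
    [Fact (Irreducible (quadRel (oddPoly (algebraMap k K f.leadingCoeff) (f.rootSet K).toFinset
      (ω₀ : K))))] :
    ∃ (w' : K → Place f K) (conjP : Place f K → Place f K),
      (∀ ω, ω ≠ ω₀ → w' ((ω : K) - ω₀)⁻¹ = w ω) ∧
      OddModel (splitSextic hdeg hsep ω₀).oddVal
        (oddLead (algebraMap k K f.leadingCoeff) (f.rootSet K).toFinset (ω₀ : K))
        (oddRoots (f.rootSet K).toFinset (ω₀ : K)) (w ω₀) w' conjP := by
  classical
  set hf := splitSextic hdeg hsep ω₀
  choose conjP hconjP using hf.isPlaceFamily.exists_conj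
  -- the values of `w'` outside `oddRoots` are irrelevant
  let w' : K → Place f K := fun i => if h : (ω₀ : K) + i⁻¹ ∈ f.rootSet K then w ⟨_, h⟩ else w ω₀
  have hw' : ∀ ω : f.rootSet K, w' ((ω : K) - ω₀)⁻¹ = w ω := by
    intro ω
    have h : (ω₀ : K) + (((ω : K) - ω₀)⁻¹)⁻¹ = ω := by rw [inv_inv]; ring
    simp only [w', h, Subtype.coe_prop, dif_pos]
  refine ⟨w', conjP, fun ω _ => hw' ω,
    { fam := hf.isPlaceFamily
      eq := rfl
      odd := by rw [hf.card_oddRoots]; decide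
      infinity := fun p => (hf.one_lt_oddVal_iff p).trans (hw ω₀ p)
      root := fun i hi p => ?_
      val_conjP := hconjP
      two := ?_
      sqrt := exists_sq_eq h2 }⟩
  · obtain ⟨ω, hω, rfl⟩ := Finset.mem_image.mp hi
    have h1 := Finset.mem_erase.mp hω
    lift ω to f.rootSet K using by simpa using h1.2
    rw [hf.oddVal_sub p h1.1, hw ω p, hw' ω]
  · have := (_root_.map_ne_zero (algebraMap k K)).mpr h2
    rwa [map_ofNat] at this

variable (h2 : (2 : k) ≠ 0) (hdeg : f.natDegree = 6) (hsep : f.Separable)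
include h2 hdeg hsep

/-- Twice `(ω) - (ω₀)` is the divisor of `(x - ω) / (x - ω₀)`. -/
theorem two_zsmul_mem (ω ω₀ : f.rootSet K) :
    (2 : ℤ) • (Finsupp.single (w ω) (1 : ℤ) - Finsupp.single (w ω₀) 1) ∈ principalDiv f K := by
  have := (splitSextic hdeg hsep ω₀).fact_irreducible
  obtain ⟨w', conjP, hw', hM⟩ := hw.exists_oddModel h2 hdeg hsep ω₀
  by_cases h : ω = ω₀
  · simp [h]
  rw [(splitSextic hdeg hsep ω₀).mem_principalDiv_iff, ← hw' ω h]
  exact hM.two_nsmul_single_sub_mem (mem_oddRoots_iff.mpr ⟨ω, h, rfl⟩)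

/-- The divisor of `y / (x - ω₀)³`. -/
theorem sum_univ_mem (ω₀ : f.rootSet K) :
    ∑ ω, (Finsupp.single (w ω) (1 : ℤ) - Finsupp.single (w ω₀) 1) ∈ principalDiv f K := by
  classical
  have := (splitSextic hdeg hsep ω₀).fact_irreducible
  obtain ⟨w', conjP, hw', hM⟩ := hw.exists_oddModel h2 hdeg hsep ω₀
  rw [(splitSextic hdeg hsep ω₀).mem_principalDiv_iff,
    ← Finset.add_sum_erase _ _ (Finset.mem_univ ω₀), sub_self, zero_add,
    ← sum_image_eq (Finset.notMem_erase ω₀ _) hw', ← oddRoots_eq_image, Finset.sum_sub_distrib,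
    Finset.sum_const]
  have := hM.isDivOf_genS.mem_prinDiv
  simpa using this

/-- A sum of differences `(ω) - (ω₀)` is principal only in the two obvious cases. -/
theorem eq_empty_or_eq_of_sum_mem [DecidableEq (f.rootSet K)] {ω₀ : f.rootSet K}
    {S : Finset (f.rootSet K)} (hS : ω₀ ∉ S)
    (h : ∑ ω ∈ S, (Finsupp.single (w ω) (1 : ℤ) - Finsupp.single (w ω₀) 1) ∈ principalDiv f K) :
    S = ∅ ∨ S = Finset.univ.erase ω₀ := by
  classical
  have := (splitSextic hdeg hsep ω₀).fact_irreducible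
  obtain ⟨w', conjP, hw', hM⟩ := hw.exists_oddModel h2 hdeg hsep ω₀
  rw [(splitSextic hdeg hsep ω₀).mem_principalDiv_iff, ← sum_image_eq hS hw',
    Finset.sum_sub_distrib, Finset.sum_const, sub_eq_add_neg, Finsupp.smul_single,
    ← Finsupp.single_neg] at h
  refine (hM.eq_empty_or_eq_of_mem_prinDiv ?_ h).imp Finset.image_eq_empty.mp fun h => ?_
  · rw [oddRoots_eq_image]
    exact Finset.image_subset_image fun ω hω =>
      Finset.mem_erase.mpr ⟨fun h => hS (h ▸ hω), Finset.mem_univ _⟩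
  · rw [oddRoots_eq_image] at h
    exact Finset.image_injective (invSub_injective ω₀) h

/-- The classes of the differences `(ω) - (ω₀)` generate the 2-torsion. -/
theorem exists_sub_sum_mem (ω₀ : f.rootSet K) {D : CurveDiv f K} (hD : 2 • D ∈ principalDiv f K) :
    ∃ S : Finset (f.rootSet K), ω₀ ∉ S ∧
      D - ∑ ω ∈ S, (Finsupp.single (w ω) (1 : ℤ) - Finsupp.single (w ω₀) 1) ∈
        principalDiv f K := by
  classical
  have := (splitSextic hdeg hsep ω₀).fact_irreducible
  obtain ⟨w', conjP, hw', hM⟩ := hw.exists_oddModel h2 hdeg hsep ω₀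
  rw [(splitSextic hdeg hsep ω₀).mem_principalDiv_iff] at hD
  obtain ⟨S, hS, h⟩ := hM.exists_sum_sub_mem hD
  rw [oddRoots_eq_image] at hS
  obtain ⟨S, hS', rfl⟩ := Finset.subset_image_iff.mp hS
  have h0 : ω₀ ∉ S := fun h => Finset.notMem_erase ω₀ Finset.univ (hS' h)
  refine ⟨S, h0, ?_⟩
  rwa [(splitSextic hdeg hsep ω₀).mem_principalDiv_iff, ← sum_image_eq h0 hw']

end IsWeierstrassFamily

end Family

end Weierstrass

/-! ### The étale algebra `K ⊗ L` over a separable closure -/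

section Etale

variable {k : Type*} [Field k] {f : k[X]} {K : Type*} [Field K] [Algebra k K]

theorem evalRoot_tmul (ω : f.rootSet K) (c : K) (p : k[X]) :
    evalRoot f K ω (c ⊗ₜ AdjoinRoot.mk f p) = c * aeval (ω : K) p := by
  rfl

theorem evalRoot_smul (σ : Gal(K/k)) (ω : f.rootSet K) (a : EtAlgSep f K) :
    evalRoot f K (σ • ω) (σ • a) = σ (evalRoot f K ω a) := by
  induction a using TensorProduct.induction_on with
  | zero => simp
  | add a b ha hb => rw [smul_add, map_add, map_add, map_add, ha, hb]
  | tmul c l =>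
    obtain ⟨p, rfl⟩ := AdjoinRoot.mk_surjective l
    rw [TensorProduct.smul_tmul', evalRoot_tmul, evalRoot_tmul, map_mul, rootSet.coe_smul]
    congr 1
    exact aeval_algHom_apply (σ : K →ₐ[k] K) (ω : K) p

theorem evalRoot_smul' (σ : Gal(K/k)) (ω : f.rootSet K) (a : EtAlgSep f K) :
    evalRoot f K ω (σ • a) = σ (evalRoot f K (σ⁻¹ • ω) a) := by
  rw [← evalRoot_smul, smul_inv_smul]

theorem exists_evalRoot_eq (v : f.rootSet K → K) :
    ∃ a : EtAlgSep f K, ∀ ω, evalRoot f K ω a = v ω := by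
  classical
  let x : EtAlgSep f K := 1 ⊗ₜ AdjoinRoot.root f
  refine ⟨aeval x (Lagrange.interpolate Finset.univ ((↑) : f.rootSet K → K) v), fun ω => ?_⟩
  have hx : evalRoot f K ω x = ω := by
    have := evalRoot_tmul ω 1 X
    rwa [AdjoinRoot.mk_X, aeval_X, one_mul] at this
  rw [← aeval_algHom_apply, hx, coe_aeval_eq_eval,
    Lagrange.eval_interpolate_at_node _ Subtype.val_injective.injOn (Finset.mem_univ ω)]

theorem card_rootSet [IsSepClosed K] (hsep : f.Separable) :
    Fintype.card (f.rootSet K) = f.natDegree :=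
  card_rootSet_eq_natDegree hsep (IsSepClosed.splits_codomain f hsep)

theorem finite_etAlg (hsep : f.Separable) : Module.Finite k (EtAlg f) :=
  (AdjoinRoot.powerBasis hsep.ne_zero).finite

/-- `K ⊗ L` is the algebra of functions on the roots. -/
def evalEquiv [IsSepClosed K] (hsep : f.Separable) : EtAlgSep f K ≃ₐ[K] (f.rootSet K → K) :=
  AlgEquiv.ofBijective (AlgHom.pi (evalRoot f K)) (by
    have hfin := finite_etAlg hsep
    have hs : Function.Surjective (AlgHom.pi (evalRoot f K)).toLinearMap := fun v => by
      obtain ⟨a, ha⟩ := exists_evalRoot_eq v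
      exact ⟨a, funext ha⟩
    refine ⟨(LinearMap.injective_iff_surjective_of_finrank_eq_finrank ?_).mpr hs, hs⟩
    rw [Module.finrank_baseChange, Module.finrank_fintype_fun_eq_card, card_rootSet hsep,
      (AdjoinRoot.powerBasis hsep.ne_zero).finrank, AdjoinRoot.powerBasis_dim])

theorem ext_evalRoot [IsSepClosed K] (hsep : f.Separable) {a b : EtAlgSep f K}
    (h : ∀ ω, evalRoot f K ω a = evalRoot f K ω b) : a = b :=
  (evalEquiv hsep).injective (funext h)

/-- Under `K ⊗ L ≅ ∏ K` the norm is the product over the roots. -/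
theorem norm_eq_prod [IsSepClosed K] (hsep : f.Separable) (a : EtAlgSep f K) :
    Algebra.norm K a = ∏ ω, evalRoot f K ω a := by
  classical
  rw [← Algebra.norm_eq_of_algEquiv (evalEquiv hsep),
    Algebra.norm_eq_matrix_det (Pi.basisFun K (f.rootSet K))]
  have : Algebra.leftMulMatrix (Pi.basisFun K (f.rootSet K)) (evalEquiv hsep a) =
      Matrix.diagonal (evalEquiv hsep a) := by
    ext i j
    rw [Algebra.leftMulMatrix_eq_repr_mul, Pi.basisFun_repr, Pi.basisFun_apply, Pi.mul_apply,
      Matrix.diagonal_apply, Pi.single_apply]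
    split_ifs <;> simp
  rw [this, Matrix.det_diagonal]
  rfl

theorem norm_one_tmul (hsep : f.Separable) (l : EtAlg f) :
    Algebra.norm K ((1 : K) ⊗ₜ[k] l) = algebraMap k K (Algebra.norm k l) := by
  have := finite_etAlg hsep
  rw [Algebra.norm_apply, Algebra.norm_apply, ← LinearMap.det_baseChange]
  congr 1
  exact (Algebra.baseChange_lmul l).symm

theorem unitsIncl_injective : Function.Injective (unitsIncl (f := f) (K := K)) :=
  Units.map_injective (Algebra.TensorProduct.includeRight_injective
    (FaithfulSMul.algebraMap_injective k K))

theorem smul_unitsIncl (σ : Gal(K/k)) (l : (EtAlg f)ˣ) :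
    σ • (unitsIncl l : (EtAlgSep f K)ˣ) = unitsIncl l := by
  refine Units.ext ?_
  change σ • ((1 : K) ⊗ₜ[k] (l : EtAlg f)) = 1 ⊗ₜ (l : EtAlg f)
  rw [TensorProduct.smul_tmul', smul_one]

/-- The Galois invariants of `K ⊗ L`. -/
theorem exists_eq_one_tmul [IsGalois k K] (a : EtAlgSep f K)
    (ha : ∀ σ : Gal(K/k), σ • a = a) : ∃ l : EtAlg f, a = 1 ⊗ₜ l := by
  classical
  let b := Module.Free.chooseBasis k (EtAlg f)
  let B := Algebra.TensorProduct.basis K b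
  have hB : ∀ (σ : Gal(K/k)) (x : EtAlgSep f K) i, B.repr (σ • x) i = σ (B.repr x i) := by
    intro σ x i
    induction x using TensorProduct.induction_on with
    | zero => simp
    | add x y hx hy => rw [smul_add, map_add, map_add, Finsupp.add_apply, Finsupp.add_apply,
        map_add, hx, hy]
    | tmul c l =>
      rw [TensorProduct.smul_tmul', Algebra.TensorProduct.basis_repr_tmul,
        Algebra.TensorProduct.basis_repr_tmul]
      simp
  have h : ∀ i, ∃ c : k, algebraMap k K c = B.repr a i := fun i =>
    (InfiniteGalois.mem_range_algebraMap_iff_fixed _).mpr fun σ => by rw [← hB, ha]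
  choose c hc using h
  have hl : ∀ s : Finset _, ∑ i ∈ s, B.repr a i • B i = 1 ⊗ₜ ∑ i ∈ s, c i • b i := by
    intro s
    rw [TensorProduct.tmul_sum]
    refine Finset.sum_congr rfl fun i _ => ?_
    rw [← hc i, Algebra.TensorProduct.basis_apply, TensorProduct.smul_tmul', smul_eq_mul, mul_one,
      ← TensorProduct.smul_tmul, Algebra.smul_def, mul_one]
  refine ⟨∑ i ∈ (B.repr a).support, c i • b i, ?_⟩
  rw [← hl]
  conv_lhs => rw [← B.linearCombination_repr a, Finsupp.linearCombination_apply]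
  rfl

theorem exists_eq_unitsIncl [IsGalois k K] (a : (EtAlgSep f K)ˣ)
    (ha : ∀ σ : Gal(K/k), σ • a = a) : ∃ l : (EtAlg f)ˣ, a = unitsIncl l := by
  obtain ⟨l, hl⟩ := exists_eq_one_tmul (a : EtAlgSep f K) fun σ => congrArg Units.val (ha σ)
  obtain ⟨l', hl'⟩ := exists_eq_one_tmul ((a⁻¹ : (EtAlgSep f K)ˣ) : EtAlgSep f K) fun σ => by
    have := congrArg (fun u : (EtAlgSep f K)ˣ => ((u⁻¹ : (EtAlgSep f K)ˣ) : EtAlgSep f K)) (ha σ)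
    rwa [← smul_inv'] at this
  have h1 : l * l' = 1 := by
    refine Algebra.TensorProduct.includeRight_injective (B := EtAlg f)
      (FaithfulSMul.algebraMap_injective k K) ?_
    rw [map_mul, map_one]
    exact (congrArg₂ (· * ·) hl hl').symm.trans a.mul_inv
  exact ⟨⟨l, l', h1, by rwa [mul_comm]⟩, Units.ext hl⟩

theorem isLocallyConstant_smul_field [Algebra.IsAlgebraic k K] (c : K) :
    IsLocallyConstant fun σ : Gal(K/k) => σ c := by
  let _ : TopologicalSpace K := ⊥
  have : DiscreteTopology K := ⟨rfl⟩
  have := continuousSMul_iff_stabilizer_isOpen.mpr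
    (fun x : K => stabilizer_isOpen_of_isIntegral (K := k) x)
  exact (IsLocallyConstant.iff_continuous _).mpr
    (show Continuous fun σ : Gal(K/k) => σ • c by fun_prop)

theorem isLocallyConstant_smul [Algebra.IsAlgebraic k K] (a : EtAlgSep f K) :
    IsLocallyConstant fun σ : Gal(K/k) => σ • a := by
  induction a using TensorProduct.induction_on with
  | zero => 
    simp only [smul_zero]
    exact IsLocallyConstant.const 0
  | add a b ha hb => simpa using ha.comp₂ hb (· + ·)
  | tmul c l =>
    exact (isLocallyConstant_smul_field c).comp fun x : K => (x ⊗ₜ[k] l : EtAlgSep f K)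

theorem isLocallyConstant_of_comp_injective {X Y Z : Type*} [TopologicalSpace X] {g : X → Y}
    {i : Y → Z} (hi : Function.Injective i) (h : IsLocallyConstant (i ∘ g)) :
    IsLocallyConstant g :=
  IsLocallyConstant.desc g i h hi

theorem isLocallyConstant_smul_units [Algebra.IsAlgebraic k K] (a : (EtAlgSep f K)ˣ) :
    IsLocallyConstant fun σ : Gal(K/k) => σ • a :=
  isLocallyConstant_of_comp_injective Units.val_injective
    (isLocallyConstant_smul (a : EtAlgSep f K))

theorem isLocallyConstant_smul_div [Algebra.IsAlgebraic k K] (a : (EtAlgSep f K)ˣ) :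
    IsLocallyConstant fun σ : Gal(K/k) => σ • a / a :=
  (isLocallyConstant_smul_units a).comp (· / a)

theorem isLocallyConstant_smul_rootSet [Algebra.IsAlgebraic k K] (ω : f.rootSet K) :
    IsLocallyConstant fun σ : Gal(K/k) => σ • ω :=
  isLocallyConstant_of_comp_injective Subtype.val_injective
    (isLocallyConstant_smul_field (ω : K))

/-- The `K`-algebra map `φ_ω` on units. -/
abbrev evalUnit (ω : f.rootSet K) : (EtAlgSep f K)ˣ →* Kˣ :=
  Units.map ((evalRoot f K ω : EtAlgSep f K →ₐ[K] K) : EtAlgSep f K →* K)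

theorem evalUnit_smul' (σ : Gal(K/k)) (ω : f.rootSet K) (a : (EtAlgSep f K)ˣ) :
    evalUnit ω (σ • a) = Units.map (σ : K →* K) (evalUnit (σ⁻¹ • ω) a) :=
  Units.ext (evalRoot_smul' σ ω (a : EtAlgSep f K))

theorem ext_evalUnit [IsSepClosed K] (hsep : f.Separable) {a b : (EtAlgSep f K)ˣ}
    (h : ∀ ω, evalUnit ω a = evalUnit ω b) : a = b :=
  Units.ext (ext_evalRoot hsep fun ω => congrArg Units.val (h ω))

theorem exists_evalUnit_eq [IsSepClosed K] (hsep : f.Separable) (v : f.rootSet K → Kˣ) :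
    ∃ a : (EtAlgSep f K)ˣ, ∀ ω, evalUnit ω a = v ω :=
  ⟨(Units.mapEquiv (evalEquiv (K := K) hsep).toMulEquiv).symm
      (MulEquiv.piUnits.symm v), fun ω => Units.ext (by
        have := (evalEquiv hsep).apply_symm_apply (fun ω => (v ω : K))
        exact congrFun this ω)⟩

end Etale

/-! ### First cohomology classes -/

section Classes

theorem smul_div_mul {G A : Type*} [Group G] [CommGroup A] [MulDistribMulAction G A] (a : A) (g h : G) :
    (g * h) • a / a = g • (h • a / a) * (g • a / a) := by
  rw [smul_div', mul_smul, div_mul_div_cancel]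

variable {G : Type*} [Group G] [TopologicalSpace G] {A : Type*} [CommGroup A]
  [MulDistribMulAction G A] {B : Type*} [CommGroup B] [MulDistribMulAction G B]

theorem H1.mk_surjective : Function.Surjective (H1.mk : Z1 G A → H1 G A) :=
  QuotientGroup.mk'_surjective _

theorem H1.mk_eq_one_iff {c : Z1 G A} :
    H1.mk c = 1 ↔ ∃ x : A, ∀ g, (c : G → A) g = g • x / x := by
  refine (QuotientGroup.eq_one_iff c).trans ?_
  exact exists_congr fun x => forall_congr' fun g => eq_comm

theorem H1.mk_eq_mk_iff {c d : Z1 G A} :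
    H1.mk c = H1.mk d ↔ ∃ x : A, ∀ g, (c : G → A) g = (d : G → A) g * (g • x / x) := by
  rw [← div_eq_one, ← _root_.map_div, H1.mk_eq_one_iff]
  exact exists_congr fun x => forall_congr' fun g => div_eq_iff_eq_mul'

theorem H1.map_mk (φ : A →*[G] B) (c : Z1 G A) : H1.map φ (H1.mk c) = H1.mk (Z1.map φ c) := rfl

theorem Z1.apply_mul (c : Z1 G A) (g h : G) :
    (c : G → A) (g * h) = g • (c : G → A) h * (c : G → A) g := c.2.2 g h

theorem Z1.ext {c d : Z1 G A} (h : ∀ g, (c : G → A) g = (d : G → A) g) : c = d :=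
  Subtype.ext (funext h)

theorem Z1.ext_coe {A' : Type*} [CommGroup A'] {V : Subgroup A'} [MulDistribMulAction G V]
    {c d : Z1 G V} (h : ∀ g, (((c : G → V) g : V) : A') = ((d : G → V) g : V)) : c = d :=
  Z1.ext fun g => Subtype.ext (h g)

/-- Let `V ⊆ A` be a stable subgroup such that continuous 1-cocycles with values in `V` split in
`A`, and let `R` relate the elements of a group `X` to those `ε : A` for which `σ ε / ε` has values
in `V`. Then `x ↦ (σ ↦ σ ε / ε)` identifies `X`, modulo the elements related to invariants,
with `H¹(V)`. -/
theorem exists_h1_equiv {V : Subgroup A} [MulDistribMulAction G V]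
    (hV : ∀ (g : G) (v : V), ((g • v : V) : A) = g • (v : A))
    (hloc : ∀ a : A, IsLocallyConstant fun g : G => g • a)
    (h90 : ∀ c : Z1 G V, ∃ a : A, ∀ g, (((c : G → V) g : V) : A) = g • a / a)
    {X : Type*} [CommGroup X] (R : Subgroup (X × A)) (Y : Subgroup X)
    (hR : ∀ x, ∃ a, (x, a) ∈ R) (hR1 : ∀ a, (1, a) ∈ R → a ∈ V)
    (hRV : ∀ x a, (x, a) ∈ R → ∀ g : G, g • a / a ∈ V)
    (hVR : ∀ a, (∀ g : G, g • a / a ∈ V) → ∃ x, (x, a) ∈ R)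
    (hVR1 : ∀ a ∈ V, (1, a) ∈ R)
    (hY : ∀ x, x ∈ Y ↔ ∃ a, (∀ g : G, g • a = a) ∧ (x, a) ∈ R) :
    ∃ γ : X ⧸ Y ≃* H1 G V, ∀ x a, (x, a) ∈ R → ∃ c : Z1 G V,
      (∀ g, (((c : G → V) g : V) : A) = g • a / a) ∧ γ (QuotientGroup.mk x) = H1.mk c := by
  have hcoc : ∀ x a, (x, a) ∈ R → ∃ c : Z1 G V, ∀ g, (((c : G → V) g : V) : A) = g • a / a :=
    fun x a h => ⟨⟨fun g => ⟨g • a / a, hRV x a h g⟩,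
      IsLocallyConstant.desc _ Subtype.val ((hloc a).comp (· / a)) Subtype.val_injective,
      fun g h => Subtype.ext (by
        rw [Subgroup.coe_mul, hV]
        exact smul_div_mul a g h)⟩, fun g => rfl⟩
  -- the class of the cocycle depends only on `x`
  have hwd : ∀ x a a', (x, a) ∈ R → (x, a') ∈ R → ∀ c c' : Z1 G V,
      (∀ g, (((c : G → V) g : V) : A) = g • a / a) →
      (∀ g, (((c' : G → V) g : V) : A) = g • a' / a') → H1.mk c = H1.mk c' := by
    intro x a a' h h' c c' hc hc'
    have h1 : (1, a / a') ∈ R := by simpa using div_mem h h'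
    refine H1.mk_eq_mk_iff.mpr ⟨⟨a / a', hR1 _ h1⟩, fun g => Subtype.ext ?_⟩
    rw [Subgroup.coe_mul, Subgroup.coe_div, hV, hc, hc']
    rw [smul_div', div_div_div_comm, mul_div_cancel]
  choose r hr using hR
  choose z hz using fun x => hcoc x (r x) (hr x)
  have hφ : ∀ x a, (x, a) ∈ R → ∀ c : Z1 G V, (∀ g, (((c : G → V) g : V) : A) = g • a / a) →
      H1.mk (z x) = H1.mk c := fun x a h c hc => hwd x _ _ (hr x) h _ _ (hz x) hc
  let φ : X →* H1 G V := MonoidHom.mk' (fun x => H1.mk (z x)) (fun x y => by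
    rw [← map_mul]
    refine hφ _ _ (mul_mem (hr x) (hr y)) _ fun g => ?_
    rw [Subgroup.coe_mul, Pi.mul_apply, Subgroup.coe_mul, hz, hz]
    change _ = g • (r x * r y) / (r x * r y)
    rw [smul_mul', div_mul_div_comm])
  have hker : φ.ker = Y := by
    ext x
    rw [MonoidHom.mem_ker, hY]
    constructor
    · intro h
      obtain ⟨v, hv⟩ := H1.mk_eq_one_iff.mp (show H1.mk (z x) = 1 from h)
      refine ⟨r x / v, fun g => ?_, ?_⟩
      · have := congrArg Subtype.val (hv g)
        rw [hz, Subgroup.coe_div, hV, div_eq_div_iff_mul_eq_mul] at this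
        rw [smul_div', div_eq_div_iff_mul_eq_mul, this, mul_comm]
      · simpa using div_mem (hr x) (hVR1 v v.2)
    · rintro ⟨a, ha, hxa⟩
      exact hφ x a hxa 1 fun g => by rw [ha, div_self']; rfl
  have hsurj : Function.Surjective φ := by
    intro ξ
    obtain ⟨c, rfl⟩ := H1.mk_surjective ξ
    obtain ⟨a, ha⟩ := h90 c
    obtain ⟨x, hx⟩ := hVR a fun g => ha g ▸ ((c : G → V) g).2
    exact ⟨x, hφ x a hx c ha⟩
  subst hker
  refine ⟨QuotientGroup.quotientKerEquivOfSurjective φ hsurj, fun x a h => ?_⟩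
  obtain ⟨c, hc⟩ := hcoc x a h
  exact ⟨c, hc, hφ x a h c hc⟩

end Classes

/-! ### Hilbert's Theorem 90 -/

section Hilbert

/-- Hilbert 90 for a group `H` acting on a field: a 1-cocycle splits as soon as it is trivial on a
subgroup `N` of finite index that consists of all elements fixing the invariants of `N`.
A splitting is a value of the Poincaré series `∑ c(τ) τ(a)` over `H / N`. -/
theorem exists_smul_div_eq_of_finiteIndex {H K : Type*} [Group H] [Field K]
    [MulSemiringAction H K] (c : H → Kˣ) (hc : ∀ σ τ, (c (σ * τ) : K) = σ • (c τ : K) * c σ)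
    (N : Subgroup H) [N.FiniteIndex] (hcN : ∀ n ∈ N, c n = 1)
    (hN : ∀ h : H, (∀ x : K, (∀ n ∈ N, n • x = x) → h • x = x) → h ∈ N) :
    ∃ b : Kˣ, ∀ σ, (c σ : K) = σ • (b : K) / b := by
  classical
  let F : Submonoid K :=
    { carrier := {x | ∀ n ∈ N, n • x = x}
      one_mem' := fun n _ => smul_one n
      mul_mem' := fun {a b} ha hb n hn => by rw [smul_mul', ha n hn, hb n hn] }
  let χ : H → F →* K := fun τ => (MulSemiringAction.toRingHom H K τ : K →* K).comp F.subtype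
  have hχ : ∀ τ (a : F), χ τ a = τ • (a : K) := fun _ _ => rfl
  have hχN : ∀ τ τ', χ τ = χ τ' ↔ τ⁻¹ * τ' ∈ N := by
    intro τ τ'
    constructor
    · intro h
      refine hN _ fun x hx => ?_
      have := DFunLike.congr_fun h (⟨x, hx⟩ : F)
      rw [hχ, hχ] at this
      rw [mul_smul, ← this, inv_smul_smul]
    · intro h
      ext a
      have := a.2 _ h
      rw [hχ, hχ, ← this, smul_smul, mul_inv_cancel_left, this]
  have hcτ : ∀ τ τ', τ⁻¹ * τ' ∈ N → c τ = c τ' := by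
    intro τ τ' h
    have := hc τ (τ⁻¹ * τ')
    rw [mul_inv_cancel_left, hcN _ h, Units.val_one, smul_one, one_mul] at this
    exact Units.ext this.symm
  have _ : Fintype (H ⧸ N) := Fintype.ofFinite _
  let t : F → H ⧸ N → K := fun a => Quotient.lift (fun τ => (c τ : K) * τ • (a : K))
    fun τ τ' h => by
      have h' := QuotientGroup.leftRel_apply.mp h
      change (c τ : K) * χ τ a = c τ' * χ τ' a
      rw [hcτ τ τ' h', (hχN τ τ').mpr h']
  have ht : ∀ a (τ : H), t a (τ : H ⧸ N) = c τ * τ • (a : K) := fun _ _ => rfl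
  have hsum : ∀ a σ, σ • (∑ q, t a q) = (c σ : K)⁻¹ * ∑ q, t a q := by
    intro a σ
    rw [Finset.smul_sum, Finset.mul_sum]
    refine Fintype.sum_equiv (MulAction.toPerm σ) _ _ fun q => ?_
    induction q using QuotientGroup.induction_on with
    | H τ =>
      rw [MulAction.toPerm_apply, MulAction.Quotient.smul_mk, smul_eq_mul, ht, ht, hc,
        smul_mul', mul_smul]
      field_simp
  obtain ⟨a, ha⟩ : ∃ a, ∑ q, t a q ≠ 0 := by
    by_contra! h
    have hli := linearIndependent_monoidHom F K
    have hinj : Function.Injective fun q : H ⧸ N => χ q.out := by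
      intro q q' hq
      have := QuotientGroup.eq.mpr ((hχN _ _).mp hq)
      simpa using this
    have := Fintype.linearIndependent_iff.mp (hli.comp _ hinj) (fun q => (c q.out : K)) (by
      ext a
      have h1 := h a
      simp only [Finset.sum_apply, Pi.zero_apply, Pi.smul_apply, smul_eq_mul, Function.comp_apply]
      rw [← h1]
      refine Finset.sum_congr rfl fun q _ => ?_
      rw [hχ, ← ht, QuotientGroup.out_eq'])
    exact (c _).ne_zero (this ((1 : H) : H ⧸ N))
  refine ⟨(Units.mk0 _ ha)⁻¹, fun σ => ?_⟩
  rw [Units.val_inv_eq_inv_val, smul_inv₀', inv_div_inv, Units.val_mk0, hsum]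
  field_simp

variable {k : Type*} [Field k] {K : Type*} [Field K] [Algebra k K] [IsGalois k K]

/-- Hilbert 90 for continuous cocycles on an open subgroup of the Galois group. -/
theorem exists_smul_div_eq_of_isOpen (H : Subgroup Gal(K/k)) (hH : IsOpen (H : Set Gal(K/k)))
    (c : Gal(K/k) → Kˣ) (hloc : IsLocallyConstant c)
    (hc : ∀ σ ∈ H, ∀ τ ∈ H, c (σ * τ) = σ • c τ * c σ) :
    ∃ b : Kˣ, ∀ σ ∈ H, c σ = σ • b / b := by
  have hc1 : c 1 = 1 := by
    have := hc 1 H.one_mem 1 H.one_mem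
    rwa [mul_one, one_smul, left_eq_mul] at this
  have hnhds : {σ | c σ = 1} ∈ nhds (1 : Gal(K/k)) :=
    (hloc.isOpen_fiber 1).mem_nhds hc1
  obtain ⟨E, hE, hEc⟩ := (krullTopology_mem_nhds_one_iff k K _).mp hnhds
  let N : Subgroup Gal(K/k) := H ⊓ E.fixingSubgroup
  have hNo : IsOpen (N : Set Gal(K/k)) := hH.inter E.fixingSubgroup_isOpen
  have hNc : IsClosed (N : Set Gal(K/k)) := Subgroup.isClosed_of_isOpen _ hNo
  have hNfix : ∀ σ : Gal(K/k), (∀ x : K, (∀ n ∈ N, n • x = x) → σ • x = x) → σ ∈ N := by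
    intro σ h
    have h1 := InfiniteGalois.fixingSubgroup_fixedField (⟨N, hNc⟩ : ClosedSubgroup Gal(K/k))
    have h2 : σ ∈ (IntermediateField.fixedField N).fixingSubgroup := by
      rintro ⟨x, hx⟩
      exact h x fun n hn => hx ⟨n, hn⟩
    have h3 : (IntermediateField.fixedField N).fixingSubgroup = N := h1
    rwa [h3] at h2
  have := Subgroup.quotient_finite_of_isOpen N hNo
  have hNi : N.FiniteIndex := Subgroup.finiteIndex_of_finite_quotient
  obtain ⟨b, hb⟩ := exists_smul_div_eq_of_finiteIndex (H := H) (fun σ => c σ)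
    (fun σ τ => congrArg Units.val (hc σ σ.2 τ τ.2)) (N.subgroupOf H) (fun n hn => hEc (Subgroup.mem_subgroupOf.mp hn).2)
    (fun h hh => Subgroup.mem_subgroupOf.mpr (hNfix h fun x hx => hh x fun n hn => hx n
      (Subgroup.mem_subgroupOf.mp hn)))
  exact ⟨b, fun σ hσ => Units.ext ((hb ⟨σ, hσ⟩).trans
    (Units.val_div_eq_div_val (σ • b) b).symm)⟩

variable {f : k[X]}

/-- Hilbert 90 for the units of `K ⊗ L`, by Shapiro's lemma over the Galois orbits of roots. -/
theorem exists_smul_div_eq_etAlgSep [IsSepClosed K] (hsep : f.Separable)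
    (c : Gal(K/k) → (EtAlgSep f K)ˣ) (hloc : IsLocallyConstant c)
    (hc : ∀ σ τ, c (σ * τ) = σ • c τ * c σ) :
    ∃ a : (EtAlgSep f K)ˣ, ∀ σ, c σ = σ • a / a := by
  have hopen : ∀ ω : f.rootSet K,
      IsOpen (MulAction.stabilizer Gal(K/k) ω : Set Gal(K/k)) := fun ω =>
    (isLocallyConstant_smul_rootSet ω).isOpen_fiber ω
  have hsmul : ∀ (σ : Gal(K/k)) (ω : f.rootSet K) (a : (EtAlgSep f K)ˣ),
      evalUnit (σ • ω) (σ • a) = σ • evalUnit ω a :=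
    fun σ ω a => Units.ext (evalRoot_smul σ ω (a : EtAlgSep f K))
  have h1 : ∀ ω : f.rootSet K, ∃ b : Kˣ, ∀ σ ∈ MulAction.stabilizer Gal(K/k) ω,
      evalUnit ω (c σ) = σ • b / b := by
    intro ω
    refine exists_smul_div_eq_of_isOpen _ (hopen ω) _ (hloc.comp (evalUnit ω)) fun σ hσ τ hτ => ?_
    have h := hsmul σ ω (c τ)
    rw [MulAction.mem_stabilizer_iff.mp hσ] at h
    change evalUnit ω (c (σ * τ)) = σ • evalUnit ω (c τ) * evalUnit ω (c σ)
    rw [hc, map_mul, h]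
  choose b hb using h1
  -- a representative of the orbit of `ω`, and an element that moves it to `ω`
  let r : f.rootSet K → f.rootSet K := fun ω =>
    Quotient.out (s := MulAction.orbitRel Gal(K/k) (f.rootSet K)) (Quotient.mk _ ω)
  have hr : ∀ ω, ∃ σ : Gal(K/k), σ • r ω = ω := fun ω => by
    have h := Quotient.mk_out (s := MulAction.orbitRel Gal(K/k) (f.rootSet K)) ω
    obtain ⟨σ, hσ⟩ := MulAction.orbitRel_apply.mp (Setoid.symm' _ h)
    exact ⟨σ, hσ⟩
  have hrs : ∀ (σ : Gal(K/k)) ω, r (σ • ω) = r ω := fun σ ω => by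
    refine congrArg (Quotient.out (s := MulAction.orbitRel Gal(K/k) (f.rootSet K)))
      (Quotient.sound ?_)
    exact MulAction.orbitRel_apply.mpr ⟨σ, rfl⟩
  choose s hs using hr
  let v : f.rootSet K → Kˣ := fun ω => s ω • b (r ω) / evalUnit ω (c (s ω))
  have hv : ∀ (σ : Gal(K/k)) ω, σ • r ω = ω → v ω = σ • b (r ω) / evalUnit ω (c σ) := by
    intro σ ω hσ
    have hh : (s ω)⁻¹ * σ ∈ MulAction.stabilizer Gal(K/k) (r ω) := by
      rw [MulAction.mem_stabilizer_iff, mul_smul, hσ, inv_smul_eq_iff, hs]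
    have h2 := hb (r ω) _ hh
    have h3 := hc (s ω) ((s ω)⁻¹ * σ)
    have h4 := hsmul (s ω) (r ω) (c ((s ω)⁻¹ * σ))
    rw [hs] at h4
    rw [mul_inv_cancel_left] at h3
    rw [h3, map_mul, h4, h2, smul_div', smul_smul, mul_inv_cancel_left]
    change s ω • b (r ω) / _ = _
    rw [div_eq_div_iff_mul_eq_mul, ← mul_assoc, mul_div_cancel]
  obtain ⟨a, ha⟩ := exists_evalUnit_eq hsep v
  refine ⟨a, fun σ => ext_evalUnit hsep fun ω => ?_⟩
  obtain ⟨ω, rfl⟩ := MulAction.surjective σ ω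
  rw [_root_.map_div]
  simp only []
  rw [hsmul, ha, ha, hv (σ * s ω) (σ • ω) (by rw [hrs, mul_smul, hs]), hrs, hc, map_mul,
    hsmul]
  change _ = σ • (s ω • b (r ω) / _) / _
  rw [smul_div', mul_smul, div_div_div_cancel_left]
  rw [mul_div_cancel_left]

end Hilbert

/-! ### The isomorphism `γ` and the Kummer isomorphism -/

section Kummer

variable {k : Type*} [Field k] {f : k[X]} {K : Type*} [Field K] [Algebra k K]

theorem mem_normOneMu2_iff {a : (EtAlgSep f K)ˣ} :
    a ∈ normOneMu2 f K ↔ a ^ 2 = 1 ∧ Algebra.norm K (a : EtAlgSep f K) = 1 := by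
  rw [normOneMu2, Subgroup.mem_inf, mem_rootsOfUnity, MonoidHom.mem_ker, Units.ext_iff (u := Units.map _ a)]
  rfl

theorem norm_smul_div (σ : Gal(K/k)) (a : (EtAlgSep f K)ˣ) :
    Algebra.norm K ((σ • a / a : (EtAlgSep f K)ˣ) : EtAlgSep f K) =
      σ (Algebra.norm K (a : EtAlgSep f K)) / Algebra.norm K (a : EtAlgSep f K) := by
  rw [← norm_galois_smul, eq_div_iff (a.isUnit.map (Algebra.norm K)).ne_zero, ← map_mul]
  exact congrArg (fun u : (EtAlgSep f K)ˣ => Algebra.norm K (u : EtAlgSep f K))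
    (div_mul_cancel (σ • a) a)

theorem smul_div_pow (σ : Gal(K/k)) (a : (EtAlgSep f K)ˣ) (n : ℕ) :
    (σ • a / a) ^ n = σ • a ^ n / a ^ n := by rw [div_pow, smul_pow']

theorem eq_pow_two_of_unitsIncl {δ l : (EtAlg f)ˣ} (h : unitsIncl (K := K) l ^ 2 = unitsIncl δ) :
    l ^ 2 = δ := unitsIncl_injective (K := K) (by rw [map_pow, h])

variable [IsSepClosure k K]

/-- Every element of `Γ` has a root. -/
theorem exists_isRootOf (h2 : (2 : k) ≠ 0) (hsep : f.Separable) (hΩ : Nonempty (f.rootSet K))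
    (x : Gam f) : ∃ ε : (EtAlgSep f K)ˣ, IsRootOf x ε := by
  classical
  have := IsSepClosure.sep_closed k (K := K)
  obtain ⟨ω₀⟩ := hΩ
  have hs : ∀ ω : f.rootSet K, ∃ u : Kˣ, u ^ 2 = evalUnit ω (unitsIncl (x : (EtAlg f)ˣ × kˣ).1) := by
    intro ω
    obtain ⟨e, he⟩ := exists_sq_eq (K := K) h2
      (evalUnit ω (unitsIncl (x : (EtAlg f)ˣ × kˣ).1) : K)
    have h0 : e ≠ 0 := by
      rintro rfl
      exact (evalUnit ω (unitsIncl (x : (EtAlg f)ˣ × kˣ).1)).ne_zero (by rw [← he]; simp)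
    exact ⟨Units.mk0 e h0, Units.ext he⟩
  choose u hu using hs
  have hprod : (∏ ω, (u ω : K)) ^ 2 = algebraMap k K ((x : (EtAlg f)ˣ × kˣ).2 : k) ^ 2 := by
    have h1 : ∀ ω : f.rootSet K, (u ω : K) ^ 2 =
        evalRoot f K ω (unitsIncl (x : (EtAlg f)ˣ × kˣ).1 : (EtAlgSep f K)ˣ) := fun ω =>
      congrArg Units.val (hu ω)
    rw [← Finset.prod_pow, Finset.prod_congr rfl fun ω _ => h1 ω, ← norm_eq_prod hsep, ← map_pow]
    refine (norm_one_tmul hsep _).trans (congrArg _ ?_)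
    exact congrArg Units.val x.2
  -- adjust the sign at `ω₀` so that the norm is `n` instead of `-n`
  obtain ⟨s, hs, hsn⟩ : ∃ s : Kˣ, s ^ 2 = 1 ∧
      s * ∏ ω, (u ω : K) = algebraMap k K ((x : (EtAlg f)ˣ × kˣ).2 : k) := by
    rcases sq_eq_sq_iff_eq_or_eq_neg.mp hprod with h | h
    · exact ⟨1, one_pow 2, by simpa using h⟩
    · exact ⟨-1, by simp, by simp [h]⟩
  obtain ⟨ε, hε⟩ := exists_evalUnit_eq hsep (fun ω => (if ω = ω₀ then s else 1) * u ω)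
  refine ⟨ε, ext_evalUnit hsep fun ω => ?_, ?_⟩
  · rw [map_pow, hε, mul_pow, hu]
    split_ifs <;> simp [hs]
  · have h1 : ∀ ω : f.rootSet K, evalRoot f K ω (ε : EtAlgSep f K) =
        ((if ω = ω₀ then s else 1 : Kˣ) : K) * u ω := fun ω => congrArg Units.val (hε ω)
    rw [norm_eq_prod hsep, Finset.prod_congr rfl fun ω _ => h1 ω, Finset.prod_mul_distrib, ← hsn,
      ← Units.coe_prod, Finset.prod_ite_eq' Finset.univ ω₀ fun _ => s, if_pos (Finset.mem_univ _)]

theorem exists_sq_eq_unit (h2 : (2 : k) ≠ 0) (hsep : f.Separable) (a : (EtAlgSep f K)ˣ) :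
    ∃ ε : (EtAlgSep f K)ˣ, ε ^ 2 = a := by
  have := IsSepClosure.sep_closed k (K := K)
  have hs : ∀ ω : f.rootSet K, ∃ u : Kˣ, u ^ 2 = evalUnit ω a := by
    intro ω
    obtain ⟨e, he⟩ := exists_sq_eq (K := K) h2 (evalUnit ω a : K)
    have h0 : e ≠ 0 := by
      rintro rfl
      exact (evalUnit ω a).ne_zero (by rw [← he]; simp)
    exact ⟨Units.mk0 e h0, Units.ext he⟩
  choose u hu using hs
  obtain ⟨ε, hε⟩ := exists_evalUnit_eq hsep u
  exact ⟨ε, ext_evalUnit hsep fun ω => by rw [map_pow, hε, hu]⟩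

/-- `γ` comes from the relation `ε ^ 2 = δ`, `N(ε) = n` between `Γ` and the units of `K ⊗ L`. An
element `ε` for which all `σ(ε) / ε` lie in `M` has `ε ^ 2` and `N(ε)` Galois invariant, hence belongs
to a pair in `Γ`. -/
theorem exists_isGamma (h2 : (2 : k) ≠ 0) (hsep : f.Separable) (hΩ : Nonempty (f.rootSet K)) :
    ∃ γ : Gam f ⧸ (chi f).range ≃* H1 Gal(K/k) (MGrp f K), IsGamma γ := by
  have := IsSepClosure.sep_closed k (K := K)
  let R : Subgroup (Gam f × (EtAlgSep f K)ˣ) :=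
    { carrier := {p | IsRootOf p.1 p.2}
      one_mem' := ⟨by simp, by simp⟩
      mul_mem' := by
        rintro p q ⟨hp, hp'⟩ ⟨hq, hq'⟩
        refine ⟨?_, ?_⟩
        · rw [Prod.snd_mul, mul_pow, hp, hq, ← map_mul]; rfl
        · rw [Prod.snd_mul, Units.val_mul, map_mul, hp', hq', ← map_mul]; rfl
      inv_mem' := by
        rintro p ⟨hp, hp'⟩
        refine ⟨?_, ?_⟩
        · rw [Prod.snd_inv, inv_pow, hp, ← map_inv]; rfl
        · have h1 : Algebra.norm K ((p.2⁻¹ : (EtAlgSep f K)ˣ) : EtAlgSep f K) *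
              Algebra.norm K (p.2 : EtAlgSep f K) = 1 := by
            rw [← map_mul, Units.inv_mul, map_one]
          rw [Prod.snd_inv, eq_inv_of_mul_eq_one_left h1, hp', ← map_inv₀]
          refine congrArg _ ?_
          exact (Units.val_inv_eq_inv_val _).symm }
  have hR : ∀ x a, (x, a) ∈ R ↔ IsRootOf x a := fun _ _ => Iff.rfl
  have hR1 : ∀ a : (EtAlgSep f K)ˣ, (1, a) ∈ R ↔ a ∈ normOneMu2 f K := fun a => by
    rw [hR, mem_normOneMu2_iff, IsRootOf]
    simp
  refine exists_h1_equiv (V := normOneMu2 f K) (fun _ _ => rfl) isLocallyConstant_smul_units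
    (fun c => exists_smul_div_eq_etAlgSep hsep _ (c.2.1.comp Subtype.val)
      fun σ τ => congrArg Subtype.val (Z1.apply_mul c σ τ)) R _
    (exists_isRootOf h2 hsep hΩ) (fun a h => (hR1 a).mp h) ?_ ?_ (fun a h => (hR1 a).mpr h) ?_
  · rintro x a ⟨hx, hx'⟩ σ
    rw [mem_normOneMu2_iff, smul_div_pow, hx, smul_unitsIncl, norm_smul_div, hx',
      AlgEquiv.commutes, div_self', div_self]
    · exact ⟨rfl, rfl⟩
    · simp
  · intro a ha
    obtain ⟨δ, hδ⟩ := exists_eq_unitsIncl (a ^ 2) fun σ => by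
      rw [← div_eq_one, ← smul_div_pow, (mem_normOneMu2_iff.mp (ha σ)).1]
    have hN0 := (a.isUnit.map (Algebra.norm K)).ne_zero
    obtain ⟨n, hn⟩ := (InfiniteGalois.mem_range_algebraMap_iff_fixed (k := k)
        (Algebra.norm K (a : EtAlgSep f K))).mpr fun σ => by
      have h := (mem_normOneMu2_iff.mp (ha σ)).2
      rwa [norm_smul_div, div_eq_one_iff_eq hN0] at h
    have hn0 : n ≠ 0 := by
      rintro rfl
      exact hN0 (by rw [← hn, map_zero])
    refine ⟨⟨(δ, Units.mk0 n hn0), Units.ext (FaithfulSMul.algebraMap_injective k K ?_)⟩, hδ,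
      hn.symm⟩
    refine (norm_one_tmul hsep _).symm.trans ?_
    change Algebra.norm K ((unitsIncl δ : (EtAlgSep f K)ˣ) : EtAlgSep f K) = _
    rw [← hδ, Units.val_pow_eq_pow_val, map_pow, ← hn, ← map_pow]
    rfl
  · intro x
    constructor
    · rintro ⟨l, rfl⟩
      exact ⟨unitsIncl l, fun σ => smul_unitsIncl σ l, (map_pow _ _ _).symm, norm_one_tmul hsep _⟩
    · rintro ⟨a, ha, hxa, hxa'⟩
      obtain ⟨l, rfl⟩ := exists_eq_unitsIncl a ha
      refine ⟨l, Subtype.ext (Prod.ext (eq_pow_two_of_unitsIncl hxa) (Units.ext ?_))⟩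
      refine FaithfulSMul.algebraMap_injective k K (Eq.trans ?_ hxa')
      exact (norm_one_tmul hsep _).symm

theorem exists_isKummer (h2 : (2 : k) ≠ 0) (hsep : f.Separable) :
    ∃ θ : H1 Gal(K/k) (Mu2 f K) ≃* SqClasses f, IsKummer θ := by
  have := IsSepClosure.sep_closed k (K := K)
  let R : Subgroup ((EtAlg f)ˣ × (EtAlgSep f K)ˣ) :=
    { carrier := {p | p.2 ^ 2 = unitsIncl p.1}
      one_mem' := by simp
      mul_mem' := by
        intro p q (hp : _ = _) (hq : _ = _)
        change _ = _
        rw [Prod.snd_mul, mul_pow, hp, hq, ← map_mul]; rfl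
      inv_mem' := by
        intro p (hp : _ = _)
        change _ = _
        rw [Prod.snd_inv, inv_pow, hp, ← map_inv]; rfl }
  have hR : ∀ x a, (x, a) ∈ R ↔ a ^ 2 = unitsIncl x := fun _ _ => Iff.rfl
  have hR1 : ∀ a : (EtAlgSep f K)ˣ, (1, a) ∈ R ↔ a ∈ rootsOfUnity 2 (EtAlgSep f K) := fun a => by
    rw [hR, mem_rootsOfUnity, map_one]
  have hRV : ∀ x a, (x, a) ∈ R → ∀ σ : Gal(K/k), σ • a / a ∈ rootsOfUnity 2 (EtAlgSep f K) := by
    intro x a hx σ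
    rw [mem_rootsOfUnity, smul_div_pow, (hR _ _).mp hx, smul_unitsIncl, div_self']
  have hVR : ∀ a : (EtAlgSep f K)ˣ,
      (∀ σ : Gal(K/k), σ • a / a ∈ rootsOfUnity 2 (EtAlgSep f K)) → ∃ x, (x, a) ∈ R := by
    intro a ha
    obtain ⟨δ, hδ⟩ := exists_eq_unitsIncl (a ^ 2) fun σ => by
      rw [← div_eq_one, ← smul_div_pow, (mem_rootsOfUnity _ _).mp (ha σ)]
    exact ⟨δ, hδ⟩
  have hY : ∀ x, x ∈ (powMonoidHom 2 : (EtAlg f)ˣ →* (EtAlg f)ˣ).range ↔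
      ∃ a, (∀ σ : Gal(K/k), σ • a = a) ∧ (x, a) ∈ R := by
    intro x
    constructor
    · rintro ⟨l, rfl⟩
      exact ⟨unitsIncl l, fun σ => smul_unitsIncl σ l, (map_pow _ _ _).symm⟩
    · rintro ⟨a, ha, hxa⟩
      obtain ⟨l, rfl⟩ := exists_eq_unitsIncl a ha
      exact ⟨l, eq_pow_two_of_unitsIncl hxa⟩
  obtain ⟨θ, hθ⟩ := exists_h1_equiv (V := rootsOfUnity 2 (EtAlgSep f K)) (G := Gal(K/k))
    (fun _ _ => rfl) isLocallyConstant_smul_units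
    (fun c => exists_smul_div_eq_etAlgSep hsep _ (c.2.1.comp Subtype.val)
      fun σ τ => congrArg Subtype.val (Z1.apply_mul c σ τ)) R
    (powMonoidHom 2 : (EtAlg f)ˣ →* (EtAlg f)ˣ).range
    (fun x => exists_sq_eq_unit h2 hsep (unitsIncl x)) (fun a h => (hR1 a).mp h) hRV hVR
    (fun a h => (hR1 a).mpr h) hY
  refine ⟨θ.symm, fun δ ε h => ?_⟩
  obtain ⟨c, hc, hθc⟩ := hθ δ ε h
  exact ⟨c, hc, by rw [← hθc, MulEquiv.symm_apply_apply]⟩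

theorem isGamma_unique (h2 : (2 : k) ≠ 0) (hsep : f.Separable) (hΩ : Nonempty (f.rootSet K))
    {γ γ' : Gam f ⧸ (chi f).range ≃* H1 Gal(K/k) (MGrp f K)} (hγ : IsGamma γ)
    (hγ' : IsGamma γ') : γ' = γ := by
  ext x
  induction x using QuotientGroup.induction_on with
  | H x =>
    obtain ⟨ε, hε⟩ := exists_isRootOf (K := K) h2 hsep hΩ x
    obtain ⟨c, hc, h⟩ := hγ x ε hε
    obtain ⟨c', hc', h'⟩ := hγ' x ε hε
    rw [h, h']
    rw [Z1.ext_coe fun σ => (hc' σ).trans (hc σ).symm]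

theorem isKummer_unique (h2 : (2 : k) ≠ 0) (hsep : f.Separable)
    {θ θ' : H1 Gal(K/k) (Mu2 f K) ≃* SqClasses f} (hθ : IsKummer θ) (hθ' : IsKummer θ') :
    θ' = θ := by
  refine MulEquiv.symm_bijective.injective (MulEquiv.ext fun x => ?_)
  induction x using QuotientGroup.induction_on with
  | H δ =>
    obtain ⟨ε, hε⟩ := exists_sq_eq_unit h2 hsep (unitsIncl (K := K) δ)
    obtain ⟨c, hc, h⟩ := hθ δ ε hε
    obtain ⟨c', hc', h'⟩ := hθ' δ ε hε
    rw [← h, MulEquiv.symm_apply_apply, h, ← h', MulEquiv.symm_apply_apply]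
    rw [Z1.ext_coe fun σ => (hc' σ).trans (hc σ).symm]

theorem kummer_map_gamma (h2 : (2 : k) ≠ 0) (hsep : f.Separable) (hΩ : Nonempty (f.rootSet K))
    {γ : Gam f ⧸ (chi f).range ≃* H1 Gal(K/k) (MGrp f K)} (hγ : IsGamma γ)
    {θ : H1 Gal(K/k) (Mu2 f K) ≃* SqClasses f} (hθ : IsKummer θ) (x : Gam f) :
    θ (H1.map (mToMu2 f K) (γ (QuotientGroup.mk x))) =
      QuotientGroup.mk (x : (EtAlg f)ˣ × kˣ).1 := by
  obtain ⟨ε, hε⟩ := exists_isRootOf (K := K) h2 hsep hΩ x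
  obtain ⟨c, hc, h⟩ := hγ x ε hε
  obtain ⟨d, hd, h'⟩ := hθ _ ε hε.1
  have hcd : Z1.map (mToMu2 f K) c = d := Z1.ext_coe fun σ => (hc σ).trans (hd σ).symm
  rw [h, ← h', H1.map_mk, hcd]

end Kummer

/-! ### Sign vectors: the groups `M` and `μ₂(L_K)` -/

section Signs

variable {k : Type*} [Field k] {f : k[X]} {K : Type*} [Field K] [Algebra k K]

/-- The inclusion `Kˣ → (K ⊗ L)ˣ`. -/
abbrev constUnit : Kˣ →* (EtAlgSep f K)ˣ :=
  Units.map (algebraMap K (EtAlgSep f K)).toMonoidHom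

theorem evalUnit_constUnit (ω : f.rootSet K) (c : Kˣ) : evalUnit ω (constUnit c) = c :=
  Units.ext ((evalRoot f K ω).commutes (c : K))

theorem eq_one_or_eq_neg_one {u : Kˣ} (h : u ^ 2 = 1) : u = 1 ∨ u = -1 := by
  have h1 : (u : K) ^ 2 = 1 := congrArg Units.val h
  rw [← one_pow 2, sq_eq_sq_iff_eq_or_eq_neg] at h1
  exact h1.imp (fun h => Units.ext h) fun h => Units.ext h

theorem evalUnit_eq_of_sq_eq_one {a : (EtAlgSep f K)ˣ} (h : a ^ 2 = 1) (ω : f.rootSet K) :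
    evalUnit ω a = 1 ∨ evalUnit ω a = -1 :=
  eq_one_or_eq_neg_one (by rw [← map_pow, h, map_one])

theorem units_neg_one_ne_one (h2 : (2 : K) ≠ 0) : (-1 : Kˣ) ≠ 1 := by
  intro h
  have h1 : (-1 : K) = 1 := congrArg Units.val h
  exact h2 (by linear_combination -h1)

theorem evalUnit_mGrp (m : MGrp f K) (ω : f.rootSet K) :
    evalUnit ω (m : (EtAlgSep f K)ˣ) = 1 ∨ evalUnit ω (m : (EtAlgSep f K)ˣ) = -1 :=
  evalUnit_eq_of_sq_eq_one (mem_normOneMu2_iff.mp m.2).1 ω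

/-- The roots at which the sign vector `m` is negative. -/
def negRoots (m : MGrp f K) : Finset (f.rootSet K) :=
  open Classical in Finset.univ.filter fun ω => evalUnit ω (m : (EtAlgSep f K)ˣ) = -1

theorem mem_negRoots {m : MGrp f K} {ω : f.rootSet K} :
    ω ∈ negRoots m ↔ evalUnit ω (m : (EtAlgSep f K)ˣ) = -1 := by
  simp [negRoots]

theorem isAlpha_iff {ω₁ ω₂ : f.rootSet K} {α : MGrp f K} : IsAlpha ω₁ ω₂ α ↔
    ∀ ω : f.rootSet K,
      ((ω = ω₁ ∨ ω = ω₂) → evalUnit ω (α : (EtAlgSep f K)ˣ) = -1) ∧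
      (¬ (ω = ω₁ ∨ ω = ω₂) → evalUnit ω (α : (EtAlgSep f K)ˣ) = 1) := by
  refine forall_congr' fun ω => and_congr (imp_congr_right fun _ => ?_)
    (imp_congr_right fun _ => ?_)
  · exact ⟨fun h => Units.ext h, fun h => congrArg Units.val h⟩
  · exact ⟨fun h => Units.ext h, fun h => congrArg Units.val h⟩

theorem prod_evalUnit_eq_pow_card {a : (EtAlgSep f K)ˣ} {S : Finset (f.rootSet K)}
    (hS : ∀ ω ∈ S, evalUnit ω a = -1) (hS' : ∀ ω ∉ S, evalUnit ω a = 1) :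
    ∏ ω, evalUnit ω a = (-1) ^ S.card := by
  classical
  rw [← Finset.prod_subset (Finset.subset_univ S) fun ω _ h => hS' ω h, Finset.prod_congr rfl hS,
    Finset.prod_const]

variable [IsSepClosed K] (hsep : f.Separable)
include hsep

theorem mem_normOneMu2_iff_prod {a : (EtAlgSep f K)ˣ} :
    a ∈ normOneMu2 f K ↔ a ^ 2 = 1 ∧ ∏ ω, evalUnit ω a = 1 := by
  rw [mem_normOneMu2_iff, norm_eq_prod hsep]
  refine and_congr_right fun _ => ?_
  rw [Units.ext_iff, Units.coe_prod]
  rfl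

theorem exists_mGrp {S : Finset (f.rootSet K)} (hS : Even S.card) :
    ∃ m : MGrp f K, (∀ ω ∈ S, evalUnit ω (m : (EtAlgSep f K)ˣ) = -1) ∧
      ∀ ω ∉ S, evalUnit ω (m : (EtAlgSep f K)ˣ) = 1 := by
  classical
  obtain ⟨a, ha⟩ := exists_evalUnit_eq hsep (fun ω => if ω ∈ S then (-1 : Kˣ) else 1)
  have h1 : ∀ ω ∈ S, evalUnit ω a = -1 := fun ω hω => by rw [ha, if_pos hω]
  have h2 : ∀ ω ∉ S, evalUnit ω a = 1 := fun ω hω => by rw [ha, if_neg hω]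
  refine ⟨⟨a, (mem_normOneMu2_iff_prod hsep).mpr ⟨ext_evalUnit hsep fun ω => ?_, ?_⟩⟩, h1, h2⟩
  · rw [map_pow, ha, map_one]
    split_ifs <;> simp
  · rw [prod_evalUnit_eq_pow_card h1 h2, hS.neg_one_pow]

theorem exists_isAlpha {ω₁ ω₂ : f.rootSet K} (h : ω₁ ≠ ω₂) :
    ∃ α : MGrp f K, IsAlpha ω₁ ω₂ α := by
  classical
  obtain ⟨m, hm, hm'⟩ := exists_mGrp hsep (S := {ω₁, ω₂}) (by rw [Finset.card_pair h]; decide)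
  exact ⟨m, isAlpha_iff.mpr fun ω => ⟨fun h => hm ω (by simpa using h), fun h => hm' ω (by simpa using h)⟩⟩

theorem even_card_negRoots (h2 : (2 : K) ≠ 0) (m : MGrp f K) : Even (negRoots m).card := by
  have h := ((mem_normOneMu2_iff_prod hsep).mp m.2).2
  rw [prod_evalUnit_eq_pow_card (S := negRoots m) (fun ω hω => mem_negRoots.mp hω)
    fun ω hω => (evalUnit_mGrp m ω).resolve_right fun h => hω (mem_negRoots.mpr h)] at h
  by_contra hodd
  rw [(Nat.not_even_iff_odd.mp hodd).neg_one_pow] at h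
  exact units_neg_one_ne_one h2 h

/-- An element of `M` is determined by all of its signs but one. -/
theorem ext_mGrp (ω₀ : f.rootSet K) {m m' : MGrp f K} (h : ∀ ω, ω ≠ ω₀ →
    evalUnit ω (m : (EtAlgSep f K)ˣ) = evalUnit ω (m' : (EtAlgSep f K)ˣ)) : m = m' := by
  classical
  refine Subtype.ext (ext_evalUnit hsep fun ω => ?_)
  by_cases hω : ω = ω₀
  · subst hω
    have h1 := ((mem_normOneMu2_iff_prod hsep).mp m.2).2
    have h2 := ((mem_normOneMu2_iff_prod hsep).mp m'.2).2
    rw [← Finset.mul_prod_erase _ _ (Finset.mem_univ ω)] at h1 h2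
    rw [Finset.prod_congr rfl fun ω' hω' => h ω' (Finset.ne_of_mem_erase hω'), ← h2] at h1
    exact mul_right_cancel h1
  · exact h ω hω

/-- The elements `α_{ω₁,ω₂}` generate `M`. -/
theorem mGrp_hom_ext [Nonempty (f.rootSet K)] {B : Type*} [CommGroup B] {h h' : MGrp f K →* B}
    (hh : ∀ ω₁ ω₂ : f.rootSet K, ω₁ ≠ ω₂ → ∀ α : MGrp f K, IsAlpha ω₁ ω₂ α → h α = h' α) :
    h = h' := by
  classical
  obtain ⟨ω₀⟩ := ‹Nonempty (f.rootSet K)›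
  have hα : ∀ ω : f.rootSet K, ∃ α : MGrp f K, ω ≠ ω₀ → IsAlpha ω ω₀ α := fun ω => by
    by_cases h : ω = ω₀
    · exact ⟨1, fun h' => absurd h h'⟩
    · obtain ⟨α, hα⟩ := exists_isAlpha hsep h
      exact ⟨α, fun _ => hα⟩
  choose α hα using hα
  ext m
  have hm : m = ∏ ω ∈ (negRoots m).erase ω₀, α ω := by
    refine ext_mGrp hsep ω₀ fun ω hω => ?_
    have h1 : ∀ ω' ∈ (negRoots m).erase ω₀,
        evalUnit ω (α ω' : (EtAlgSep f K)ˣ) = if ω = ω' then -1 else 1 := fun ω' hω' => by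
      have h2 := isAlpha_iff.mp (hα ω' (Finset.ne_of_mem_erase hω')) ω
      split_ifs with h3
      · exact h2.1 (Or.inl h3)
      · exact h2.2 (not_or.mpr ⟨h3, hω⟩)
    rw [Subgroup.val_finsetProd, map_prod, Finset.prod_congr rfl h1, Finset.prod_ite_eq]
    split_ifs with h3
    · exact mem_negRoots.mp (Finset.mem_of_mem_erase h3)
    · exact (evalUnit_mGrp m ω).resolve_right fun h =>
        h3 (Finset.mem_erase.mpr ⟨hω, mem_negRoots.mpr h⟩)
  rw [hm, map_prod, map_prod]
  exact Finset.prod_congr rfl fun ω hω => by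
    have h0 := Finset.ne_of_mem_erase hω
    exact hh ω ω₀ h0 _ (hα ω h0)

end Signs

/-! ### The 2-torsion of the Jacobian -/

section Torsion

variable {k : Type*} [Field k] {f : k[X]} {K : Type*} [Field K] [Algebra k K]

theorem IsWeierstrassFamily.smul {w : f.rootSet K → Place f K} (hw : IsWeierstrassFamily w)
    (σ : Gal(K/k)) (ω : f.rootSet K) : σ • w ω = w (σ • ω) := by
  rw [← hw (σ • ω), Place.smul_val]
  have h : σ⁻¹ • (coordX f K - algebraMap K _ ((σ • ω : f.rootSet K) : K)) =
      coordX f K - algebraMap K _ (ω : K) := by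
    rw [smul_sub, coordX, TensorProduct.smul_tmul', smul_one,
      Algebra.TensorProduct.algebraMap_apply, TensorProduct.smul_tmul']
    simp [Algebra.TensorProduct.algebraMap_apply]
  rw [h]
  exact (hw ω _).mpr rfl

theorem smul_diffClass (σ : Gal(K/k)) (p q : Place f K) :
    σ • diffClass p q = diffClass (σ • p) (σ • q) := by
  change divClass f K (divAct σ _) = _
  rw [map_sub, diffClass]
  simp [divAct]

theorem diffClass_sub (p q r : Place f K) : diffClass p r - diffClass q r = diffClass p q := by
  simp only [diffClass, ← map_sub]
  congr 1
  abel

theorem divClass_eq_zero {D : CurveDiv f K} : divClass f K D = 0 ↔ D ∈ principalDiv f K :=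
  QuotientAddGroup.eq_zero_iff D

theorem divClass_surjective : Function.Surjective (divClass f K) :=
  QuotientAddGroup.mk'_surjective _

theorem jTwo_mul_self (p : JTwo f K) : p * p = 1 := by
  refine Subtype.ext ?_
  have h : 2 • (p.toAdd : CurvePic f K) = 0 := p.toAdd.2.2
  rwa [two_nsmul] at h

/-- The classes `x ω = [(ω, 0) - (ω₀, 0)]` in `J[2]`, together with all relations
between them. -/
structure IsTorsionFrame (w : f.rootSet K → Place f K) (ω₀ : f.rootSet K)
    (x : f.rootSet K → JTwo f K) : Prop where
  coe : ∀ ω, (((x ω).toAdd : jacobianTwoTorsion f K) : CurvePic f K) = diffClass (w ω) (w ω₀)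
  prod_univ : ∏ ω, x ω = 1
  eq_empty_or : ∀ S : Finset (f.rootSet K), ω₀ ∉ S → ∏ ω ∈ S, x ω = 1 →
    S = ∅ ∨ ∀ ω, ω ≠ ω₀ → ω ∈ S
  exists_prod : ∀ p, ∃ S : Finset (f.rootSet K), ω₀ ∉ S ∧ p = ∏ ω ∈ S, x ω
  smul : ∀ (σ : Gal(K/k)) ω, σ • x ω = x (σ • ω) * x (σ • ω₀)

theorem coe_prod_jTwo (S : Finset (f.rootSet K)) (x : f.rootSet K → JTwo f K) :
    (((∏ ω ∈ S, x ω).toAdd : jacobianTwoTorsion f K) : CurvePic f K) =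
      ∑ ω ∈ S, (((x ω).toAdd : jacobianTwoTorsion f K) : CurvePic f K) := by
  rw [toAdd_prod, AddSubgroup.val_finsetSum]

theorem IsWeierstrassFamily.exists_isTorsionFrame [IsSepClosure k K] (h2 : (2 : k) ≠ 0)
    (hdeg : f.natDegree = 6) (hsep : f.Separable) {w : f.rootSet K → Place f K}
    (hw : IsWeierstrassFamily w) (ω₀ : f.rootSet K) :
    ∃ x : f.rootSet K → JTwo f K, IsTorsionFrame w ω₀ x := by
  classical
  have hmem : ∀ ω, diffClass (w ω) (w ω₀) ∈ jacobianTwoTorsion f K := fun ω => by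
    refine ⟨⟨_, ?_, rfl⟩, ?_⟩
    · change CurveDiv.degree f K _ = 0
      rw [map_sub]
      simp [CurveDiv.degree, hw.degree_eq_one hdeg hsep]
    · change 2 • diffClass (w ω) (w ω₀) = 0
      rw [diffClass, ← map_nsmul, divClass_eq_zero, ← natCast_zsmul]
      exact hw.two_zsmul_mem h2 hdeg hsep ω ω₀
  let x : f.rootSet K → JTwo f K := fun ω => Multiplicative.ofAdd ⟨_, hmem ω⟩
  have hcoe : ∀ ω, (((x ω).toAdd : jacobianTwoTorsion f K) : CurvePic f K) =
      diffClass (w ω) (w ω₀) := fun _ => rfl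
  have hsum : ∀ S : Finset (f.rootSet K),
      (((∏ ω ∈ S, x ω).toAdd : jacobianTwoTorsion f K) : CurvePic f K) =
        divClass f K (∑ ω ∈ S, (Finsupp.single (w ω) (1 : ℤ) - Finsupp.single (w ω₀) 1)) :=
    fun S => by rw [coe_prod_jTwo, map_sum]; rfl
  have hinj : ∀ p q : JTwo f K, (p.toAdd : CurvePic f K) = q.toAdd → p = q := fun p q h =>
    Subtype.ext h
  refine ⟨x, hcoe, ?_, ?_, ?_, ?_⟩
  · refine hinj _ _ ?_
    rw [hsum, divClass_eq_zero.mpr (hw.sum_univ_mem h2 hdeg hsep ω₀)]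
    rfl
  · intro S hS h
    have h1 := hsum S
    rw [h] at h1
    refine (hw.eq_empty_or_eq_of_sum_mem h2 hdeg hsep hS (divClass_eq_zero.mp h1.symm)).imp_right ?_
    rintro rfl ω hω
    exact Finset.mem_erase.mpr ⟨hω, Finset.mem_univ ω⟩
  · intro p
    obtain ⟨D, hD⟩ := divClass_surjective (p.toAdd : CurvePic f K)
    have hD2 : 2 • D ∈ principalDiv f K := by
      rw [← divClass_eq_zero, map_nsmul, hD]
      exact p.toAdd.2.2
    obtain ⟨S, hS, h⟩ := hw.exists_sub_sum_mem h2 hdeg hsep ω₀ hD2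
    refine ⟨S, hS, hinj _ _ ?_⟩
    rw [hsum, ← hD, ← sub_eq_zero, ← map_sub, divClass_eq_zero]
    exact h
  · intro σ ω
    refine hinj _ _ ?_
    rw [eq_inv_of_mul_eq_one_left (jTwo_mul_self (x (σ • ω₀))), ← div_eq_mul_inv]
    change σ • diffClass (w ω) (w ω₀) = diffClass _ _ - diffClass _ _
    rw [diffClass_sub, smul_diffClass, hw.smul, hw.smul]

end Torsion

/-! ### The homomorphisms `β` and `ϵ` -/

section BetaEpsilon

variable {k : Type*} [Field k] {f : k[X]} {K : Type*} [Field K] [Algebra k K]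

theorem constUnit_mem_normOneMu2 [IsSepClosed K] (hsep : f.Separable) (hdeg : f.natDegree = 6)
    {c : Kˣ} (hc : c ^ 2 = 1) : (constUnit c : (EtAlgSep f K)ˣ) ∈ normOneMu2 f K := by
  refine (mem_normOneMu2_iff_prod hsep).mpr ⟨by rw [← map_pow, hc, map_one], ?_⟩
  simp only [evalUnit_constUnit]
  rw [Finset.prod_const, Finset.card_univ, card_rootSet hsep, hdeg, show 6 = 2 * 3 from rfl, pow_mul,
    hc, one_pow]

theorem mem_constMu2_iff {a : Mu2 f K} :
    a ∈ constMu2 f K ↔ ∃ c : Kˣ, c ^ 2 = 1 ∧ constUnit c = (a : (EtAlgSep f K)ˣ) := by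
  constructor
  · rintro ⟨c, rfl⟩
    exact ⟨c, (mem_rootsOfUnity _ _).mp c.2, rfl⟩
  · rintro ⟨c, hc, h⟩
    exact ⟨⟨c, (mem_rootsOfUnity _ _).mpr hc⟩, Subtype.ext h⟩

theorem mu2ToQuot_eq_one_iff {a : Mu2 f K} :
    mu2ToQuot f K a = 1 ↔ ∃ c : Kˣ, c ^ 2 = 1 ∧ constUnit c = (a : (EtAlgSep f K)ˣ) :=
  (QuotientGroup.eq_one_iff a).trans mem_constMu2_iff

theorem map_map_eq {β : MGrp f K →*[Gal(K/k)] JTwo f K} {e : JTwo f K →*[Gal(K/k)] Mu2Quot f K}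
    (heβ : ∀ m, e (β m) = mu2ToQuot f K (mToMu2 f K m)) (η : H1 Gal(K/k) (MGrp f K)) :
    H1.map e (H1.map β η) = H1.map (mu2ToQuot f K) (H1.map (mToMu2 f K) η) := by
  obtain ⟨m, rfl⟩ := H1.mk_surjective η
  exact congrArg H1.mk (Z1.ext fun σ => heβ _)

theorem negRoots_smul (σ : Gal(K/k)) (m : MGrp f K) :
    negRoots (σ • m) = (negRoots m).map (MulAction.toPerm σ).toEmbedding := by
  ext ω
  rw [Finset.mem_map_equiv, mem_negRoots, mem_negRoots]
  change evalUnit ω (σ • (m : (EtAlgSep f K)ˣ)) = -1 ↔ evalUnit (σ⁻¹ • ω) _ = -1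
  have h : Units.map (σ : K →* K) (-1) = -1 := Units.ext (by simp)
  rw [evalUnit_smul']
  conv_lhs => rw [← h]
  exact (Units.map_injective (f := (σ : K →* K)) (AlgEquiv.injective σ)).eq_iff

/-- The homomorphism `m ↦ ∏ x ω`, the product over the roots at which `m` is negative. -/
theorem exists_prod_negRoots_hom (x : f.rootSet K → JTwo f K) (h2 : (2 : K) ≠ 0) :
    ∃ β : MGrp f K →* JTwo f K, ∀ m, β m = ∏ ω ∈ negRoots m, x ω := by
  classical
  refine ⟨MonoidHom.mk' (fun m => ∏ ω ∈ negRoots m, x ω) fun m m' => ?_, fun m => rfl⟩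
  have h : ∀ m : MGrp f K, ∏ ω ∈ negRoots m, x ω =
      ∏ ω, if evalUnit ω (m : (EtAlgSep f K)ˣ) = -1 then x ω else 1 := fun m => by
    rw [Finset.prod_ite, Finset.prod_const_one, mul_one]
    refine Finset.prod_congr ?_ fun _ _ => rfl
    ext ω
    simp [mem_negRoots]
  rw [h, h, h, ← Finset.prod_mul_distrib]
  refine Finset.prod_congr rfl fun ω _ => ?_
  have h1 := (units_neg_one_ne_one h2).symm
  rw [Subgroup.coe_mul, map_mul]
  rcases evalUnit_mGrp m ω with h | h <;> rcases evalUnit_mGrp m' ω with h' | h' <;>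
    simp [h, h', h1, jTwo_mul_self]

namespace IsTorsionFrame

variable {w : f.rootSet K → Place f K} {ω₀ : f.rootSet K} {x : f.rootSet K → JTwo f K}
  (hx : IsTorsionFrame w ω₀ x)
include hx

theorem base : x ω₀ = 1 := by
  refine Subtype.ext ((hx.coe ω₀).trans ?_)
  rw [diffClass, sub_self, map_zero]
  rfl

theorem coe_mul (ω₁ ω₂ : f.rootSet K) :
    (((x ω₁ * x ω₂).toAdd : jacobianTwoTorsion f K) : CurvePic f K) = diffClass (w ω₁) (w ω₂) := by
  rw [eq_inv_of_mul_eq_one_left (jTwo_mul_self (x ω₂)), ← div_eq_mul_inv,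
    ← diffClass_sub _ _ (w ω₀), ← hx.coe, ← hx.coe]
  rfl

theorem prod_erase [DecidableEq (f.rootSet K)] (S : Finset (f.rootSet K)) :
    ∏ ω ∈ S.erase ω₀, x ω = ∏ ω ∈ S, x ω := Finset.prod_erase S hx.base

variable {β : MGrp f K →* JTwo f K} (hβ : ∀ m, β m = ∏ ω ∈ negRoots m, x ω)
include hβ

theorem isBeta (h2 : (2 : K) ≠ 0) : IsBeta w β := by
  classical
  intro ω₁ ω₂ hne α hα
  rw [isAlpha_iff] at hα
  have : negRoots α = {ω₁, ω₂} := by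
    ext ω
    rw [mem_negRoots, Finset.mem_insert, Finset.mem_singleton]
    refine ⟨fun h => ?_, (hα ω).1⟩
    by_contra h'
    exact units_neg_one_ne_one h2 (h.symm.trans ((hα ω).2 h'))
  rw [hβ, this, Finset.prod_pair hne, hx.coe_mul]

variable [IsSepClosed K] (h2 : (2 : K) ≠ 0) (hsep : f.Separable)
include h2 hsep

theorem beta_smul (σ : Gal(K/k)) (m : MGrp f K) : β (σ • m) = σ • β m := by
  rw [hβ, hβ, negRoots_smul, Finset.prod_map, Finset.smul_prod', Finset.prod_congr rfl
    (fun ω _ => hx.smul σ ω), Finset.prod_mul_distrib, Finset.prod_const]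
  obtain ⟨n, hn⟩ := even_card_negRoots hsep h2 m
  rw [hn, ← two_mul, pow_mul, pow_two, jTwo_mul_self, one_pow, mul_one]
  rfl

theorem beta_surjective : Function.Surjective β := by
  classical
  intro p
  obtain ⟨S, hS, rfl⟩ := hx.exists_prod p
  have hneg : ∀ (S : Finset (f.rootSet K)) (m : MGrp f K),
      (∀ ω ∈ S, evalUnit ω (m : (EtAlgSep f K)ˣ) = -1) →
      (∀ ω ∉ S, evalUnit ω (m : (EtAlgSep f K)ˣ) = 1) → negRoots m = S := by
    intro S m hm hm'
    ext ω
    rw [mem_negRoots]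
    refine ⟨fun h => ?_, hm ω⟩
    by_contra h'
    exact units_neg_one_ne_one h2 (h.symm.trans (hm' ω h'))
  rcases Nat.even_or_odd S.card with h | h
  · obtain ⟨m, hm, hm'⟩ := exists_mGrp hsep h
    exact ⟨m, by rw [hβ, hneg S m hm hm']⟩
  · obtain ⟨m, hm, hm'⟩ := exists_mGrp hsep (S := insert ω₀ S) (by
      rw [Finset.card_insert_of_notMem hS]
      exact h.add_one)
    exact ⟨m, by rw [hβ, hneg _ m hm hm', Finset.prod_insert hS, hx.base, one_mul]⟩

theorem beta_eq_one_iff (hdeg : f.natDegree = 6) {m : MGrp f K} :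
    β m = 1 ↔ ∃ c : Kˣ, c ^ 2 = 1 ∧ constUnit c = (m : (EtAlgSep f K)ˣ) := by
  classical
  constructor
  · intro h
    have heven := even_card_negRoots hsep h2 m
    rw [hβ, ← hx.prod_erase] at h
    rcases hx.eq_empty_or _ (Finset.notMem_erase _ _) h with h | h
    · refine ⟨1, one_pow 2, congrArg Subtype.val (ext_mGrp hsep ω₀ (m := 1) fun ω hω => ?_)⟩
      refine (((evalUnit_mGrp m ω).resolve_right fun h' => ?_).trans (map_one _).symm).symm
      have := Finset.mem_erase.mpr ⟨hω, mem_negRoots.mpr h'⟩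
      rw [h] at this
      exact Finset.notMem_empty _ this
    · refine ⟨-1, by simp, congrArg Subtype.val (ext_mGrp hsep ω₀
        (m := ⟨_, constUnit_mem_normOneMu2 hsep hdeg (c := -1) (by simp)⟩) fun ω hω => ?_)⟩
      rw [mem_negRoots.mp (Finset.mem_of_mem_erase (h ω hω))]
      exact evalUnit_constUnit ω (-1)
  · rintro ⟨c, hc, hcm⟩
    have hm : ∀ ω, evalUnit ω (m : (EtAlgSep f K)ˣ) = c := fun ω => by
      rw [← hcm, evalUnit_constUnit]
    rw [hβ]
    rcases eq_one_or_eq_neg_one hc with rfl | rfl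
    · refine Finset.prod_eq_one fun ω hω => ?_
      exact absurd ((mem_negRoots.mp hω).symm.trans (hm ω)) (units_neg_one_ne_one h2)
    · rw [← hx.prod_univ]
      exact Finset.prod_congr (by ext ω; simp [mem_negRoots, hm]) fun _ _ => rfl

end IsTorsionFrame

variable [IsSepClosure k K]

/-- The homomorphism `β` exists, is equivariant and surjective, and its kernel is `μ₂(K)`. -/
theorem exists_beta (h2 : (2 : k) ≠ 0) (hdeg : f.natDegree = 6) (hsep : f.Separable)
    {w : f.rootSet K → Place f K} (hw : IsWeierstrassFamily w) [Nonempty (f.rootSet K)] :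
    ∃ β : MGrp f K →*[Gal(K/k)] JTwo f K, (∀ β' : MGrp f K →* JTwo f K, IsBeta w β' ↔ β' = β) ∧
      Function.Surjective β ∧
      ∀ m, β m = 1 ↔ ∃ c : Kˣ, c ^ 2 = 1 ∧ constUnit c = (m : (EtAlgSep f K)ˣ) := by
  have := IsSepClosure.sep_closed k (K := K)
  have h2' : (2 : K) ≠ 0 := by
    have := (_root_.map_ne_zero (algebraMap k K)).mpr h2
    rwa [map_ofNat] at this
  obtain ⟨ω₀⟩ := ‹Nonempty (f.rootSet K)›
  have hne : Nonempty (f.rootSet K) := ⟨ω₀⟩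
  obtain ⟨x, hx⟩ := hw.exists_isTorsionFrame h2 hdeg hsep ω₀
  obtain ⟨β, hβ⟩ := exists_prod_negRoots_hom x h2'
  refine ⟨{ β with map_smul' := hx.beta_smul hβ h2' hsep }, fun β' => ⟨fun h => ?_, ?_⟩,
    hx.beta_surjective hβ h2' hsep, fun m => hx.beta_eq_one_iff hβ h2' hsep hdeg⟩
  · refine mGrp_hom_ext hsep fun ω₁ ω₂ hne α hα => ?_
    exact Subtype.ext ((h ω₁ ω₂ hne α hα).trans (hx.isBeta hβ h2' ω₁ ω₂ hne α hα).symm)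
  · rintro rfl
    exact hx.isBeta hβ h2'

/-- The homomorphism `ϵ`: it exists, is equivariant and injective, and `ϵ ∘ β` is the natural
map. -/
theorem exists_epsilon (hsep : f.Separable)
    {w : f.rootSet K → Place f K} [Nonempty (f.rootSet K)] {β : MGrp f K →*[Gal(K/k)] JTwo f K}
    (hβ : IsBeta w (β : MGrp f K →* JTwo f K)) (hsurj : Function.Surjective β)
    (hker : ∀ m, β m = 1 ↔ ∃ c : Kˣ, c ^ 2 = 1 ∧ constUnit c = (m : (EtAlgSep f K)ˣ)) :
    ∃ e : JTwo f K →*[Gal(K/k)] Mu2Quot f K,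
      (∀ e' : JTwo f K →* Mu2Quot f K, IsEpsilon w e' ↔ e' = e) ∧
      Function.Injective e ∧ ∀ m, e (β m) = mu2ToQuot f K (mToMu2 f K m) := by
  have := IsSepClosure.sep_closed k (K := K)
  let q : MGrp f K →* Mu2Quot f K :=
    (mu2ToQuot f K : Mu2 f K →* Mu2Quot f K).comp (mToMu2 f K : MGrp f K →* Mu2 f K)
  have hq : ∀ m, q m = 1 ↔ β m = 1 := fun m => by
    rw [hker]
    exact mu2ToQuot_eq_one_iff
  let e : JTwo f K →* Mu2Quot f K :=
    (β : MGrp f K →* JTwo f K).liftOfSurjective hsurj ⟨q, fun m hm => (hq m).mpr hm⟩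
  have he : ∀ m, e (β m) = q m := fun m =>
    MonoidHom.liftOfRightInverse_comp_apply (β : MGrp f K →* JTwo f K) _ _ _ m
  have hsmul : ∀ (σ : Gal(K/k)) p, e (σ • p) = σ • e p := by
    intro σ p
    obtain ⟨m, rfl⟩ := hsurj p
    rw [← map_smul, he, he]
    rfl
  have hepsilon : IsEpsilon w e := by
    intro ω₁ ω₂ hne α hα p hp
    have : p = β α := Subtype.ext (hp.trans (hβ ω₁ ω₂ hne α hα).symm)
    rw [this, he]
    rfl
  refine ⟨{ e with map_smul' := hsmul }, fun e' => ⟨fun h => ?_, ?_⟩, ?_, he⟩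
  · have h1 : e'.comp (β : MGrp f K →* JTwo f K) = e.comp (β : MGrp f K →* JTwo f K) := by
      refine mGrp_hom_ext hsep fun ω₁ ω₂ hne α hα => ?_
      have h2 := hβ ω₁ ω₂ hne α hα
      exact (h ω₁ ω₂ hne α hα _ h2).trans (hepsilon ω₁ ω₂ hne α hα _ h2).symm
    exact (MonoidHom.cancel_right hsurj).mp h1
  · rintro rfl
    exact hepsilon
  · refine (injective_iff_map_eq_one e).mpr fun p hp => ?_
    obtain ⟨m, rfl⟩ := hsurj p
    rw [he] at hp
    exact (hq m).mp hp

end BetaEpsilon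

/-! ### The connecting homomorphism `Υ` -/

section Connecting

theorem isLocallyConstant_smul_comp {G A : Type*} [TopologicalSpace G] [SMul G A] {a : G → A}
    (ha : IsLocallyConstant a) (hloc : ∀ x : A, IsLocallyConstant fun g : G => g • x) :
    IsLocallyConstant fun p : G × G => p.1 • a p.2 := by
  rw [IsLocallyConstant.iff_eventually_eq]
  rintro ⟨g, h⟩
  filter_upwards [((IsLocallyConstant.iff_eventually_eq _).mp (hloc (a h)) g).prod_nhds
    ((IsLocallyConstant.iff_eventually_eq _).mp ha h)] with p hp
  rw [hp.2, hp.1]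

section Boundary

variable {G A : Type*} [Group G] [CommGroup A] [MulDistribMulAction G A]

/-- The coboundary of a 1-cochain. -/
def boundary (a : G → A) (p : G × G) : A := p.1 • a p.2 / a (p.1 * p.2) * a p.1

theorem boundary_cocycle (a : G → A) (g h j : G) :
    boundary a (g * h, j) * boundary a (g, h) = g • boundary a (h, j) * boundary a (g, h * j) := by
  simp only [boundary, smul_mul', smul_div', mul_smul, mul_assoc g h j]
  refine Additive.ofMul.injective ?_
  simp only [ofMul_mul, ofMul_div]
  abel

theorem boundary_mul (a b : G → A) (p : G × G) :
    boundary (fun g => a g * b g) p = boundary a p * boundary b p := by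
  simp only [boundary, smul_mul']
  refine Additive.ofMul.injective ?_
  simp only [ofMul_mul, ofMul_div]
  abel

theorem boundary_div (a b : G → A) (p : G × G) :
    boundary (fun g => a g / b g) p = boundary a p / boundary b p := by
  simp only [boundary, smul_div']
  refine Additive.ofMul.injective ?_
  simp only [ofMul_mul, ofMul_div]
  abel

theorem boundary_eq_one_iff {a : G → A} :
    (∀ p, boundary a p = 1) ↔ ∀ g h, a (g * h) = g • a h * a g := by
  rw [Prod.forall]
  refine forall_congr' fun g => forall_congr' fun h => ?_
  rw [boundary, div_mul_eq_mul_div, div_eq_one, eq_comm]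

theorem boundary_smul_div (x : A) (p : G × G) : boundary (fun g : G => g • x / x) p = 1 :=
  boundary_eq_one_iff.mpr (smul_div_mul x) p

theorem map_boundary {B : Type*} [CommGroup B] [MulDistribMulAction G B] (φ : A →* B)
    (hφ : ∀ (g : G) a, φ (g • a) = g • φ a) (a : G → A) (p : G × G) :
    φ (boundary a p) = boundary (fun g => φ (a g)) p := by
  simp only [boundary, map_mul, _root_.map_div, hφ]

theorem isLocallyConstant_boundary [TopologicalSpace G] [ContinuousMul G] {a : G → A}
    (ha : IsLocallyConstant a) (hloc : ∀ x : A, IsLocallyConstant fun g : G => g • x) :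
    IsLocallyConstant (boundary a) :=
  ((isLocallyConstant_smul_comp ha hloc).div (ha.comp_continuous continuous_mul)).mul
    (ha.comp_continuous continuous_fst)

theorem H2.mk_eq_mk_iff [TopologicalSpace G] {y z : Z2 G A} :
    H2.mk y = H2.mk z ↔ ∃ u : G → A, IsLocallyConstant u ∧
      ∀ p, (z : G × G → A) p = (y : G × G → A) p * boundary u p := by
  refine QuotientGroup.eq.trans (exists_congr fun u => and_congr_right fun _ => ?_)
  rw [Prod.forall]
  refine forall_congr' fun g => forall_congr' fun h => ?_
  rw [← inv_mul_eq_iff_eq_mul, eq_comm]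
  rfl

theorem Z2.ext [TopologicalSpace G] {y z : Z2 G A}
    (h : ∀ p, (y : G × G → A) p = (z : G × G → A) p) : y = z :=
  Subtype.ext (funext h)

end Boundary

variable {k : Type*} [Field k] {f : k[X]} {K : Type*} [Field K] [Algebra k K]

theorem constUnit_injective [Nonempty (f.rootSet K)] :
    Function.Injective (constUnit : Kˣ →* (EtAlgSep f K)ˣ) := fun c d h => by
  obtain ⟨ω⟩ := ‹Nonempty (f.rootSet K)›
  rw [← evalUnit_constUnit ω c, h, evalUnit_constUnit]

theorem constUnit_smul (σ : Gal(K/k)) (c : Kˣ) :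
    (constUnit (σ • c) : (EtAlgSep f K)ˣ) = σ • constUnit c := by
  refine Units.ext ?_
  change (σ (c : K)) ⊗ₜ[k] (1 : EtAlg f) = σ • ((c : K) ⊗ₜ[k] (1 : EtAlg f))
  rw [TensorProduct.smul_tmul']
  rfl

theorem isLocallyConstant_smul_mGrp [Algebra.IsAlgebraic k K] (m : MGrp f K) :
    IsLocallyConstant fun σ : Gal(K/k) => σ • m :=
  isLocallyConstant_of_comp_injective Subtype.val_injective
    (isLocallyConstant_smul_units (m : (EtAlgSep f K)ˣ))

theorem coe_boundary_mGrp (a : Gal(K/k) → MGrp f K) (p : Gal(K/k) × Gal(K/k)) :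
    ((boundary a p : MGrp f K) : (EtAlgSep f K)ˣ) =
      boundary (fun σ => (a σ : (EtAlgSep f K)ˣ)) p :=
  map_boundary (normOneMu2 f K).subtype (fun _ _ => rfl) a p

/-- The 2-cocycle `z` with values in `Kˣ`, embedded in `K ⊗ L` as constants, is the coboundary of the
1-cochain `a` with values in `M`. -/
def IsBoundary (a : Gal(K/k) → MGrp f K) (z : Z2 Gal(K/k) Kˣ) : Prop :=
  ∀ p, constUnit ((z : Gal(K/k) × Gal(K/k) → Kˣ) p) = ((boundary a p : MGrp f K) : (EtAlgSep f K)ˣ)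

theorem exists_lift {β : MGrp f K →*[Gal(K/k)] JTwo f K} (hsurj : Function.Surjective β)
    (c : Z1 Gal(K/k) (JTwo f K)) : ∃ a : Gal(K/k) → MGrp f K,
    IsLocallyConstant a ∧ ∀ σ, β (a σ) = (c : Gal(K/k) → JTwo f K) σ :=
  ⟨fun σ => Function.surjInv hsurj ((c : Gal(K/k) → JTwo f K) σ), c.2.1.comp (Function.surjInv hsurj),
    fun _ => Function.surjInv_eq hsurj _⟩

variable [Nonempty (f.rootSet K)]

theorem IsBoundary.eq {a : Gal(K/k) → MGrp f K} {z z' : Z2 Gal(K/k) Kˣ} (h : IsBoundary a z)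
    (h' : IsBoundary a z') : z = z' := by
  refine Z2.ext fun p => constUnit_injective (f := f) ?_
  rw [h p, h' p]

theorem IsBoundary.sq {a : Gal(K/k) → MGrp f K} {z : Z2 Gal(K/k) Kˣ} (h : IsBoundary a z)
    (p : Gal(K/k) × Gal(K/k)) : (z : Gal(K/k) × Gal(K/k) → Kˣ) p ^ 2 = 1 :=
  constUnit_injective (f := f) (by
    rw [map_pow, h p, map_one]
    exact (mem_normOneMu2_iff.mp (boundary a p).2).1)

theorem isConnecting_unique {β : MGrp f K →*[Gal(K/k)] JTwo f K} (hsurj : Function.Surjective β)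
    {U U' : H1 Gal(K/k) (JTwo f K) →* BrauerTwo k K}
    (hU : IsConnecting β U) (hU' : IsConnecting β U') : U' = U := by
  ext ξ
  obtain ⟨c, rfl⟩ := H1.mk_surjective ξ
  obtain ⟨a, ha, hac⟩ := exists_lift hsurj c
  obtain ⟨z, hz, -, h⟩ := hU c a ha hac
  obtain ⟨z', hz', -, h'⟩ := hU' c a ha hac
  have hzz : z = z' := IsBoundary.eq (a := a) (fun p => hz p.1 p.2) fun p => hz' p.1 p.2
  rw [h, h', hzz]

theorem connecting_map_eq_one {β : MGrp f K →*[Gal(K/k)] JTwo f K}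
    {U : H1 Gal(K/k) (JTwo f K) →* BrauerTwo k K} (hU : IsConnecting β U) (η : H1 Gal(K/k) (MGrp f K)) : U (H1.map β η) = 1 := by
  obtain ⟨m, rfl⟩ := H1.mk_surjective η
  obtain ⟨z, hz, -, hUz⟩ := hU (Z1.map β m) m m.2.1 fun σ => rfl
  refine Subtype.ext (hUz.trans ?_)
  have hz1 : z = 1 := Z2.ext fun p => constUnit_injective (f := f) (by
    refine (hz p.1 p.2).trans ?_
    have := boundary_eq_one_iff.mpr (Z1.apply_mul m) p
    exact (congrArg Subtype.val this).trans (map_one constUnit).symm)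
  rw [hz1, map_one]
  rfl

variable [Algebra.IsAlgebraic k K] {β : MGrp f K →*[Gal(K/k)] JTwo f K}
  (hsurj : Function.Surjective β)
  (hker : ∀ m, β m = 1 ↔ ∃ c : Kˣ, c ^ 2 = 1 ∧ constUnit c = (m : (EtAlgSep f K)ˣ))

include hker in
theorem exists_isBoundary (c : Z1 Gal(K/k) (JTwo f K)) {a : Gal(K/k) → MGrp f K}
    (ha : IsLocallyConstant a) (hac : ∀ σ, β (a σ) = (c : Gal(K/k) → JTwo f K) σ) :
    ∃ z : Z2 Gal(K/k) Kˣ, IsBoundary a z := by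
  have h1 : ∀ p, β (boundary a p) = 1 := fun p => by
    refine (map_boundary (β : MGrp f K →* JTwo f K) (fun σ m => map_smul β σ m) a p).trans ?_
    refine boundary_eq_one_iff.mpr (fun σ τ => ?_) p
    exact (hac _).trans ((Z1.apply_mul c σ τ).trans (by rw [← hac, ← hac]; rfl))
  choose z hz using fun p => (hker _).mp (h1 p)
  have hz' : ∀ p, (constUnit (z p) : (EtAlgSep f K)ˣ) = boundary (fun σ => (a σ : (EtAlgSep f K)ˣ)) p :=
    fun p => (hz p).2.trans (coe_boundary_mGrp a p)
  refine ⟨⟨z, ?_, fun g h j => constUnit_injective (f := f) ?_⟩, fun p => (hz p).2⟩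
  · refine isLocallyConstant_of_comp_injective (constUnit_injective (f := f)) ?_
    exact (funext fun p => (hz p).2.symm :
        (fun p => ((boundary a p : MGrp f K) : (EtAlgSep f K)ˣ)) = constUnit ∘ z) ▸
      (isLocallyConstant_boundary ha isLocallyConstant_smul_mGrp).comp Subtype.val
  · rw [map_mul, map_mul, constUnit_smul, hz', hz', hz', hz', boundary_cocycle]

include hsurj hker in
/-- The class of the coboundary depends neither on the lift nor on the cocycle in its class. -/
theorem mk_eq_mk_of_isBoundary {c c' : Z1 Gal(K/k) (JTwo f K)} (hcc : H1.mk c' = H1.mk c)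
    {a a' : Gal(K/k) → MGrp f K} (ha : IsLocallyConstant a) (ha' : IsLocallyConstant a')
    (hac : ∀ σ, β (a σ) = (c : Gal(K/k) → JTwo f K) σ)
    (hac' : ∀ σ, β (a' σ) = (c' : Gal(K/k) → JTwo f K) σ)
    {z z' : Z2 Gal(K/k) Kˣ} (hz : IsBoundary a z) (hz' : IsBoundary a' z') :
    H2.mk z = H2.mk z' := by
  obtain ⟨x, hx⟩ := H1.mk_eq_mk_iff.mp hcc
  obtain ⟨y, rfl⟩ := hsurj x
  have h1 : ∀ σ, β (a' σ / (a σ * (σ • y / y))) = 1 := fun σ => by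
    rw [_root_.map_div, map_mul, _root_.map_div, map_smul, hac, hac', hx, div_self']
  choose u hu using fun σ => (hker _).mp (h1 σ)
  have hu' : ∀ σ, (constUnit (u σ) : (EtAlgSep f K)ˣ) =
      (a' σ : (EtAlgSep f K)ˣ) / (a σ * (σ • (y : (EtAlgSep f K)ˣ) / y)) := fun σ => (hu σ).2
  refine H2.mk_eq_mk_iff.mpr ⟨u, ?_, fun p => constUnit_injective (f := f) ?_⟩
  · refine isLocallyConstant_of_comp_injective (constUnit_injective (f := f)) ?_
    rw [show constUnit ∘ u = _ from funext hu']
    exact (ha'.comp Subtype.val).div ((ha.comp Subtype.val).mul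
      (isLocallyConstant_smul_div (y : (EtAlgSep f K)ˣ)))
  · rw [map_mul, hz, hz', map_boundary _ constUnit_smul, coe_boundary_mGrp, coe_boundary_mGrp]
    simp only [hu']
    rw [boundary_div, boundary_mul, boundary_smul_div, mul_one, mul_div_cancel]

include hsurj hker in
/-- Existence of the connecting homomorphism. -/
theorem exists_isConnecting : ∃ U : H1 Gal(K/k) (JTwo f K) →* BrauerTwo k K,
    IsConnecting β U := by
  choose a ha hac using exists_lift (K := K) hsurj
  choose z hz using fun c => exists_isBoundary hker c (ha c) (hac c)
  choose r hr using H1.mk_surjective (G := Gal(K/k)) (A := JTwo f K)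
  have hwd : ∀ (c : Z1 Gal(K/k) (JTwo f K)) (b : Gal(K/k) → MGrp f K) (y : Z2 Gal(K/k) Kˣ),
      IsLocallyConstant b → (∀ σ, β (b σ) = (c : Gal(K/k) → JTwo f K) σ) → IsBoundary b y →
      H2.mk (z (r (H1.mk c))) = H2.mk y := fun c b y hb hbc hy =>
    mk_eq_mk_of_isBoundary hsurj hker (hr (H1.mk c)).symm (ha _) hb (hac _) hbc (hz _) hy
  have htors : ∀ y : Z2 Gal(K/k) Kˣ, (∀ p, (y : Gal(K/k) × Gal(K/k) → Kˣ) p ^ 2 = 1) →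
      H2.mk y ^ 2 = 1 := fun y hy => by
    rw [← map_pow, ← map_one H2.mk]
    exact congrArg H2.mk (Subtype.ext (funext hy))
  let U : H1 Gal(K/k) (JTwo f K) →* BrauerTwo k K :=
    MonoidHom.mk' (fun ξ => ⟨H2.mk (z (r ξ)), htors _ (hz _).sq⟩) (fun ξ η => Subtype.ext (by
      have h := hwd (r ξ * r η) (fun σ => a (r ξ) σ * a (r η) σ) (z (r ξ) * z (r η))
        ((ha _).mul (ha _)) (fun σ => by rw [map_mul, hac, hac]; rfl) fun p => by
          rw [boundary_mul]
          exact (map_mul _ _ _).trans (congrArg₂ (· * ·) (hz _ p) (hz _ p))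
      rwa [map_mul, map_mul, hr, hr] at h))
  refine ⟨U, fun c b hb hbc => ?_⟩
  obtain ⟨y, hy⟩ := exists_isBoundary hker c hb hbc
  exact ⟨y, fun σ τ => hy (σ, τ), fun σ τ => (mem_rootsOfUnity _ _).mpr (hy.sq (σ, τ)),
    hwd c b y hb hbc hy⟩

end Connecting

/-! ### The homomorphism `κ` and the kernels -/

section Kappa

variable {k : Type*} [Field k] {f : k[X]} {K : Type*} [Field K] [Algebra k K] [IsSepClosure k K]

/-- Hilbert 90 for `Kˣ`. -/
theorem exists_smul_div_eq (c : Gal(K/k) → Kˣ) (hloc : IsLocallyConstant c)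
    (hc : ∀ σ τ, c (σ * τ) = σ • c τ * c σ) : ∃ b : Kˣ, ∀ σ, c σ = σ • b / b := by
  obtain ⟨b, hb⟩ := exists_smul_div_eq_of_isOpen ⊤ isOpen_univ c hloc fun σ _ τ _ => hc σ τ
  exact ⟨b, fun σ => hb σ trivial⟩

theorem exists_sq_eq_unit_field (h2 : (2 : k) ≠ 0) (b : Kˣ) : ∃ d : Kˣ, d ^ 2 = b := by
  obtain ⟨e, he⟩ := exists_sq_eq (K := K) h2 (b : K)
  have h0 : e ≠ 0 := by
    rintro rfl
    exact b.ne_zero (by rw [← he]; simp)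
  exact ⟨Units.mk0 e h0, Units.ext he⟩

variable [Nonempty (f.rootSet K)] {β : MGrp f K →*[Gal(K/k)] JTwo f K}
  (hsurj : Function.Surjective β)
  (hker : ∀ m, β m = 1 ↔ ∃ c : Kˣ, c ^ 2 = 1 ∧ constUnit c = (m : (EtAlgSep f K)ˣ))
  {U : H1 Gal(K/k) (JTwo f K) →* BrauerTwo k K} (hU : IsConnecting β U)

include hsurj hker hU in
/-- Exactness at `H¹(J[2])`: by Hilbert 90, it makes no difference that `Υ` takes values in
`H²(Kˣ)` instead of `H²(μ₂(K))`. -/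
theorem exists_map_eq_of_connecting_eq_one (h2 : (2 : k) ≠ 0) (hdeg : f.natDegree = 6)
    (hsep : f.Separable) {ξ : H1 Gal(K/k) (JTwo f K)}
    (hξ : U ξ = 1) : ∃ η : H1 Gal(K/k) (MGrp f K), H1.map β η = ξ := by
  obtain ⟨c, rfl⟩ := H1.mk_surjective ξ
  obtain ⟨a, ha, hac⟩ := exists_lift hsurj c
  obtain ⟨z, hz, -, hUz⟩ := hU c a ha hac
  have hz : IsBoundary a z := fun p => hz p.1 p.2
  rw [hξ] at hUz
  obtain ⟨x, hx, hxz⟩ := H2.mk_eq_mk_iff.mp ((map_one H2.mk).trans hUz)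
  have hxz : ∀ p, (z : Gal(K/k) × Gal(K/k) → Kˣ) p = boundary x p := fun p =>
    (hxz p).trans (one_mul _)
  -- the square of the cochain `x` is a cocycle with values in `Kˣ`, hence split
  obtain ⟨b, hb⟩ := exists_smul_div_eq (fun σ => x σ * x σ) (hx.mul hx)
    ((boundary_eq_one_iff (a := fun σ => x σ * x σ)).mp fun p => by
      rw [boundary_mul, ← hxz, ← pow_two, hz.sq])
  obtain ⟨d, rfl⟩ := exists_sq_eq_unit_field h2 b
  let u : Gal(K/k) → Kˣ := fun σ => x σ / (σ • d / d)
  have hu2 : ∀ σ, u σ ^ 2 = 1 := fun σ => by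
    rw [div_pow, pow_two (x σ), hb, div_pow, smul_pow', div_self']
  have huz : ∀ p, boundary u p = (z : Gal(K/k) × Gal(K/k) → Kˣ) p := fun p => by
    rw [boundary_div, boundary_smul_div, div_one, hxz]
  have hmem : ∀ σ, ∃ m : MGrp f K, (m : (EtAlgSep f K)ˣ) = constUnit (u σ) ∧ β m = 1 := fun σ => by
    have := IsSepClosure.sep_closed k (K := K)
    exact ⟨⟨_, constUnit_mem_normOneMu2 hsep hdeg (hu2 σ)⟩, rfl,
      (hker _).mpr ⟨u σ, hu2 σ, rfl⟩⟩
  choose v hv hv1 using hmem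
  have hd : IsLocallyConstant fun σ : Gal(K/k) => σ • d / d :=
    (isLocallyConstant_of_comp_injective Units.val_injective
      (isLocallyConstant_smul_field (d : K))).comp (· / d)
  have hvl : IsLocallyConstant v := by
    refine isLocallyConstant_of_comp_injective Subtype.val_injective ?_
    rw [show Subtype.val ∘ v = _ from funext hv]
    exact (hx.div hd).comp constUnit
  have hcoc : ∀ σ τ, a (σ * τ) / v (σ * τ) = σ • (a τ / v τ) * (a σ / v σ) :=
    (boundary_eq_one_iff (a := fun σ => a σ / v σ)).mp fun p => by
      refine Subtype.ext ?_
      rw [boundary_div, Subgroup.coe_div, ← hz p, coe_boundary_mGrp]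
      simp only [hv]
      rw [← map_boundary _ constUnit_smul, huz, div_self']
      rfl
  refine ⟨H1.mk ⟨fun σ => a σ / v σ, ha.div hvl, hcoc⟩, ?_⟩
  rw [H1.map_mk]
  refine congrArg H1.mk (Z1.ext fun σ => ?_)
  change β (a σ / v σ) = _
  rw [_root_.map_div, hv1, div_one, hac]

/-- The kernel of `Lˣ / Lˣ² ≅ H¹(μ₂(L_K)) → H¹(μ₂(L_K)/μ₂(K))`. -/
theorem map_kummer_symm_eq_one_iff (h2 : (2 : k) ≠ 0) (hsep : f.Separable)
    {θ : H1 Gal(K/k) (Mu2 f K) ≃* SqClasses f} (hθ : IsKummer θ) (δ : (EtAlg f)ˣ) :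
    H1.map (mu2ToQuot f K) (θ.symm (QuotientGroup.mk δ)) = 1 ↔ δ ∈ squaresConsts f := by
  have hmk : ∀ (ε : (EtAlgSep f K)ˣ), ε ^ 2 = unitsIncl δ → ∃ c : Z1 Gal(K/k) (Mu2 f K),
      (∀ σ, (((c : Gal(K/k) → Mu2 f K) σ : Mu2 f K) : (EtAlgSep f K)ˣ) = σ • ε / ε) ∧
      θ.symm (QuotientGroup.mk δ) = H1.mk c := fun ε hε => by
    obtain ⟨c, hc, h⟩ := hθ δ ε hε
    exact ⟨c, hc, by rw [← h, MulEquiv.symm_apply_apply]⟩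
  have hconst : ∀ c : kˣ, (unitsIncl (Units.map (algebraMap k (EtAlg f)).toMonoidHom c) :
      (EtAlgSep f K)ˣ) = constUnit (Units.map (algebraMap k K).toMonoidHom c) := fun c => by
    refine Units.ext ?_
    change (1 : K) ⊗ₜ[k] algebraMap k (EtAlg f) c = algebraMap k K c ⊗ₜ[k] (1 : EtAlg f)
    rw [Algebra.algebraMap_eq_smul_one, Algebra.algebraMap_eq_smul_one, TensorProduct.smul_tmul]
  constructor
  · intro h
    obtain ⟨ε, hε⟩ := exists_sq_eq_unit h2 hsep (unitsIncl (K := K) δ)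
    obtain ⟨c, hc, hθc⟩ := hmk ε hε
    rw [hθc, H1.map_mk, H1.mk_eq_one_iff] at h
    obtain ⟨p, hp⟩ := h
    obtain ⟨p, rfl⟩ := QuotientGroup.mk_surjective p
    have h1 : ∀ σ, ∃ u : Kˣ, u ^ 2 = 1 ∧
        (constUnit u : (EtAlgSep f K)ˣ) = σ • (ε / (p : (EtAlgSep f K)ˣ)) / (ε / (p : (EtAlgSep f K)ˣ)) := fun σ => by
      have h3 : mu2ToQuot f K ((c : Gal(K/k) → Mu2 f K) σ / (σ • p / p)) = 1 := by
        rw [_root_.map_div, _root_.map_div, map_smul, div_eq_one]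
        exact hp σ
      obtain ⟨u, hu, hu'⟩ := mu2ToQuot_eq_one_iff.mp h3
      refine ⟨u, hu, hu'.trans ?_⟩
      change (((c : Gal(K/k) → Mu2 f K) σ : Mu2 f K) : (EtAlgSep f K)ˣ) / (σ • (p : (EtAlgSep f K)ˣ) / p) = _
      rw [hc, smul_div', div_div_div_comm]
    choose u hu hu' using h1
    -- split the sign cocycle `u` in `Kˣ`; then `ε / (p b)` is invariant, and so is `b ^ 2`
    obtain ⟨b, hb⟩ := exists_smul_div_eq u
      (isLocallyConstant_of_comp_injective (constUnit_injective (f := f)) (by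
        rw [show constUnit ∘ u = _ from funext hu']
        exact isLocallyConstant_smul_div _))
      fun σ τ => constUnit_injective (f := f) (by
        rw [map_mul, constUnit_smul, hu', hu', hu', smul_div_mul])
    obtain ⟨l, hl⟩ := exists_eq_unitsIncl (ε / (p : (EtAlgSep f K)ˣ) / constUnit b) fun σ => by
      rw [smul_div', ← constUnit_smul, div_eq_div_iff_div_eq_div, ← hu', hb, _root_.map_div]
    obtain ⟨n, hn⟩ : ∃ n : kˣ, Units.map (algebraMap k K).toMonoidHom n = b ^ 2 := by
      obtain ⟨n, hn⟩ := (InfiniteGalois.mem_range_algebraMap_iff_fixed (k := k)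
        ((b : K) ^ 2)).mpr fun σ => by
          have h4 : σ • b ^ 2 = b ^ 2 := by
            rw [← div_eq_one, smul_pow', ← div_pow, ← hb, hu]
          exact congrArg Units.val h4
      have h0 : n ≠ 0 := by
        rintro rfl
        exact pow_ne_zero 2 b.ne_zero (by rw [← hn, map_zero])
      exact ⟨Units.mk0 n h0, Units.ext hn⟩
    have hδ : δ = l ^ 2 * Units.map (algebraMap k (EtAlg f)).toMonoidHom n := by
      refine unitsIncl_injective (K := K) ?_
      have hp2 : (p : (EtAlgSep f K)ˣ) ^ 2 = 1 := (mem_rootsOfUnity _ _).mp p.2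
      rw [map_mul, map_pow, hconst, hn, ← hl, map_pow, div_pow, div_pow, hp2, div_one, hε,
        div_mul_cancel]
    rw [hδ]
    exact mul_mem (Subgroup.mem_sup_left ⟨l, rfl⟩) (Subgroup.mem_sup_right ⟨n, rfl⟩)
  · intro h
    obtain ⟨_, ⟨l, rfl⟩, _, ⟨n, rfl⟩, rfl⟩ := Subgroup.mem_sup.mp h
    obtain ⟨b, hb⟩ := exists_sq_eq_unit_field (K := K) h2 (Units.map (algebraMap k K).toMonoidHom n)
    obtain ⟨c, hc, hθc⟩ := hmk (unitsIncl l * constUnit b) (by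
      rw [mul_pow, ← map_pow, ← map_pow, hb, map_mul, hconst]
      rfl)
    rw [hθc, H1.map_mk, H1.mk_eq_one_iff]
    refine ⟨1, fun σ => ?_⟩
    rw [smul_one, div_one]
    refine mu2ToQuot_eq_one_iff.mpr ⟨σ • b / b, ?_, ?_⟩
    · rw [div_pow, ← smul_pow', hb, div_eq_one]
      exact Units.ext (AlgEquiv.commutes σ (n : k))
    · rw [hc, _root_.map_div, constUnit_smul, smul_mul', smul_unitsIncl, mul_div_mul_left_eq_div]

/-- The injection `Lˣ / Lˣ² kˣ → H¹(μ₂(L_K)/μ₂(K))`. -/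
theorem exists_squaresConsts_hom (h2 : (2 : k) ≠ 0) (hsep : f.Separable)
    {θ : H1 Gal(K/k) (Mu2 f K) ≃* SqClasses f} (hθ : IsKummer θ) :
    ∃ Ψ : (EtAlg f)ˣ ⧸ squaresConsts f →* H1 Gal(K/k) (Mu2Quot f K), Function.Injective Ψ ∧
      ∀ δ : (EtAlg f)ˣ, Ψ (QuotientGroup.mk δ) =
        H1.map (mu2ToQuot f K) (θ.symm (QuotientGroup.mk δ)) := by
  let φ : (EtAlg f)ˣ →* H1 Gal(K/k) (Mu2Quot f K) :=
    ((H1.map (mu2ToQuot f K)).comp θ.symm.toMonoidHom).comp (QuotientGroup.mk' _)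
  have hφ : ∀ δ, φ δ = 1 ↔ δ ∈ squaresConsts f := map_kummer_symm_eq_one_iff h2 hsep hθ
  refine ⟨QuotientGroup.lift _ φ fun δ h => (hφ δ).mpr h, ?_, fun δ => rfl⟩
  refine (injective_iff_map_eq_one _).mpr fun x hx => ?_
  induction x using QuotientGroup.induction_on with
  | H δ => exact (QuotientGroup.eq_one_iff δ).mpr ((hφ δ).mp hx)

variable {e : JTwo f K →*[Gal(K/k)] Mu2Quot f K} (he : Function.Injective e)
  (heβ : ∀ m, e (β m) = mu2ToQuot f K (mToMu2 f K m))

include hsurj hker hU heβ in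
/-- Existence and uniqueness of `κ`, which has the same kernel as `ϵ_*`. -/
theorem exists_kappa (h2 : (2 : k) ≠ 0) (hdeg : f.natDegree = 6) (hsep : f.Separable)
    {θ : H1 Gal(K/k) (Mu2 f K) ≃* SqClasses f} (hθ : IsKummer θ) :
    ∃ κ : U.ker →* (EtAlg f)ˣ ⧸ squaresConsts f, (∀ κ', IsKappa e θ U.ker κ' ↔ κ' = κ) ∧
      ∀ ξ, κ ξ = 1 ↔ H1.map e (ξ : H1 Gal(K/k) (JTwo f K)) = 1 := by
  obtain ⟨Ψ, hΨ, hΨδ⟩ := exists_squaresConsts_hom h2 hsep hθ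
  have hrange : ∀ ξ : U.ker, ∃ y, Ψ y = H1.map e (ξ : H1 Gal(K/k) (JTwo f K)) := fun ξ => by
    obtain ⟨η, hη⟩ := exists_map_eq_of_connecting_eq_one hsurj hker hU h2 hdeg hsep ξ.2
    obtain ⟨δ, hδ⟩ := QuotientGroup.mk_surjective (θ (H1.map (mToMu2 f K) η))
    exact ⟨QuotientGroup.mk δ, by
      rw [hΨδ, hδ, MulEquiv.symm_apply_apply, ← hη, map_map_eq heβ]⟩
  choose κ hκ using hrange
  have hkappa : ∀ κ' : U.ker →* (EtAlg f)ˣ ⧸ squaresConsts f, IsKappa e θ U.ker κ' ↔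
      ∀ ξ, Ψ (κ' ξ) = H1.map e (ξ : H1 Gal(K/k) (JTwo f K)) := fun κ' => by
    constructor
    · intro h ξ
      obtain ⟨δ, hδ⟩ := QuotientGroup.mk_surjective (κ' ξ)
      rw [h ξ δ hδ.symm, ← hδ, hΨδ]
    · intro h ξ δ hδ
      rw [← h, hδ, hΨδ]
  refine ⟨MonoidHom.mk' κ fun ξ η => hΨ ?_, fun κ' => ?_, fun ξ => ?_⟩
  · rw [map_mul, hκ, hκ, hκ, Subgroup.coe_mul, map_mul]
  · rw [hkappa]
    constructor
    · intro h
      ext ξ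
      exact hΨ ((h ξ).trans (hκ ξ).symm)
    · rintro rfl
      exact hκ
  · rw [← hκ, map_eq_one_iff Ψ hΨ]
    rfl

include he heβ in
/-- The kernel of `ϵ_*` is generated by the image of `(1, -1)`: if `ϵ(c(σ)) = σ(q)/q` for some
`q` in `μ₂(L_K)`, then `c` splits when `N(q) = 1`, and `q` is a root of `(1, -1)` when
`N(q) = -1`. -/
theorem ker_map_epsilon (h2 : (2 : k) ≠ 0) (hsep : f.Separable)
    {γ : Gam f ⧸ (chi f).range ≃* H1 Gal(K/k) (MGrp f K)} (hγ : IsGamma γ)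
    {θ : H1 Gal(K/k) (Mu2 f K) ≃* SqClasses f} (hθ : IsKummer θ) :
    (H1.map e).ker = Subgroup.zpowers (H1.map β (γ (QuotientGroup.mk (oneNegOne f)))) := by
  refine le_antisymm (fun ξ hξ => ?_) (Subgroup.zpowers_le.mpr ?_)
  · obtain ⟨c, rfl⟩ := H1.mk_surjective ξ
    rw [MonoidHom.mem_ker, H1.map_mk, H1.mk_eq_one_iff] at hξ
    obtain ⟨q, hq⟩ := hξ
    obtain ⟨q, rfl⟩ := QuotientGroup.mk_surjective q
    have hq : ∀ σ, e ((c : Gal(K/k) → JTwo f K) σ) = mu2ToQuot f K (σ • q / q) := hq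
    have hq2 : (q : (EtAlgSep f K)ˣ) ^ 2 = 1 := (mem_rootsOfUnity _ _).mp q.2
    have hN : Algebra.norm K ((q : (EtAlgSep f K)ˣ) : EtAlgSep f K) ^ 2 = 1 := by
      rw [← map_pow, ← Units.val_pow_eq_pow_val, hq2, Units.val_one, map_one]
    rw [← one_pow 2, sq_eq_sq_iff_eq_or_eq_neg] at hN
    rcases hN with hN | hN
    · let m : MGrp f K := ⟨q, mem_normOneMu2_iff.mpr ⟨hq2, hN⟩⟩
      have : H1.mk c = 1 := H1.mk_eq_one_iff.mpr ⟨β m, fun σ => he (by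
        rw [hq, ← map_smul, ← _root_.map_div, heβ]
        rfl)⟩
      rw [this]
      exact one_mem _
    · have hroot : IsRootOf (oneNegOne f) (q : (EtAlgSep f K)ˣ) :=
        ⟨hq2.trans (map_one _).symm, hN.trans (by simp [oneNegOne])⟩
      obtain ⟨d, hd, hγd⟩ := hγ _ _ hroot
      have hcd : c = Z1.map β d := Z1.ext fun σ => he (by
        rw [hq]
        refine Eq.trans ?_ (heβ _).symm
        exact congrArg (mu2ToQuot f K) (Subtype.ext (hd σ).symm))
      rw [hγd, H1.map_mk, hcd]
      exact Subgroup.mem_zpowers _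
  · rw [MonoidHom.mem_ker, map_map_eq heβ]
    have h := kummer_map_gamma h2 hsep ‹_› hγ hθ (oneNegOne f)
    rw [← MulEquiv.eq_symm_apply] at h
    rw [h, map_kummer_symm_eq_one_iff h2 hsep hθ]
    exact one_mem _

end Kappa

end TwoDescent

end

theorem mainTheorem3 {k : Type*} [Field k] (hchar : (2 : k) ≠ 0) (f : k[X]) (hdeg : f.natDegree = 6)
    (hsep : f.Separable) (K : Type*) [Field K] [Algebra k K] [IsSepClosure k K] :
    -- every pair in `Γ` has a root, and `γ` exists and is unique
    (∀ x : Gam f, ∃ ε : (EtAlgSep f K)ˣ, IsRootOf x ε) ∧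
    ∃ γ : Gam f ⧸ (chi f).range ≃* H1 Gal(K/k) (MGrp f K),
      (∀ γ', IsGamma γ' ↔ γ' = γ) ∧
    -- the Kummer isomorphism, and the composition of `γ` with `H¹(M) → Lˣ / Lˣ²`
    ∃ θ : H1 Gal(K/k) (Mu2 f K) ≃* SqClasses f,
      (∀ θ', IsKummer θ' ↔ θ' = θ) ∧
      (∀ x : Gam f, θ (H1.map (mToMu2 f K) (γ (QuotientGroup.mk x))) =
        QuotientGroup.mk (x : (EtAlg f)ˣ × kˣ).1) ∧
    -- the Weierstrass points and the homomorphisms `β`, `ϵ`, `Υ`, `κ`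
    ∃ w : f.rootSet K → Place f K, (∀ ω v, IsWeierstrassPoint ω v ↔ v = w ω) ∧
    ∃ β : MGrp f K →*[Gal(K/k)] JTwo f K,
      (∀ β' : MGrp f K →* JTwo f K, IsBeta w β' ↔ β' = β) ∧
    ∃ e : JTwo f K →*[Gal(K/k)] Mu2Quot f K,
      (∀ e' : JTwo f K →* Mu2Quot f K, IsEpsilon w e' ↔ e' = e) ∧
    ∃ U : H1 Gal(K/k) (JTwo f K) →* BrauerTwo k K,
      (∀ U', IsConnecting β U' ↔ U' = U) ∧
    ∃ κ : U.ker →* (EtAlg f)ˣ ⧸ squaresConsts f,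
      (∀ κ', IsKappa e θ U.ker κ' ↔ κ' = κ) ∧
    -- the kernel of `ϵ_*` and of `κ`
      κ.ker.map U.ker.subtype = (H1.map e).ker ∧
      (H1.map e).ker =
        Subgroup.zpowers (H1.map β (γ (QuotientGroup.mk (oneNegOne f)))) := by
  have := IsSepClosure.sep_closed k (K := K)
  have hΩ : Nonempty (f.rootSet K) := by
    rw [← Fintype.card_pos_iff, card_rootSet hsep, hdeg]
    norm_num
  obtain ⟨γ, hγ⟩ := exists_isGamma (K := K) hchar hsep hΩ
  obtain ⟨θ, hθ⟩ := exists_isKummer (K := K) hchar hsep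
  obtain ⟨w, hw⟩ := exists_isWeierstrassFamily (K := K) hchar hdeg hsep
  obtain ⟨β, hβ, hsurj, hker⟩ := exists_beta hchar hdeg hsep hw
  obtain ⟨e, he, hinj, heβ⟩ := exists_epsilon hsep ((hβ _).mpr rfl) hsurj hker
  obtain ⟨U, hU⟩ := exists_isConnecting hsurj hker
  obtain ⟨κ, hκ, hκ1⟩ := exists_kappa hsurj hker hU heβ hchar hdeg hsep hθ
  have hE := ker_map_epsilon hinj heβ hchar hsep hγ hθ
  refine ⟨exists_isRootOf hchar hsep hΩ, γ,
    fun γ' => ⟨isGamma_unique hchar hsep hΩ hγ, fun h => h ▸ hγ⟩, θ,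
    fun θ' => ⟨isKummer_unique hchar hsep hθ, fun h => h ▸ hθ⟩,
    kummer_map_gamma hchar hsep hΩ hγ hθ, w, hw.isWeierstrassPoint_iff hdeg hsep, β, hβ, e, he, U,
    fun U' => ⟨isConnecting_unique hsurj hU, fun h => h ▸ hU⟩, κ, hκ, ?_, hE⟩
  ext ξ
  constructor
  · rintro ⟨ξ, hξ, rfl⟩
    exact (hκ1 ξ).mp hξ
  · intro hξ
    have hξU : ξ ∈ U.ker := by
      have h : (H1.map e).ker ≤ U.ker := by
        rw [hE, Subgroup.zpowers_le]
        exact connecting_map_eq_one hU _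
      exact h hξ
    exact ⟨⟨ξ, hξU⟩, (hκ1 ⟨ξ, hξU⟩).mpr hξ, rfl⟩
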